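/- **Theorem 1.2.** *Model.* A star network has links $1,\dots,N$ with capacities $C_i>0$. A route is an unordered pair $ij$ of distinct links; documents arrive on route $ij$ at rate $\lambda_{ij}\ge 0$ and have exponential sizes of parameter $\mu_{ij}>0$. Let $\mathcal R=\{ij:\lambda_{ij}>0\}$, and for $x\in\mathbb R_+^{\mathcal R}$ let $x_i=\sum_{j:\,ij\in\mathcal R}x_{ij}$ and $$\mu_{ij}(x)=\mu_{ij}\,x_{ij}\Big(\frac{C_i}{x_i}\wedge\frac{C_j}{x_j}\Big)\quad(\mu_{ij}(x)=0\text{ if }x_{ij}=0).$$ Let $Q(t,y)$, $t\ge0$, be the Markov jump process on $\mathbb Z_+^{\mathcal R}$ started from $y$ which, from a state $z$, jumps to $z+e_{ij}$ at rate $\lambda_{ij}$ and to $z-e_{ij}$ at rate $\mu_{ij}(z)$, $ij\in\mathcal R$. Assume that $Q$ is ergodic (irreducible and positive recurrent). For $\Lambda\subset\mathcal R$ let $\mathbb R^\Lambda=\{D\in\mathbb R^{\mathcal R}:D_{ij}=0\ \forall ij\notin\Lambda\}$, let the face of $\Lambda$ be the set of $x\in\mathbb R_+^{\mathcal R}$ with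 $x_{ij}>0$ exactly for $ij\in\Lambda$, and let $\Lambda_1$ be the set of routes of $\mathcal R\setminus\Lambda$ sharing a link with some route of $\Lambda$. For $x\in\mathbb R_+^{\mathcal R}$ put $\Lambda(x)=\{ij\in\mathcal R:x_{ij}>0\}$ and $\Lambda_1(x)=(\Lambda(x))_1$. Let $|\cdot|$ be the maximum norm on $\mathbb R^{\mathcal R}$. *Statement.* For $x\in\mathbb R_+^{\mathcal R}$, $D\in\mathbb R^{\Lambda(x)}$ and $\tau,\delta,\epsilon>0$ put $$p_n(y)=\mathbb P\Big[\sup_{t\in[0,n\tau]}|Q(t,y)-nx-Dt|<\delta n\Big],$$ $$F^-_{x,D}(\tau,\delta,\epsilon)=\liminf_{n\to\infty}\inf_{|y-nx|<\epsilon n}\frac1{n\tau}\log p_n(y),\qquad F^+_{x,D}(\tau,\delta,\epsilon)=\limsup_{n\to\infty}\sup_{|y-nx|<\epsilon n}\frac1{n\tau}\log p_n(y),$$ where $y\in\mathbb Z_+^{\mathcal R}$ and $\log 0=-\infty$. Then: 1. For all $x\in\mathbb R_+^{\mathcal R}$ and $D\in\mathbb R^{\Lambda(x)}$ the following iterated limits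 (as $\tau,\delta,\epsilon$ decrease to $0$) exist and $$\lim_{\tau\to0}\lim_{\delta\to0}\lim_{\epsilon\to0}F^-_{x,D}(\tau,\delta,\epsilon)=\lim_{\tau\to0}\lim_{\delta\to0}\lim_{\epsilon\to0}F^+_{x,D}(\tau,\delta,\epsilon)=-L(x,D),\qquad L(x,D)=\sum_{ij\in\Lambda(x)\cup\Lambda_1(x)}l\big(D_{ij}\,\|\,\lambda_{ij},\mu_{ij}(x)\big),$$ where $$l(D\|\lambda,\mu)=D\log\Big(\frac{D+\sqrt{D^2+4\lambda\mu}}{2\lambda}\Big)+\lambda+\mu-\sqrt{D^2+4\lambda\mu}$$ (with $0\log0=0$). 2. If $\Lambda\subset\mathcal R$ and $D\in\mathbb R^\Lambda$ are fixed, both limits in $\tau$ are uniform in $x$ on every compact subset of the face of $\Lambda$. 3. $l(D\|\lambda,\mu)\ge0$ whenever $\lambda>0$ and either $\mu>0$, or $\mu=0$ and $D\ge0$. -/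

import Mathlib

open MeasureTheory ProbabilityTheory Filter Topology
open scoped NNReal ENNReal

/-- Routes of length two through the hub: unordered pairs of distinct links. -/
abbrev Route (N : ℕ) : Type := {e : Sym2 (Fin N) // ¬ e.IsDiag}

/-- Parameters of a star network with `N` links: link capacities, arrival rates and
document-size parameters of the routes. -/
structure StarNetwork (N : ℕ) where
  cap : Fin N → ℝ
  cap_pos : ∀ i, 0 < cap i
  lam : Route N → ℝ
  lam_nonneg : ∀ e, 0 ≤ lam e
  mu : Route N → ℝ
  mu_pos : ∀ e, 0 < mu e

/-- The cost `l(D ‖ lam, mu)` for an M/M/1 queue with arrival rate `lam` and service rate `mu`,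
far from the origin, to follow the drift `D`. -/
noncomputable def mm1Cost (D lam mu : ℝ) : ℝ :=
  D * Real.log ((D + √(D ^ 2 + 4 * lam * mu)) / (2 * lam)) + lam + mu
    - √(D ^ 2 + 4 * lam * mu)

/-- `a = lim_{δ → 0+} lim_{ε → 0+} F δ ε`, all the limits existing in the extended reals. -/
def IsInnerLimit (F : ℝ → ℝ → EReal) (a : EReal) : Prop :=
  ∃ A : ℝ → EReal, (∀ δ : ℝ, 0 < δ → Tendsto (F δ) (𝓝[>] 0) (𝓝 (A δ))) ∧
    Tendsto A (𝓝[>] 0) (𝓝 a)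

namespace StarNetwork

variable {N : ℕ} (S : StarNetwork N)

/-- The active routes, those with a positive arrival rate. -/
abbrev Active : Type := {e : Route N // 0 < S.lam e}

/-- States of the network: number of connections on each active route. -/
abbrev State : Type := S.Active → ℕ

variable {S}

/-- The link `i` is one of the two ends of the route `e`. -/
abbrev Uses (e : S.Active) (i : Fin N) : Prop := i ∈ e.1.1

/-- `x_i`, the total of `x` over the routes that use link `i`. -/
noncomputable def load (x : S.Active → ℝ) (i : Fin N) : ℝ :=
  ∑ e : S.Active with Uses e i, x e

/-- Service rate `μ_ij(x) = μ_ij x_ij min (C_i / x_i) (C_j / x_j)` of the min policy;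
it vanishes when `x_ij = 0`. -/
noncomputable def serviceRate (x : S.Active → ℝ) (e : S.Active) : ℝ :=
  S.mu e.1 * (x e * (e.1.1.map (fun i => S.cap i / load x i)).inf)

/-- A state seen as a real vector. -/
def toReal (y : S.State) : S.Active → ℝ := fun e => (y e : ℝ)

/-- Jump rate `q(x, y)`: `λ_ij` if `y - x = e_ij`, `μ_ij(x)` if `y - x = - e_ij`, else `0`. -/
noncomputable def jumpRate (x y : S.State) : ℝ :=
  ∑ e : S.Active, ((if y = x + Pi.single e 1 then S.lam e.1 else 0) +
    (if x = y + Pi.single e 1 then serviceRate (toReal x) e else 0))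

/-- The generator `R f (x) = ∑_y q(x, y) (f y - f x)`; only finitely many terms are nonzero. -/
noncomputable def generator (f : S.State → ℝ) (x : S.State) : ℝ :=
  ∑' y : S.State, jumpRate x y * (f y - f x)

variable (S) in
/-- Ergodicity: the chain is irreducible and has a stationary probability distribution
(the rates are bounded, so stationarity is `π R = 0`). -/
def Ergodic : Prop :=
  (∀ x y : S.State, Relation.ReflTransGen (fun a b : S.State => 0 < jumpRate a b) x y) ∧
  ∃ p : S.State → ℝ, (∀ x, 0 ≤ p x) ∧ HasSum p 1 ∧
    ∀ f : S.State → ℝ, (∃ c : ℝ, ∀ x, |f x| ≤ c) → HasSum (fun x => p x * generator f x) 0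

/-- `X` is a Markov process with generator `R` started from `y`, with right-continuous paths
having left limits, expressed by the (well-posed, the rates being bounded) martingale problem
for `R` with respect to the natural filtration of `X`. -/
structure IsNetworkProcess {Ω : Type*} [MeasurableSpace Ω] (P : Measure Ω)
    (y : S.State) (X : ℝ≥0 → Ω → S.State) : Prop where
  measurable : ∀ t, Measurable (X t)
  start : ∀ᵐ ω ∂P, X 0 ω = y
  right_cont : ∀ ω t, ContinuousWithinAt (fun s => X s ω) (Set.Ici t) t
  left_lim : ∀ ω t, ∃ z, Tendsto (fun s => X s ω) (𝓝[<] t) (𝓝 z)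
  martingale : ∀ f : S.State → ℝ, (∃ c : ℝ, ∀ x, |f x| ≤ c) →
    Martingale
      (fun (t : ℝ≥0) ω => f (X t ω) - f (X 0 ω)
        - ∫ s in (0 : ℝ)..(t : ℝ), generator f (X s.toNNReal ω))
      (Filtration.natural X (fun t => (measurable t).stronglyMeasurable)) P

/-- `Λ(x)`, the set of active routes with `x_ij > 0`. -/
noncomputable def support (x : S.Active → ℝ) : Finset S.Active := {e | 0 < x e}

/-- The face of the orthant attached to `Λ`. -/
def face (Λ : Finset S.Active) : Set (S.Active → ℝ) :=
  {x | (∀ e ∈ Λ, 0 < x e) ∧ ∀ e ∉ Λ, x e = 0}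

/-- The vector space `ℝ^Λ`. -/
def driftSpace (Λ : Finset S.Active) : Set (S.Active → ℝ) := {D | ∀ e ∉ Λ, D e = 0}

/-- `Λ₁`, the routes outside `Λ` that share a link with a route of `Λ`. -/
noncomputable def jammed (Λ : Finset S.Active) : Finset S.Active :=
  {e | e ∉ Λ ∧ ∃ i, Uses e i ∧ ∃ r ∈ Λ, Uses r i}

/-- The local rate function `L(x, D)`. -/
noncomputable def localRate (x D : S.Active → ℝ) : ℝ :=
  ∑ e ∈ support x ∪ jammed (support x), mm1Cost (D e) (S.lam e.1) (serviceRate x e)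

section Rates

variable {Ω : Type*} [MeasurableSpace Ω] (P : Measure Ω)
  (Q : S.State → ℝ≥0 → Ω → S.State) (x D : S.Active → ℝ)

/-- The event `sup_{t ∈ [0, n τ]} |Q(t, y) - n x - D t| < δ n` (maximum norm). -/
def tube (τ δ : ℝ) (n : ℕ) (y : S.State) : Set Ω :=
  {ω | ⨆ (t : ℝ≥0) (_ : (t : ℝ) ≤ n * τ),
      ‖toReal (Q y t ω) - (n : ℝ) • x - (t : ℝ) • D‖ₑ < ENNReal.ofReal (δ * n)}

/-- `(1 / (n τ)) log ℙ[sup_{t ∈ [0, n τ]} |Q(t, y) - n x - D t| < δ n]`, with `log 0 = -∞`. -/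
noncomputable def logProb (τ δ : ℝ) (n : ℕ) (y : S.State) : EReal :=
  ((1 / (n * τ) : ℝ) : EReal) * ENNReal.log (P (tube Q x D τ δ n y))

/-- `liminf_n inf_{|y - n x| < ε n}` of the normalized log-probability. -/
noncomputable def lowerRate (τ δ ε : ℝ) : EReal :=
  liminf (fun n : ℕ => ⨅ (y : S.State) (_ : ‖toReal y - (n : ℝ) • x‖ < ε * n),
    logProb P Q x D τ δ n y) atTop

/-- `limsup_n sup_{|y - n x| < ε n}` of the normalized log-probability. -/
noncomputable def upperRate (τ δ ε : ℝ) : EReal :=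
  limsup (fun n : ℕ => ⨆ (y : S.State) (_ : ‖toReal y - (n : ℝ) • x‖ < ε * n),
    logProb P Q x D τ δ n y) atTop

end Rates

end StarNetwork

/-! Around `n x`, over times of order `n`, the routes are of three kinds. On a route of the support
the service rate is continuous and homogeneous of degree zero, so the route behaves like an M/M/1
queue with rates `λ` and `μ(x)`, and following the drift `D` costs `l(D ‖ λ, μ(x))`. A jammed route
shares a link with a population of order `n`, so its service rate is negligible: it stays near zero
only by refusing its arrivals, at cost `λ = l(0 ‖ λ, 0)`. Any other route shares links only with
routes outside the support. Ergodicity makes every link underloaded (`Ergodic.sum_lam_div_mu_lt`),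
so these idle routes remain near zero at no exponential cost.

Both estimates are comparison principles for the martingale problem, without any change of measure.
For the upper bound, the function `exp (θ · q)`, with `θ` optimal on the support, very negative on
jammed routes and zero on idle ones, is multiplied by the generator near `n x` by at most about `-L
+ θ · D` (`exists_upper_tilt`). Then `measureReal_mul_le_exp` bounds the probability of the tube
(`exists_upperRate_le`).

For the lower bound, `le_mul_measureReal` turns a space-time subsolution that is positive only
inside a tube into a lower bound for the probability of that tube. The subsolution is a product
(`Confinement.sub`). The first factor is an exponential tilt, bent quadratically so that the tilted
process drifts back to the line of slope `D`. The second is one minus exponential barriers placed at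
the edges of the tube. `Confinement.subsolution` reduces its inequality to estimates on single
routes, `exists_routeBound_busy` and `exists_routeBound_idle`, and the outcome is
`exists_le_lowerRate`.

The inner limits exist by monotonicity in `ε` and `δ`. The two bounds then enclose the outer limits,
with one radius serving for the time scale and for nearby points of the face, so compactness gives
uniformity. Nonnegativity of `l` holds because it is a sum of relative entropies. -/

/-! ### Service rates and the generator as a finite sum. -/

lemma sym2_inf_map_le {α β : Type*} [LinearOrder β] (f : α → β) {z : Sym2 α} {i : α}
    (hi : i ∈ z) : (z.map f).inf ≤ f i := by
  induction z with
  | _ a b =>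
    rcases Sym2.mem_iff.1 hi with rfl | rfl <;> simp

lemma le_sym2_inf_map {α β : Type*} [LinearOrder β] (f : α → β) {z : Sym2 α} {c : β}
    (h : ∀ i ∈ z, c ≤ f i) : c ≤ (z.map f).inf := by
  induction z with
  | _ a b => simp [h a (Sym2.mem_mk_left a b), h b (Sym2.mem_mk_right a b)]

namespace StarNetwork

variable {N : ℕ} {S : StarNetwork N}

lemma exists_uses (e : S.Active) : ∃ i, Uses e i :=
  ⟨e.1.1.out.1, Sym2.out_fst_mem _⟩

lemma le_load {x : S.Active → ℝ} (hx : 0 ≤ x) {e : S.Active} {i : Fin N} (h : Uses e i) :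
    x e ≤ load x i :=
  Finset.single_le_sum (f := x) (fun j _ => hx j) (by simp [h])

lemma load_nonneg {x : S.Active → ℝ} (hx : 0 ≤ x) (i : Fin N) : 0 ≤ load x i :=
  Finset.sum_nonneg fun j _ => hx j

lemma serviceRate_le {x : S.Active → ℝ} (hx : 0 ≤ x) {e : S.Active} {i : Fin N} (h : Uses e i) :
    serviceRate x e ≤ S.mu e.1 * (x e * (S.cap i / load x i)) :=
  mul_le_mul_of_nonneg_left (mul_le_mul_of_nonneg_left
    (sym2_inf_map_le (fun i => S.cap i / load x i) h) (hx e)) (S.mu_pos _).le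

lemma le_serviceRate {x : S.Active → ℝ} (hx : 0 ≤ x) {e : S.Active} {c : ℝ}
    (h : ∀ i, Uses e i → c ≤ S.cap i / load x i) :
    S.mu e.1 * (x e * c) ≤ serviceRate x e :=
  mul_le_mul_of_nonneg_left (mul_le_mul_of_nonneg_left
    (le_sym2_inf_map (fun i => S.cap i / load x i) h) (hx e)) (S.mu_pos _).le

lemma serviceRate_nonneg {x : S.Active → ℝ} (hx : 0 ≤ x) (e : S.Active) :
    0 ≤ serviceRate x e := by
  simpa using le_serviceRate (c := 0) hx
    fun i _ => div_nonneg (S.cap_pos i).le (load_nonneg hx i)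

lemma serviceRate_le_cap {x : S.Active → ℝ} (hx : 0 ≤ x) {e : S.Active} {i : Fin N}
    (h : Uses e i) : serviceRate x e ≤ S.mu e.1 * S.cap i := by
  refine (serviceRate_le hx h).trans (mul_le_mul_of_nonneg_left ?_ (S.mu_pos _).le)
  have h1 := le_load hx h
  rcases (hx e).eq_or_lt with h0 | h0
  · rw [← h0]; simpa using (S.cap_pos i).le
  · have : 0 < load x i := lt_of_lt_of_le h0 h1
    rw [mul_div_assoc', div_le_iff₀ this]
    nlinarith [S.cap_pos i]

lemma serviceRate_eq_zero {x : S.Active → ℝ} {e : S.Active} (h : x e = 0) :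
    serviceRate x e = 0 := by
  simp [serviceRate, h]

lemma load_smul (c : ℝ) (x : S.Active → ℝ) (i : Fin N) : load (c • x) i = c * load x i := by
  simp [load, Finset.mul_sum]

/-- The factor `x e` scales by `c` and the shares `C_i / x_i` by its inverse. This is what lets the
rates in a state of size `n` be read off at its rescaled position. -/
lemma serviceRate_smul {c : ℝ} (hc : 0 < c) (x : S.Active → ℝ) (e : S.Active) :
    serviceRate (c • x) e = serviceRate x e := by
  unfold serviceRate
  generalize e.1.1 = z
  induction z with
  | _ a b =>
    simp only [Sym2.map_mk, Sym2.inf_mk, load_smul, Pi.smul_apply, smul_eq_mul]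
    have h : ∀ i, S.cap i / (c * load x i) = c⁻¹ * (S.cap i / load x i) := fun i => by
      rw [mul_comm, ← div_div, div_eq_inv_mul]
    rw [h, h, ← mul_min_of_nonneg _ _ (inv_pos.2 hc).le]
    field_simp

lemma toReal_nonneg (q : S.State) : 0 ≤ toReal q := fun e => Nat.cast_nonneg (q e)

/-- The service rate of the route `e` in the state `q`. -/
noncomputable def srv (q : S.State) (e : S.Active) : ℝ := serviceRate (toReal q) e

lemma srv_nonneg (q : S.State) (e : S.Active) : 0 ≤ srv q e :=
  serviceRate_nonneg (toReal_nonneg q) e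

lemma srv_eq_zero {q : S.State} {e : S.Active} (h : q e = 0) : srv q e = 0 :=
  serviceRate_eq_zero (by simp [toReal, h])

lemma lam_pos (e : S.Active) : 0 < S.lam e.1 := e.2

/-- The generator as a finite sum over the possible jumps. -/
lemma generator_eq (f : S.State → ℝ) (q : S.State) :
    generator f q = ∑ e : S.Active, (S.lam e.1 * (f (q + Pi.single e 1) - f q)
      + srv q e * (f (q - Pi.single e 1) - f q)) := by
  unfold generator jumpRate
  simp only [Finset.sum_mul, add_mul]
  refine (hasSum_sum fun e _ => HasSum.add ?_ ?_).tsum_eq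
  · convert hasSum_single (q + Pi.single e 1) ?_ using 1
    · simp
    · intro y hy; simp [hy]
  -- Subtraction in `ℕ` is truncated, so `q - e_ij` is `q` itself on an empty route; the service
  -- rate vanishes there.
  · rcases Nat.eq_zero_or_pos (q e) with h | h
    · have h0 : serviceRate (toReal q) e = 0 := srv_eq_zero h
      rw [srv_eq_zero h]
      simp [h0, hasSum_zero]
    · have hle : Pi.single e 1 ≤ q := by
        intro i
        by_cases hi : i = e
        · subst hi; rw [Pi.single_eq_same]; exact h
        · simp [hi]
      have key : ∀ y : S.State, q = y + Pi.single e 1 ↔ y = q - Pi.single e 1 := fun y =>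
        ⟨fun h => by rw [h, add_tsub_cancel_right], fun h => by rw [h, tsub_add_cancel_of_le hle]⟩
      convert hasSum_single (q - Pi.single e 1) ?_ using 1
      · rw [if_pos ((key _).2 rfl), srv]
      · intro y hy; simp [key, hy]

lemma exists_rate_bound (S : StarNetwork N) :
    ∃ Γ : ℝ, 0 < Γ ∧ ∀ q : S.State, ∑ e : S.Active, (S.lam e.1 + srv q e) ≤ Γ := by
  choose i hi using fun e : S.Active => exists_uses e
  refine ⟨∑ e : S.Active, (S.lam e.1 + S.mu e.1 * S.cap (i e)) + 1, ?_, fun q => ?_⟩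
  · have : 0 ≤ ∑ e : S.Active, (S.lam e.1 + S.mu e.1 * S.cap (i e)) :=
      Finset.sum_nonneg fun e _ => add_nonneg (S.lam_nonneg _)
        (mul_nonneg (S.mu_pos _).le (S.cap_pos _).le)
    linarith
  · have : ∑ e : S.Active, (S.lam e.1 + srv q e)
        ≤ ∑ e : S.Active, (S.lam e.1 + S.mu e.1 * S.cap (i e)) :=
      Finset.sum_le_sum fun e _ =>
        add_le_add le_rfl (serviceRate_le_cap (toReal_nonneg q) (hi e))
    linarith

lemma abs_generator_le {Γ : ℝ} (hΓ : ∀ q : S.State, ∑ e : S.Active, (S.lam e.1 + srv q e) ≤ Γ)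
    {f : S.State → ℝ} {M : ℝ} (hM : 0 ≤ M) (hf : ∀ q, |f q| ≤ M) (q : S.State) :
    |generator f q| ≤ 2 * Γ * M := by
  have hd : ∀ a b : S.State, |f a - f b| ≤ 2 * M := fun a b =>
    (abs_sub _ _).trans (by linarith [hf a, hf b])
  rw [generator_eq]
  calc _ ≤ ∑ e : S.Active, (S.lam e.1 + srv q e) * (2 * M) := by
        refine (Finset.abs_sum_le_sum_abs _ _).trans (Finset.sum_le_sum fun e _ => ?_)
        refine (abs_add_le _ _).trans ?_
        rw [abs_mul, abs_mul, abs_of_nonneg (S.lam_nonneg _), abs_of_nonneg (srv_nonneg q e),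
          add_mul]
        exact add_le_add (mul_le_mul_of_nonneg_left (hd _ _) (S.lam_nonneg _))
          (mul_le_mul_of_nonneg_left (hd _ _) (srv_nonneg q e))
    _ ≤ Γ * (2 * M) := by
        rw [← Finset.sum_mul]
        exact mul_le_mul_of_nonneg_right (hΓ q) (by linarith)
    _ = 2 * Γ * M := by ring

end StarNetwork

/-! ### Dynkin's formula and expectations over short times. -/

namespace StarNetwork

variable {N : ℕ} {S : StarNetwork N}

namespace IsNetworkProcess

variable {Ω : Type*} [MeasurableSpace Ω] {P : Measure Ω} {y : S.State} {X : ℝ≥0 → Ω → S.State}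

/-- The natural filtration of a network process. -/
noncomputable def natFiltration (h : IsNetworkProcess P y X) :
    Filtration ℝ≥0 (inferInstance : MeasurableSpace Ω) :=
  Filtration.natural X (fun t => (h.measurable t).stronglyMeasurable)

lemma measurableSet_preimage (h : IsNetworkProcess P y X) {s t : ℝ≥0} (hst : s ≤ t)
    (A : Set S.State) : MeasurableSet[h.natFiltration t] (X s ⁻¹' A) := by
  have h1 : StronglyMeasurable[h.natFiltration s] (X s) :=
    Filtration.stronglyAdapted_natural (fun t => (h.measurable t).stronglyMeasurable) s
  exact h.natFiltration.mono hst _ (h1.measurable (MeasurableSet.of_discrete (s := A)))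

lemma measurable_uncurry (h : IsNetworkProcess P y X) (F : S.State → ℝ) :
    Measurable (fun p : ℝ × Ω => F (X p.1.toNNReal p.2)) := by
  -- Rounding the time up to a grid keeps it on the right of `u`, where right-continuity applies,
  -- and leaves countably many values. The added one places the grid point beyond `u`.
  let tm : ℕ → ℝ → ℝ := fun k u => ((⌊u * (k + 1)⌋₊ : ℝ) + 1) / (k + 1)
  have htm : ∀ k u, u ≤ tm k u := fun k u => by
    have hk : (0 : ℝ) < k + 1 := by positivity
    rw [le_div_iff₀ hk]
    exact (Nat.lt_floor_add_one _).le
  have hup : ∀ (k : ℕ) (u : ℝ), 0 ≤ u → tm k u ≤ u + 1 / ((k : ℝ) + 1) := fun k u hu => by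
    have hk : (0 : ℝ) < k + 1 := by positivity
    rw [div_le_iff₀ hk, add_mul, one_div, inv_mul_cancel₀ hk.ne']
    have := Nat.floor_le (mul_nonneg hu hk.le)
    linarith
  refine measurable_of_tendsto_metrizable
    (f := fun (k : ℕ) (p : ℝ × Ω) => F (X (tm k p.1).toNNReal p.2)) (fun k => ?_) ?_
  · have h1 : Measurable (fun p : ℕ × Ω => F (X (((p.1 : ℝ) + 1) / (k + 1)).toNNReal p.2)) :=
      measurable_from_prod_countable_right fun m =>
        (measurable_of_countable F).comp (h.measurable (((m : ℝ) + 1) / (k + 1)).toNNReal)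
    have h2 : Measurable (fun p : ℝ × Ω => ((⌊p.1 * (k + 1)⌋₊ : ℕ), p.2)) :=
      (Nat.measurable_floor.comp (measurable_fst.mul_const _)).prodMk measurable_snd
    have h3 := h1.comp h2
    simp only [Function.comp_def] at h3
    exact h3
  · rw [tendsto_pi_nhds]
    rintro ⟨u, ω⟩
    have hc : ContinuousWithinAt (fun s => F (X s ω)) (Set.Ici u.toNNReal) u.toNNReal :=
      (continuous_of_discreteTopology (f := F)).continuousAt.comp_continuousWithinAt
        (h.right_cont ω u.toNNReal)
    refine hc.tendsto.comp (tendsto_nhdsWithin_iff.2 ⟨?_, Eventually.of_forall fun k =>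
      Real.toNNReal_le_toNNReal (htm k u)⟩)
    have hone := tendsto_one_div_add_atTop_nhds_zero_nat (𝕜 := ℝ)
    rcases le_or_gt 0 u with hu | hu
    · refine (continuous_real_toNNReal.tendsto u).comp ?_
      refine tendsto_of_tendsto_of_tendsto_of_le_of_le tendsto_const_nhds
        (h := fun k : ℕ => u + 1 / ((k : ℝ) + 1)) ?_ (fun k => htm k u) (fun k => hup k u hu)
      simpa using hone.const_add u
    · have : ∀ k : ℕ, tm k u = 1 / ((k : ℝ) + 1) := fun k => by
        have : ⌊u * ((k : ℝ) + 1)⌋₊ = 0 :=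
          Nat.floor_of_nonpos (mul_nonpos_of_nonpos_of_nonneg hu.le (by positivity))
        simp [tm, this]
      rw [Real.toNNReal_of_nonpos hu.le]
      simp only [this]
      rw [← Real.toNNReal_zero]
      exact (continuous_real_toNNReal.tendsto 0).comp hone

lemma integrable_comp [IsProbabilityMeasure P] (h : IsNetworkProcess P y X) {F : S.State → ℝ} {M : ℝ}
    (hF : ∀ q, |F q| ≤ M) (t : ℝ≥0) : Integrable (fun ω => F (X t ω)) P :=
  Integrable.of_bound ((measurable_of_countable F).comp (h.measurable t)).aestronglyMeasurable M
    (Eventually.of_forall fun ω => by simpa using hF _)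

lemma intervalIntegrable_comp (h : IsNetworkProcess P y X) {F : S.State → ℝ} {M : ℝ}
    (hF : ∀ q, |F q| ≤ M) (ω : Ω) (a b : ℝ) :
    IntervalIntegrable (fun u : ℝ => F (X u.toNNReal ω)) volume a b := by
  refine (intervalIntegrable_const (c := M)).mono_fun ?_ ?_
  · exact ((h.measurable_uncurry F).comp (measurable_id.prodMk measurable_const)).aestronglyMeasurable
  · exact Eventually.of_forall fun u => by
      simpa using (hF _).trans (le_abs_self M)

variable [IsProbabilityMeasure P]

/-- Dynkin's formula on an event of the past. -/
lemma setIntegral_sub (h : IsNetworkProcess P y X) {Γ : ℝ}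
    (hΓ : ∀ q : S.State, ∑ e : S.Active, (S.lam e.1 + srv q e) ≤ Γ)
    {f : S.State → ℝ} {M : ℝ} (hM : 0 ≤ M) (hf : ∀ q, |f q| ≤ M) {s t : ℝ≥0} (hst : s ≤ t)
    {B : Set Ω} (hB : MeasurableSet[h.natFiltration s] B) :
    ∫ ω in B, f (X t ω) ∂P - ∫ ω in B, f (X s ω) ∂P
      = ∫ u in (s : ℝ)..t, ∫ ω in B, generator f (X u.toNNReal ω) ∂P := by
  have hg : ∀ q, |generator f q| ≤ 2 * Γ * M := abs_generator_le hΓ hM hf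
  have hm := h.martingale f ⟨M, hf⟩
  have heq := hm.setIntegral_eq hst hB
  have hprod : Integrable (Function.uncurry fun (u : ℝ) ω => generator f (X u.toNNReal ω))
      ((volume.restrict (Set.uIoc (s : ℝ) t)).prod (P.restrict B)) := by
    have : IsFiniteMeasure (volume.restrict (Set.uIoc (s : ℝ) t)) := ⟨by simp [Set.uIoc]⟩
    exact Integrable.of_bound (h.measurable_uncurry (generator f)).aestronglyMeasurable
      (2 * Γ * M) (Eventually.of_forall fun p => hg _)
  rw [intervalIntegral_integral_swap hprod, ← integral_sub (h.integrable_comp hf t).integrableOn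
    (h.integrable_comp hf s).integrableOn, ← sub_eq_zero]
  have hi1 := (hm.integrable t).integrableOn (s := B)
  have hi2 := (hm.integrable s).integrableOn (s := B)
  have hpt : ∀ ω, (f (X t ω) - f (X s ω)) - ∫ u in (s : ℝ)..t, generator f (X u.toNNReal ω)
      = (f (X t ω) - f (X 0 ω) - ∫ u in (0 : ℝ)..(t : ℝ), generator f (X u.toNNReal ω))
        - (f (X s ω) - f (X 0 ω) - ∫ u in (0 : ℝ)..(s : ℝ), generator f (X u.toNNReal ω)) := by
    intro ω
    rw [← intervalIntegral.integral_interval_sub_left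
      (h.intervalIntegrable_comp hg ω 0 t) (h.intervalIntegrable_comp hg ω 0 s)]
    ring
  -- The time integral is the increment of `f` minus that of the martingale, both integrable.
  have hint : IntegrableOn (fun ω => ∫ u in (s : ℝ)..t, generator f (X u.toNNReal ω)) B P := by
    have h3 := ((h.integrable_comp hf t).integrableOn (s := B)).sub
      ((h.integrable_comp hf s).integrableOn (s := B))
    refine (h3.sub (hi1.sub hi2)).congr (Eventually.of_forall fun ω => ?_)
    have := hpt ω
    simp only [Pi.sub_apply]
    linarith
  have hi3 : IntegrableOn (fun ω => f (X t ω) - f (X s ω)) B P :=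
    ((h.integrable_comp hf t).integrableOn (s := B)).sub
      ((h.integrable_comp hf s).integrableOn (s := B))
  rw [← integral_sub hi3 hint]
  simp only [hpt]
  rw [integral_sub hi1 hi2, heq, sub_self]

lemma abs_setIntegral_le (f : Ω → ℝ) {M : ℝ} (hf : ∀ ω, |f ω| ≤ M) (B : Set Ω) :
    |∫ ω in B, f ω ∂P| ≤ M := by
  have hM : 0 ≤ M ∨ IsEmpty Ω := by
    rcases isEmpty_or_nonempty Ω with h | ⟨⟨ω⟩⟩
    · exact Or.inr h
    · exact Or.inl ((abs_nonneg _).trans (hf ω))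
  rcases hM with hM | hM
  · have h1 := norm_setIntegral_le_of_norm_le_const (μ := P) (s := B) (f := f) (C := M)
      (measure_lt_top P B) (fun ω _ => hf ω)
    refine h1.trans ?_
    exact mul_le_of_le_one_right hM measureReal_le_one
  · exact absurd (measure_univ (μ := P)) (by simp [Set.univ_eq_empty_iff.2 hM])

/-- Bounded rates make expectations Lipschitz in time. Applied to `generator f` in place of `f`,
this yields the quadratic error over one time step. -/
lemma abs_setIntegral_sub_le (h : IsNetworkProcess P y X) {Γ : ℝ}
    (hΓ : ∀ q : S.State, ∑ e : S.Active, (S.lam e.1 + srv q e) ≤ Γ)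
    {f : S.State → ℝ} {M : ℝ} (hM : 0 ≤ M) (hf : ∀ q, |f q| ≤ M) {s t : ℝ≥0} (hst : s ≤ t)
    {B : Set Ω} (hB : MeasurableSet[h.natFiltration s] B) :
    |∫ ω in B, f (X t ω) ∂P - ∫ ω in B, f (X s ω) ∂P| ≤ 2 * Γ * M * (t - s) := by
  rw [h.setIntegral_sub hΓ hM hf hst hB]
  have := intervalIntegral.norm_integral_le_of_norm_le_const (a := (s : ℝ)) (b := t)
    (f := fun u => ∫ ω in B, generator f (X u.toNNReal ω) ∂P) (C := 2 * Γ * M)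
    (fun u _ => abs_setIntegral_le _ (fun ω => abs_generator_le hΓ hM hf _) B)
  rwa [abs_of_nonneg (sub_nonneg.2 (by exact_mod_cast hst)), Real.norm_eq_abs] at this

/-- Over a short time, the expectation evolves by the generator up to a quadratic error. -/
lemma abs_setIntegral_step_le (h : IsNetworkProcess P y X) {Γ : ℝ} (hΓ0 : 0 ≤ Γ)
    (hΓ : ∀ q : S.State, ∑ e : S.Active, (S.lam e.1 + srv q e) ≤ Γ)
    {f : S.State → ℝ} {M : ℝ} (hM : 0 ≤ M) (hf : ∀ q, |f q| ≤ M) {s t : ℝ≥0} (hst : s ≤ t)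
    {B : Set Ω} (hB : MeasurableSet[h.natFiltration s] B) :
    |∫ ω in B, f (X t ω) ∂P
        - ∫ ω in B, (f (X s ω) + ((t : ℝ) - s) * generator f (X s ω)) ∂P|
      ≤ (2 * Γ) ^ 2 * M * ((t : ℝ) - s) ^ 2 := by
  have hst' : (0 : ℝ) ≤ (t : ℝ) - s := sub_nonneg.2 (by exact_mod_cast hst)
  have hg : ∀ q, |generator f q| ≤ 2 * Γ * M := abs_generator_le hΓ hM hf
  have hgM : 0 ≤ 2 * Γ * M := by positivity
  rw [integral_add (h.integrable_comp hf s).integrableOn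
    ((h.integrable_comp hg s).integrableOn.const_mul _), integral_const_mul, ← sub_sub,
    h.setIntegral_sub hΓ hM hf hst hB]
  have hc : ((t : ℝ) - s) * ∫ ω in B, generator f (X s ω) ∂P
      = ∫ u in (s : ℝ)..t, ∫ ω in B, generator f (X s ω) ∂P := by
    rw [intervalIntegral.integral_const, smul_eq_mul]
  have hii : IntervalIntegrable (fun u : ℝ => ∫ ω in B, generator f (X u.toNNReal ω) ∂P)
      volume s t := by
    refine (intervalIntegrable_const (c := 2 * Γ * M)).mono_fun ?_ ?_
    · exact ((h.measurable_uncurry (generator f)).stronglyMeasurable.integral_prod_right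
        (ν := P.restrict B)).aestronglyMeasurable
    · refine Eventually.of_forall fun u => ?_
      exact (abs_setIntegral_le _ (fun ω => hg _) B).trans (le_abs_self _)
  -- What remains is the variation of the expected `generator f` over the step, controlled by the
  -- Lipschitz bound for the function `generator f`, itself bounded by `2 * Γ * M`.
  rw [hc, ← intervalIntegral.integral_sub hii intervalIntegrable_const]
  have := intervalIntegral.norm_integral_le_of_norm_le_const (a := (s : ℝ)) (b := t)
    (f := fun u : ℝ => (∫ ω in B, generator f (X u.toNNReal ω) ∂P)
      - ∫ ω in B, generator f (X s ω) ∂P) (C := 2 * Γ * (2 * Γ * M) * ((t : ℝ) - s)) ?_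
  · rw [abs_of_nonneg hst', Real.norm_eq_abs] at this
    exact this.trans (le_of_eq (by ring))
  · intro u hu
    rw [Set.uIoc_of_le (by exact_mod_cast hst)] at hu
    have hu0 : 0 ≤ u := s.2.trans hu.1.le
    have hsu : s ≤ u.toNNReal := by
      rw [← Real.toNNReal_coe (r := s)]; exact Real.toNNReal_le_toNNReal hu.1.le
    refine (h.abs_setIntegral_sub_le hΓ hgM hg hsu hB).trans ?_
    rw [Real.coe_toNNReal u hu0]
    exact mul_le_mul_of_nonneg_left (by linarith [hu.2]) (by positivity)

end IsNetworkProcess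

end StarNetwork

/-! ### Comparison principles for the probability of remaining in a set. -/

namespace StarNetwork

variable {N : ℕ} {S : StarNetwork N}

/-- The event that `X` lies in the moving set `A` at the times `0, h, …, k h`. -/
def gridEvent {Ω : Type*} (X : ℝ≥0 → Ω → S.State) (A : ℝ≥0 → Set S.State) (h : ℝ≥0) (k : ℕ) :
    Set Ω :=
  {ω | ∀ j ≤ k, X (j * h) ω ∈ A (j * h)}

lemma gridEvent_succ_subset {Ω : Type*} (X : ℝ≥0 → Ω → S.State) (A : ℝ≥0 → Set S.State)
    (h : ℝ≥0) (k : ℕ) : gridEvent X A h (k + 1) ⊆ gridEvent X A h k :=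
  fun _ hω j hj => hω j (hj.trans k.le_succ)

namespace IsNetworkProcess

variable {Ω : Type*} [MeasurableSpace Ω] {P : Measure Ω} {y : S.State} {X : ℝ≥0 → Ω → S.State}

lemma measurableSet_gridEvent (hX : IsNetworkProcess P y X) (A : ℝ≥0 → Set S.State) (h : ℝ≥0)
    (k : ℕ) : MeasurableSet[hX.natFiltration (k * h)] (gridEvent X A h k) := by
  have : gridEvent X A h k = ⋂ j ∈ Finset.range (k + 1), X (j * h) ⁻¹' A (j * h) := by
    ext ω; simp [gridEvent]
  rw [this]
  refine Finset.measurableSet_biInter _ fun j hj => hX.measurableSet_preimage ?_ _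
  have : (j : ℝ≥0) ≤ k := by exact_mod_cast Nat.lt_succ_iff.1 (Finset.mem_range.1 hj)
  exact mul_le_mul_left this h

lemma measurableSet_gridEvent' (hX : IsNetworkProcess P y X) (A : ℝ≥0 → Set S.State) (h : ℝ≥0)
    (k : ℕ) : MeasurableSet (gridEvent X A h k) :=
  hX.natFiltration.le _ _ (hX.measurableSet_gridEvent A h k)

variable [IsProbabilityMeasure P]

/-- A bounded function on which the generator acts like multiplication by at most `c` within `A`
bounds the probability of remaining in `A`. -/
lemma measureReal_mul_le_exp (hX : IsNetworkProcess P y X) {A : Set S.State} {f : S.State → ℝ}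
    {M c v : ℝ} (hf0 : ∀ q, 0 ≤ f q) (hfM : ∀ q, f q ≤ M)
    (hgen : ∀ q ∈ A, generator f q ≤ c * f q) (T : ℝ≥0) {E : Set Ω}
    (hE : ∀ ω ∈ E, ∀ t ≤ T, X t ω ∈ A) (hEv : ∀ ω ∈ E, v ≤ f (X T ω)) (hv : 0 ≤ v) :
    v * P.real E ≤ Real.exp (c * T) * f y := by
  obtain ⟨Γ, hΓ0, hΓ⟩ := exists_rate_bound S
  have hM : 0 ≤ M := (hf0 y).trans (hfM y)
  have hfabs : ∀ q, |f q| ≤ M := fun q => by rw [abs_of_nonneg (hf0 q)]; exact hfM q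
  -- Each of the `m` steps of length `T / m` costs an error of order `(T / m) ^ 2`; the total `K /
  -- m` disappears as the grid is refined.
  set K : ℝ := Real.exp (|c| * T) * ((2 * Γ) ^ 2 * M) * T ^ 2 with hK
  have main : ∀ m : ℕ, 0 < m →
      v * P.real E ≤ Real.exp (c * T) * (f y + K * (1 / (m : ℝ))) := by
    intro m hm
    have hmR : (0 : ℝ) < m := by exact_mod_cast hm
    set h : ℝ≥0 := T / m with hh
    have hhm : (m : ℝ≥0) * h = T := by
      rw [hh]; field_simp
    have hhR : (h : ℝ) = T / m := by simp [hh]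
    have hh0 : (0 : ℝ) ≤ h := h.2
    set R := gridEvent X (fun _ => A) h with hR
    set I : ℕ → ℝ := fun k => ∫ ω in R k, f (X (k * h) ω) ∂P with hI
    -- Killing the paths that leave `A` only lowers the integral, as `f ≥ 0`. On the surviving paths
    -- the state lies in `A`, and `1 + c h ≤ exp (c h)`.
    have hstep : ∀ k, I (k + 1) ≤ Real.exp (c * h) * I k + (2 * Γ) ^ 2 * M * (h : ℝ) ^ 2 := by
      intro k
      have h1 : I (k + 1) ≤ ∫ ω in R k, f (X ((k + 1 : ℕ) * h) ω) ∂P :=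
        setIntegral_mono_set (hX.integrable_comp hfabs _).integrableOn
          (Eventually.of_forall fun ω => hf0 _) (gridEvent_succ_subset X _ h k).eventuallyLE
      have hle : (k : ℝ≥0) * h ≤ ((k + 1 : ℕ) : ℝ≥0) * h :=
        mul_le_mul_left (by exact_mod_cast k.le_succ) h
      have h2 := abs_le.1 (hX.abs_setIntegral_step_le hΓ0.le hΓ hM hfabs hle
        (hX.measurableSet_gridEvent (fun _ => A) h k))
      have hdiff : ((((k + 1 : ℕ) : ℝ≥0) * h : ℝ≥0) : ℝ) - ((k : ℝ≥0) * h : ℝ≥0) = h := by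
        push_cast; ring
      rw [hdiff] at h2
      have h3 : ∫ ω in R k, (f (X (k * h) ω) + (h : ℝ) * generator f (X (k * h) ω)) ∂P
          ≤ ∫ ω in R k, Real.exp (c * h) * f (X (k * h) ω) ∂P := by
        refine setIntegral_mono_on
          ((hX.integrable_comp hfabs _).add ((hX.integrable_comp
            (abs_generator_le hΓ hM hfabs) _).const_mul _)).integrableOn
          ((hX.integrable_comp hfabs _).const_mul _).integrableOn
          (hX.measurableSet_gridEvent' _ h k) fun ω hω => ?_
        have h4 := mul_le_mul_of_nonneg_left (hgen _ (hω k le_rfl)) hh0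
        have h5 := mul_le_mul_of_nonneg_right (Real.add_one_le_exp (c * h))
          (hf0 (X (k * h) ω))
        linarith
      rw [integral_const_mul] at h3
      linarith [h2.2]
    have hind : ∀ k ≤ m, Real.exp (-(c * (k * h))) * I k
        ≤ f y + k * (Real.exp (|c| * T) * ((2 * Γ) ^ 2 * M * (h : ℝ) ^ 2)) := by
      intro k
      induction k with
      | zero =>
        intro _
        have h1 : I 0 ≤ ∫ ω, f (X 0 ω) ∂P := by
          simpa [hI] using setIntegral_le_integral (s := R 0) (hX.integrable_comp hfabs 0)
            (Eventually.of_forall fun ω => hf0 _)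
        have h2 : ∫ ω, f (X 0 ω) ∂P = f y := by
          rw [integral_congr_ae (g := fun _ => f y) (hX.start.mono fun ω hω => by simp [hω])]
          simp
        simpa [h2] using h1
      | succ k ih =>
        intro hk
        have ih := ih (Nat.le_of_succ_le hk)
        have h1 := mul_le_mul_of_nonneg_left (hstep k)
          (Real.exp_nonneg (-(c * (((k + 1 : ℕ) : ℝ) * h))))
        have h2 : Real.exp (-(c * (((k + 1 : ℕ) : ℝ) * h))) * (Real.exp (c * h) * I k)
            = Real.exp (-(c * (k * h))) * I k := by
          rw [← mul_assoc, ← Real.exp_add]; congr 2; push_cast; ring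
        have h3 : Real.exp (-(c * (((k + 1 : ℕ) : ℝ) * h))) ≤ Real.exp (|c| * T) := by
          refine Real.exp_le_exp.2 ?_
          have h4 : ((k + 1 : ℕ) : ℝ) * h ≤ T := by
            rw [← hhm]; push_cast
            exact mul_le_mul_of_nonneg_right (by exact_mod_cast hk) hh0
          calc _ ≤ |c| * (((k + 1 : ℕ) : ℝ) * h) := by
                rw [← neg_mul]
                exact mul_le_mul_of_nonneg_right (neg_le_abs c) (by positivity)
            _ ≤ _ := mul_le_mul_of_nonneg_left h4 (abs_nonneg c)
        have h5 : Real.exp (-(c * (((k + 1 : ℕ) : ℝ) * h))) * ((2 * Γ) ^ 2 * M * (h : ℝ) ^ 2)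
            ≤ Real.exp (|c| * T) * ((2 * Γ) ^ 2 * M * (h : ℝ) ^ 2) :=
          mul_le_mul_of_nonneg_right h3 (by positivity)
        rw [mul_add, h2] at h1
        push_cast at *
        linarith
    have hIm : v * P.real E ≤ I m := by
      have hsub : E ⊆ R m ∩ {ω | v ≤ f (X T ω)} := fun ω hω =>
        ⟨fun j hj => hE ω hω _ (by
          rw [← hhm]; exact mul_le_mul_left (by exact_mod_cast hj) h), hEv ω hω⟩
      have hmeas : MeasurableSet (R m ∩ {ω | v ≤ f (X T ω)}) :=
        (hX.measurableSet_gridEvent' _ h m).inter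
          (measurableSet_le measurable_const ((measurable_of_countable f).comp (hX.measurable T)))
      calc v * P.real E ≤ v * P.real (R m ∩ {ω | v ≤ f (X T ω)}) :=
            mul_le_mul_of_nonneg_left (measureReal_mono hsub) hv
        _ = ∫ ω in R m ∩ {ω | v ≤ f (X T ω)}, v ∂P := by simp [mul_comm]
        _ ≤ ∫ ω in R m ∩ {ω | v ≤ f (X T ω)}, f (X T ω) ∂P :=
            setIntegral_mono_on (integrable_const _).integrableOn
              (hX.integrable_comp hfabs _).integrableOn hmeas fun ω hω => hω.2
        _ ≤ ∫ ω in R m, f (X T ω) ∂P :=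
            setIntegral_mono_set (hX.integrable_comp hfabs _).integrableOn
              (Eventually.of_forall fun ω => hf0 _) Set.inter_subset_left.eventuallyLE
        _ = I m := by simp only [hI, hhm]
    have hfin := mul_le_mul_of_nonneg_left (hind m le_rfl) (Real.exp_nonneg (c * T))
    have hT : (m : ℝ) * h = T := by exact_mod_cast hhm
    rw [hT, ← mul_assoc, ← Real.exp_add, add_neg_cancel, Real.exp_zero, one_mul] at hfin
    refine hIm.trans (hfin.trans (le_of_eq ?_))
    rw [hhR, hK]
    field_simp
  refine ge_of_tendsto (x := atTop) (f := fun m : ℕ =>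
    Real.exp (c * T) * (f y + K * (1 / (m : ℝ)))) ?_
    ((eventually_gt_atTop 0).mono main)
  have := ((tendsto_one_div_atTop_nhds_zero_nat (𝕜 := ℝ)).const_mul K).const_add (f y)
  simpa using this.const_mul (Real.exp (c * T))

end IsNetworkProcess

/-- The off-diagonal rates are nonnegative. This allows an unbounded exponential to be cut off
outside a set without raising its generator inside. -/
lemma generator_sub_le {f g : S.State → ℝ} {q : S.State} (hfg : ∀ q', f q' ≤ g q')
    (hq : f q = g q) : generator f q ≤ generator g q := by
  rw [generator_eq, generator_eq]
  refine Finset.sum_le_sum fun e _ => ?_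
  rw [hq]
  exact add_le_add (mul_le_mul_of_nonneg_left (sub_le_sub_right (hfg _) _) (S.lam_nonneg _))
    (mul_le_mul_of_nonneg_left (sub_le_sub_right (hfg _) _) (srv_nonneg q e))

/-- For `h ≤ 1 / Γ` the operator `1 + h R` has nonnegative coefficients, so the discrete step
preserves positivity. This settles the states where the subsolution is not positive. -/
lemma add_generator_nonneg {Γ : ℝ}
    (hΓ : ∀ q : S.State, ∑ e : S.Active, (S.lam e.1 + srv q e) ≤ Γ) {f : S.State → ℝ}
    (hf : ∀ q, 0 ≤ f q) {h : ℝ} (h0 : 0 ≤ h) (hh : h * Γ ≤ 1) (q : S.State) :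
    0 ≤ f q + h * generator f q := by
  have h1 : -(Γ * f q) ≤ generator f q := by
    rw [generator_eq]
    calc -(Γ * f q) ≤ -((∑ e : S.Active, (S.lam e.1 + srv q e)) * f q) :=
          neg_le_neg (mul_le_mul_of_nonneg_right (hΓ q) (hf q))
      _ = ∑ e : S.Active, -((S.lam e.1 + srv q e) * f q) := by
          rw [Finset.sum_mul, Finset.sum_neg_distrib]
      _ ≤ _ := Finset.sum_le_sum fun e _ => by
          have h2 := mul_nonneg (S.lam_nonneg e.1) (hf (q + Pi.single e 1))
          have h3 := mul_nonneg (srv_nonneg q e) (hf (q - Pi.single e 1))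
          linarith
  have h4 := mul_le_mul_of_nonneg_left h1 h0
  have h5 := mul_le_mul_of_nonneg_right hh (hf q)
  linarith

/-- A space-time subsolution, positive at finitely many states, is a subsolution of the implicit
time discretization up to an error negligible compared with the time step. -/
lemma exists_discrete_subsolution {T : ℝ} {F F' : ℝ → S.State → ℝ}
    (hF : ∀ q t, HasDerivAt (fun s => F s q) (F' t q) t) (hF' : ∀ q, Continuous fun t => F' t q)
    (Z : Finset S.State) (hZ : ∀ t ∈ Set.Icc 0 T, ∀ q ∉ Z, F t q ≤ 0)
    (hpde : ∀ t ∈ Set.Icc 0 T, ∀ q, 0 < F t q →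
      0 ≤ F' t q + generator (fun q' => max (F t q') 0) q) {κ : ℝ} (hκ : 0 < κ) :
    ∃ h₀ > 0, ∀ h, 0 < h → h < h₀ → ∀ t, 0 ≤ t → t + h ≤ T → ∀ q,
      max (F t q) 0 ≤ max (F (t + h) q) 0
        + h * generator (fun q' => max (F (t + h) q') 0) q + κ * h := by
  obtain ⟨Γ, hΓ0, hΓ⟩ := exists_rate_bound S
  have hcF : ∀ q, Continuous fun t => F t q := fun q =>
    continuous_iff_continuousAt.2 fun t => (hF q t).continuousAt
  have hcG : ∀ q, Continuous fun t => generator (fun q' => max (F t q') 0) q := fun q => by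
    simp only [generator_eq]
    have := hcF
    fun_prop
  have huc : ∀ q, ∃ h₀ > 0, ∀ s ∈ Set.Icc 0 T, ∀ t ∈ Set.Icc 0 T, dist s t < h₀ →
      |F' s q - F' t q| < κ / 2 ∧ |generator (fun q' => max (F s q') 0) q
        - generator (fun q' => max (F t q') 0) q| < κ / 2 := by
    intro q
    obtain ⟨a, ha, ha'⟩ := Metric.uniformContinuousOn_iff.1
      (isCompact_Icc.uniformContinuousOn_of_continuous
        (hF' q).continuousOn (s := Set.Icc 0 T)) (κ / 2) (by positivity)
    obtain ⟨b, hb, hb'⟩ := Metric.uniformContinuousOn_iff.1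
      (isCompact_Icc.uniformContinuousOn_of_continuous
        (hcG q).continuousOn (s := Set.Icc 0 T)) (κ / 2) (by positivity)
    exact ⟨min a b, lt_min ha hb, fun s hs t ht hst =>
      ⟨ha' s hs t ht (hst.trans_le (min_le_left _ _)),
        hb' s hs t ht (hst.trans_le (min_le_right _ _))⟩⟩
  choose r hr0 hr using huc
  -- Only states of the finite set `Z` need a modulus of continuity in time, so one step size serves
  -- them all.
  have hev : ∀ᶠ h in 𝓝[>] (0 : ℝ), (∀ q ∈ Z, h < r q) ∧ h < 1 / Γ := by
    refine Eventually.and ((eventually_all_finset Z).2 fun q _ => ?_) ?_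
    · exact mem_nhdsWithin_of_mem_nhds (Iio_mem_nhds (hr0 q))
    · exact mem_nhdsWithin_of_mem_nhds (Iio_mem_nhds (by positivity))
  obtain ⟨h₀, hh0, hh⟩ := mem_nhdsGT_iff_exists_Ioo_subset.1 hev
  refine ⟨h₀, hh0, fun h hpos hlt t ht0 htT q => ?_⟩
  obtain ⟨h1, h2⟩ := hh ⟨hpos, hlt⟩
  have htI : t ∈ Set.Icc 0 T := ⟨ht0, by linarith⟩
  rcases le_or_gt (F t q) 0 with hle | hgt
  · rw [max_eq_right hle]
    have := add_generator_nonneg hΓ (f := fun q' => max (F (t + h) q') 0)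
      (fun q' => le_max_right _ _) hpos.le ((lt_div_iff₀ hΓ0).1 h2).le q
    have := mul_pos hκ hpos
    linarith
  · have hqZ : q ∈ Z := by
      by_contra hq
      exact absurd (hZ t htI q hq) (not_le.2 hgt)
    obtain ⟨ξ, hξ, hξ'⟩ := exists_hasDerivAt_eq_slope (fun s => F s q) (fun s => F' s q)
      (show t < t + h by linarith) (hcF q).continuousOn fun s _ => hF q s
    have hξ'' : F (t + h) q = F t q + h * F' ξ q := by
      rw [hξ', add_sub_cancel_left]; field_simp; ring
    have hrq := h1 q hqZ
    have hd1 := (hr q ξ ⟨by linarith [hξ.1], by linarith [hξ.2]⟩ t htI (by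
      rw [Real.dist_eq, abs_of_nonneg (by linarith [hξ.1])]; linarith [hξ.2])).1
    have hd2 := (hr q (t + h) ⟨by linarith, htT⟩ t htI (by
      rw [Real.dist_eq, abs_of_nonneg (by linarith)]; linarith)).2
    have h3 := hpde t htI q hgt
    rw [max_eq_left hgt.le]
    have h4 := le_max_left (F (t + h) q) 0
    have h5 : 0 ≤ F' ξ q + generator (fun q' => max (F (t + h) q') 0) q + κ := by
      linarith [(abs_lt.1 hd1).1, (abs_lt.1 hd2).1]
    have h6 := mul_nonneg hpos.le h5
    linarith

namespace IsNetworkProcess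

variable {Ω : Type*} [MeasurableSpace Ω] {P : Measure Ω} {y : S.State} {X : ℝ≥0 → Ω → S.State}
  [IsProbabilityMeasure P]

/-- The integral of the positive part of `F`, over paths that have stayed in `A` at the grid times,
decreases by at most a small error per step, and at time `T` it is at most `V` times the probability
of survival. The total error is `κ / 2` from the discretized subsolution and another `κ / 2` from
the quadratic errors. -/
lemma le_mul_measureReal_gridEvent (hX : IsNetworkProcess P y X) {T : ℝ≥0} {F F' : ℝ → S.State → ℝ}
    (hF : ∀ q t, HasDerivAt (fun s => F s q) (F' t q) t) (hF' : ∀ q, Continuous fun t => F' t q)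
    (Z : Finset S.State) (hZ : ∀ t ∈ Set.Icc 0 (T : ℝ), ∀ q ∉ Z, F t q ≤ 0)
    (hpde : ∀ t ∈ Set.Icc 0 (T : ℝ), ∀ q, 0 < F t q →
      0 ≤ F' t q + generator (fun q' => max (F t q') 0) q)
    {A : ℝ≥0 → Set S.State} (hA : ∀ t ≤ T, ∀ q, 0 < F t q → q ∈ A t)
    {V : ℝ} (hV0 : 0 ≤ V) (hV : ∀ q, F T q ≤ V) (hT : 0 < T) {κ : ℝ} (hκ : 0 < κ) :
    ∀ᶠ m : ℕ in atTop, F 0 y ≤ V * P.real (gridEvent X A (T / m) m) + κ := by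
  obtain ⟨Γ, hΓ0, hΓ⟩ := exists_rate_bound S
  set κ' : ℝ := κ / (2 * T) with hκ'
  have hTR : (0 : ℝ) < T := by exact_mod_cast hT
  have hκ'0 : 0 < κ' := by positivity
  obtain ⟨h₀, hh₀, hsub⟩ := exists_discrete_subsolution hF hF' Z hZ hpde hκ'0
  set u : ℝ → S.State → ℝ := fun t q => max (F t q) 0 with hu
  have hcu : ∀ q, Continuous fun t => u t q := fun q =>
    (continuous_iff_continuousAt.2 fun t => (hF q t).continuousAt).max continuous_const
  obtain ⟨M, hM0, hM⟩ : ∃ M, 0 ≤ M ∧ ∀ t ∈ Set.Icc 0 (T : ℝ), ∀ q, |u t q| ≤ M := by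
    have : ∀ q, ∃ M, ∀ t ∈ Set.Icc 0 (T : ℝ), |u t q| ≤ M := fun q =>
      isCompact_Icc.exists_bound_of_continuousOn (hcu q).continuousOn
    choose M hM using this
    refine ⟨∑ q ∈ Z, |M q|, Finset.sum_nonneg fun _ _ => abs_nonneg _, fun t ht q => ?_⟩
    by_cases hq : q ∈ Z
    · exact (hM q t ht).trans ((le_abs_self _).trans
        (Finset.single_le_sum (f := fun q => |M q|) (fun _ _ => abs_nonneg _) hq))
    · simp only [hu, max_eq_right (hZ t ht q hq), abs_zero]
      exact Finset.sum_nonneg fun _ _ => abs_nonneg _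
  have hlim : Tendsto (fun m : ℕ => (T : ℝ) / m) atTop (𝓝 0) :=
    tendsto_const_div_atTop_nhds_zero_nat _
  have hlim2 : Tendsto (fun m : ℕ => (2 * Γ) ^ 2 * M * T * ((T : ℝ) / m)) atTop (𝓝 0) := by
    simpa using hlim.const_mul ((2 * Γ) ^ 2 * M * T)
  filter_upwards [hlim.eventually (gt_mem_nhds hh₀), hlim2.eventually
    (gt_mem_nhds (half_pos hκ)), eventually_gt_atTop 0] with m hm1 hm2 hm
  have hmR : (0 : ℝ) < m := by exact_mod_cast hm
  set h : ℝ≥0 := T / m with hh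
  have hhm : (m : ℝ≥0) * h = T := by
    rw [hh]; field_simp
  have hhR : (h : ℝ) = T / m := by simp [hh]
  have hh0 : (0 : ℝ) < h := by rw [hhR]; positivity
  set R := gridEvent X A h with hR
  set I : ℕ → ℝ := fun k => ∫ ω in R k, u (k * h) (X (k * h) ω) ∂P with hI
  have htk : ∀ k ≤ m, ((k : ℝ) * h) ∈ Set.Icc 0 (T : ℝ) := fun k hk => by
    refine ⟨by positivity, ?_⟩
    rw [← hhm]; push_cast
    exact mul_le_mul_of_nonneg_right (by exact_mod_cast hk) hh0.le
  have hstep : ∀ k < m, I k ≤ I (k + 1) + (κ' * h + (2 * Γ) ^ 2 * M * (h : ℝ) ^ 2) := by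
    intro k hk
    have hnext : ((k + 1 : ℕ) : ℝ) * h = k * h + h := by push_cast; ring
    have htk1 := htk (k + 1) hk
    have hle : (k : ℝ≥0) * h ≤ ((k + 1 : ℕ) : ℝ≥0) * h :=
      mul_le_mul_left (by exact_mod_cast k.le_succ) h
    -- Killing the paths outside `A` is free here, since the positive part of `F` already vanishes
    -- there.
    have h1 : I (k + 1) = ∫ ω in R k, u ((k + 1 : ℕ) * h) (X ((k + 1 : ℕ) * h) ω) ∂P := by
      refine (setIntegral_eq_of_subset_of_forall_sdiff_eq_zero (hX.measurableSet_gridEvent' A h k)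
        (gridEvent_succ_subset X A h k) fun ω hω => ?_).symm
      have hnA : X ((k + 1 : ℕ) * h) ω ∉ A ((k + 1 : ℕ) * h) := fun hmem => hω.2 fun j hj => by
        rcases Nat.le_succ_iff.1 hj with hj | rfl
        · exact hω.1 j hj
        · exact hmem
      have hTle : ((k + 1 : ℕ) : ℝ≥0) * h ≤ T := by
        have := htk1.2
        exact_mod_cast this
      have : F (((k + 1 : ℕ) : ℝ) * h) (X ((k + 1 : ℕ) * h) ω) ≤ 0 := by
        by_contra hcon
        refine hnA (hA _ hTle _ ?_)
        push_cast at hcon ⊢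
        exact not_le.1 hcon
      exact max_eq_right this
    have h2 := abs_le.1 (hX.abs_setIntegral_step_le hΓ0.le hΓ hM0 (hM _ htk1) hle
      (hX.measurableSet_gridEvent A h k))
    have hdiff : ((((k + 1 : ℕ) : ℝ≥0) * h : ℝ≥0) : ℝ) - ((k : ℝ≥0) * h : ℝ≥0) = h := by
      push_cast; ring
    rw [hdiff] at h2
    have hb := hM _ (htk k hk.le)
    have h3 : ∫ ω in R k, (u (k * h) (X (k * h) ω) - κ' * h) ∂P
        ≤ ∫ ω in R k, (u ((k + 1 : ℕ) * h) (X (k * h) ω)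
          + (h : ℝ) * generator (u ((k + 1 : ℕ) * h)) (X (k * h) ω)) ∂P := by
      refine setIntegral_mono
        ((hX.integrable_comp hb _).sub (integrable_const _)).integrableOn
        ((hX.integrable_comp (hM _ htk1) _).add ((hX.integrable_comp
          (abs_generator_le hΓ hM0 (hM _ htk1)) _).const_mul _)).integrableOn fun ω => ?_
      have h4 := hsub h hh0 (by rw [hhR]; exact hm1) (k * h) (by positivity)
        (by rw [← hnext]; exact htk1.2) (X (k * h) ω)
      rw [hnext]
      simp only [hu]
      linarith
    have h5 : I k - κ' * h ≤ ∫ ω in R k, (u (k * h) (X (k * h) ω) - κ' * h) ∂P := by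
      rw [integral_sub (hX.integrable_comp hb _).integrableOn (integrable_const _).integrableOn]
      have : ∫ ω in R k, (κ' * h : ℝ) ∂P ≤ κ' * h :=
        (le_abs_self _).trans (abs_setIntegral_le (fun _ => κ' * (h : ℝ))
          (fun _ => (abs_of_nonneg (by positivity)).le) (R k))
      linarith
    linarith [h2.1]
  have hind : ∀ k ≤ m, I 0 ≤ I k + k * (κ' * h + (2 * Γ) ^ 2 * M * (h : ℝ) ^ 2) := by
    intro k
    induction k with
    | zero => intro _; simp
    | succ k ih =>
      intro hk
      have h1 := ih (Nat.le_of_succ_le hk)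
      have h2 := hstep k hk
      push_cast
      linarith
  have hI0 : F 0 y ≤ I 0 := by
    have h1 : I 0 = ∫ ω, u 0 (X 0 ω) ∂P := by
      have h0 : I 0 = ∫ ω in R 0, u 0 (X 0 ω) ∂P := by simp [hI]
      rw [h0]
      refine setIntegral_eq_integral_of_forall_compl_eq_zero fun ω hω => max_eq_right ?_
      by_contra hcon
      refine hω fun j hj => ?_
      obtain rfl : j = 0 := by omega
      simpa using hA 0 bot_le _ (by simpa using hcon)
    rw [h1, integral_congr_ae (g := fun _ => u 0 y) (hX.start.mono fun ω hω => by simp [hω])]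
    rw [integral_const, probReal_univ, one_smul]
    exact le_max_left (F 0 y) 0
  have hIm : I m ≤ V * P.real (R m) := by
    calc I m ≤ ∫ ω in R m, V ∂P := by
          refine setIntegral_mono (hX.integrable_comp (hM _ (htk m le_rfl)) _).integrableOn
            (integrable_const _).integrableOn fun ω => max_le ?_ hV0
          have : ((m : ℝ) * h) = T := by exact_mod_cast hhm
          rw [this]
          exact hV _
      _ = V * P.real (R m) := by simp [mul_comm]
  have hfin := hind m le_rfl
  have herr : (m : ℝ) * (κ' * h + (2 * Γ) ^ 2 * M * (h : ℝ) ^ 2)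
      = κ / 2 + (2 * Γ) ^ 2 * M * T * ((T : ℝ) / m) := by
    rw [hhR, hκ']; field_simp
  linarith

/-- A space-time subsolution gives a lower bound for the probability of remaining in a moving
set. -/
lemma le_mul_measureReal (hX : IsNetworkProcess P y X) {T : ℝ≥0} {F F' : ℝ → S.State → ℝ}
    (hF : ∀ q t, HasDerivAt (fun s => F s q) (F' t q) t) (hF' : ∀ q, Continuous fun t => F' t q)
    (Z : Finset S.State) (hZ : ∀ t ∈ Set.Icc 0 (T : ℝ), ∀ q ∉ Z, F t q ≤ 0)
    (hpde : ∀ t ∈ Set.Icc 0 (T : ℝ), ∀ q, 0 < F t q →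
      0 ≤ F' t q + generator (fun q' => max (F t q') 0) q)
    {A : ℝ≥0 → Set S.State} (hA : ∀ t ≤ T, ∀ q, 0 < F t q → q ∈ A t)
    (hAc : ∀ q, IsClosed {t | q ∈ A t})
    {V : ℝ} (hV0 : 0 ≤ V) (hV : ∀ q, F T q ≤ V) (hT : 0 < T) :
    F 0 y ≤ V * P.real {ω | ∀ t ≤ T, X t ω ∈ A t} := by
  set G : ℕ → Set Ω := fun k => gridEvent X A (T / (2 ^ k : ℕ)) (2 ^ k) with hG
  have hpow : ∀ k : ℕ, ((2 ^ k : ℕ) : ℝ≥0) ≠ 0 := fun k => by positivity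
  -- Dyadic grids are nested, so the events decrease and their probabilities converge to that of the
  -- intersection.
  have hanti : Antitone G := by
    refine antitone_nat_of_succ_le fun k ω hω j hj => ?_
    have := hω (2 * j) (by rw [pow_succ]; omega)
    have heq : ((2 * j : ℕ) : ℝ≥0) * (T / (2 ^ (k + 1) : ℕ)) = j * (T / (2 ^ k : ℕ)) := by
      push_cast; rw [pow_succ]; field_simp
    rwa [heq] at this
  have hsub : (⋂ k, G k) ⊆ {ω | ∀ t ≤ T, X t ω ∈ A t} := by
    intro ω hω t ht
    rw [Set.mem_iInter] at hω
    -- the dyadic times just after `t`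
    let s : ℕ → ℝ≥0 := fun k => (⌈t / T * (2 ^ k : ℕ)⌉₊ : ℝ≥0) * (T / (2 ^ k : ℕ))
    have hs1 : ∀ k, t ≤ s k := fun k => by
      calc t = (t / T * (2 ^ k : ℕ)) * (T / (2 ^ k : ℕ)) := by
            have := hpow k; field_simp
        _ ≤ s k := mul_le_mul_left (Nat.le_ceil _) _
    have hs2 : ∀ k, s k ≤ t + T / (2 ^ k : ℕ) := fun k => by
      calc s k ≤ (t / T * (2 ^ k : ℕ) + 1) * (T / (2 ^ k : ℕ)) :=
            mul_le_mul_left (Nat.ceil_lt_add_one bot_le).le _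
        _ = t + T / (2 ^ k : ℕ) := by
            have := hpow k; field_simp
    have hs3 : ∀ k, X (s k) ω ∈ A (s k) := fun k => by
      refine hω k _ (Nat.ceil_le.2 ?_)
      calc t / T * (2 ^ k : ℕ) ≤ 1 * (2 ^ k : ℕ) :=
            mul_le_mul_left (div_le_one_of_le₀ ht bot_le) _
        _ = _ := one_mul _
    have hlim0 : Tendsto (fun k : ℕ => T / ((2 ^ k : ℕ) : ℝ≥0)) atTop (𝓝 0) := by
      have h1 : Tendsto (fun k : ℕ => T * (1 / 2 : ℝ≥0) ^ k) atTop (𝓝 (T * 0)) :=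
        (tendsto_pow_atTop_nhds_zero_of_lt_one bot_le
          (NNReal.coe_lt_coe.1 (by norm_num))).const_mul T
      rw [mul_zero] at h1
      refine h1.congr fun k => ?_
      push_cast; rw [div_pow, one_pow]; ring
    have hlim : Tendsto s atTop (𝓝 t) :=
      tendsto_of_tendsto_of_tendsto_of_le_of_le tendsto_const_nhds
        (by simpa using hlim0.const_add t) hs1 hs2
    have hXlim : Tendsto (fun k => X (s k) ω) atTop (𝓝 (X t ω)) :=
      (hX.right_cont ω t).tendsto.comp
        (tendsto_nhdsWithin_iff.2 ⟨hlim, Eventually.of_forall hs1⟩)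
    rw [nhds_discrete, tendsto_pure] at hXlim
    -- The state space is discrete, so by right-continuity the path already has its value at `t` at
    -- the nearby dyadic times; closedness in time of the moving set passes to the limit.
    exact (hAc (X t ω)).mem_of_tendsto hlim (hXlim.mono fun k hk => by
      show X t ω ∈ A (s k)
      rw [← hk]; exact hs3 k)
  have hmeas : Tendsto (fun k => P.real (G k)) atTop (𝓝 (P.real (⋂ k, G k))) :=
    (ENNReal.tendsto_toReal (measure_ne_top P _)).comp (tendsto_measure_iInter_atTop
      (fun k => (hX.measurableSet_gridEvent' A _ _).nullMeasurableSet) hanti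
      ⟨0, measure_ne_top P _⟩)
  have hle : F 0 y ≤ V * P.real (⋂ k, G k) := by
    refine le_of_forall_pos_le_add fun κ hκ => ?_
    refine ge_of_tendsto ((hmeas.const_mul V).add_const κ) ?_
    exact (tendsto_pow_atTop_atTop_of_one_lt one_lt_two).eventually
      (hX.le_mul_measureReal_gridEvent hF hF' Z hZ hpde hA hV0 hV hT hκ)
  exact hle.trans (mul_le_mul_of_nonneg_left (measureReal_mono hsub) hV0)

end IsNetworkProcess

end StarNetwork

/-! ### Ergodicity keeps every link underloaded. -/

namespace StarNetwork

variable {N : ℕ} {S : StarNetwork N}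

lemma sum_add_single_sub (g : S.Active → ℕ → ℝ) (q : S.State) {I : Finset S.Active} {e : S.Active}
    (he : e ∈ I) :
    ∑ r ∈ I, g r ((q + Pi.single e 1 : S.State) r) - ∑ r ∈ I, g r (q r) = g e (q e + 1) - g e (q e) := by
  rw [← Finset.sum_sub_distrib, Finset.sum_eq_single e]
  · simp
  · intro r _ hr; simp [hr]
  · exact fun h => absurd he h

lemma sum_sub_single_sub (g : S.Active → ℕ → ℝ) (q : S.State) {I : Finset S.Active} {e : S.Active}
    (he : e ∈ I) :
    ∑ r ∈ I, g r ((q - Pi.single e 1 : S.State) r) - ∑ r ∈ I, g r (q r) = g e (q e - 1) - g e (q e) := by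
  rw [← Finset.sum_sub_distrib, Finset.sum_eq_single e]
  · simp
  · intro r _ hr; simp [hr]
  · exact fun h => absurd he h

lemma jumpRate_nonneg (x y : S.State) : 0 ≤ jumpRate x y :=
  Finset.sum_nonneg fun e _ => by
    have h1 := S.lam_nonneg e.1
    have h2 := srv_nonneg x e
    unfold srv at h2
    split_ifs <;> positivity

lemma generator_indicator {x z : S.State} (h : x ≠ z) :
    generator (fun q => if q = z then 1 else 0) x = jumpRate x z := by
  unfold generator
  rw [tsum_eq_single z]
  · simp [h]
  · intro y hy; simp [h, hy]

/-- A stationary distribution of an irreducible network charges every state. -/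
lemma stationary_pos {p : S.State → ℝ} (hp0 : ∀ x, 0 ≤ p x) (hp1 : HasSum p 1)
    (hirr : ∀ x y : S.State, Relation.ReflTransGen (fun a b : S.State => 0 < jumpRate a b) x y)
    (hst : ∀ f : S.State → ℝ, (∃ c : ℝ, ∀ x, |f x| ≤ c) →
      HasSum (fun x => p x * generator f x) 0) (z : S.State) : 0 < p z := by
  -- Stationarity tested on the indicator of a null state `b` says that the total inflow into `b`
  -- vanishes. Its terms are nonnegative, so every predecessor of `b` is null too.
  have hstep : ∀ a b : S.State, 0 < jumpRate a b → p b = 0 → p a = 0 := by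
    intro a b hab hb
    by_cases hne : a = b
    · rw [hne, hb]
    have h1 := hst (fun q => if q = b then 1 else 0) ⟨1, fun x => by split_ifs <;> simp⟩
    have h2 : ∀ x, 0 ≤ p x * generator (fun q => if q = b then 1 else 0) x := fun x => by
      by_cases hx : x = b
      · rw [hx, hb, zero_mul]
      · rw [generator_indicator hx]; exact mul_nonneg (hp0 x) (jumpRate_nonneg _ _)
    have h3 := congrFun ((hasSum_zero_iff_of_nonneg h2).1 h1) a
    rw [generator_indicator hne] at h3
    exact (mul_eq_zero.1 h3).resolve_right hab.ne'
  by_contra hcon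
  have hz : p z = 0 := le_antisymm (not_lt.1 hcon) (hp0 z)
  have hall : ∀ x, p x = 0 := fun x => by
    refine Relation.ReflTransGen.head_induction_on (motive := fun a _ => p a = 0) (hirr x z) hz ?_
    intro a c hac _ hc
    exact hstep a c hac hc
  have : HasSum p 0 := by
    rw [show p = fun _ => 0 from funext hall]; exact hasSum_zero
  exact zero_ne_one (this.unique hp1)

/-- In an ergodic network no link is overloaded. -/
theorem Ergodic.sum_lam_div_mu_lt (hS : S.Ergodic) (i : Fin N) :
    ∑ e : S.Active with Uses e i, S.lam e.1 / S.mu e.1 < S.cap i := by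
  obtain ⟨hirr, p, hp0, hp1, hst⟩ := hS
  have hpz := stationary_pos hp0 hp1 hirr hst 0
  set ρ := ∑ e : S.Active with Uses e i, S.lam e.1 / S.mu e.1 with hρ
  have hρ0 : 0 ≤ ρ := Finset.sum_nonneg fun e _ => div_nonneg (S.lam_nonneg _) (S.mu_pos _).le
  -- With these weights `∑ c e * z e` is the mean work on link `i`. It arrives at rate `ρ` and is
  -- served at rate at most the capacity, and at rate zero in the empty state; hence `ρ ≤ C_i (1 - p
  -- 0)`, a strict gain because `p 0 > 0`.
  set c : S.Active → ℝ := fun e => if Uses e i then 1 / S.mu e.1 else 0 with hc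
  have hc0 : ∀ e, 0 ≤ c e := fun e => by
    simp only [hc]
    split_ifs
    · exact one_div_nonneg.2 (S.mu_pos _).le
    · rfl
  have hcρ : ∑ e : S.Active, S.lam e.1 * c e = ρ := by
    rw [hρ, Finset.sum_filter]
    refine Finset.sum_congr rfl fun e _ => ?_
    simp only [hc]
    split_ifs
    · rw [mul_one_div]
    · rw [mul_zero]
  have hsrv : ∀ z : S.State, ∑ e : S.Active, c e * srv z e ≤ if z = 0 then 0 else S.cap i := by
    intro z
    split_ifs with hz
    · refine Finset.sum_nonpos fun e _ => ?_
      rw [srv_eq_zero (by simp [hz]), mul_zero]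
    · calc ∑ e : S.Active, c e * srv z e
          ≤ ∑ e : S.Active with Uses e i, toReal z e * (S.cap i / load (toReal z) i) := by
            rw [Finset.sum_filter]
            refine Finset.sum_le_sum fun e _ => ?_
            simp only [hc]
            split_ifs with hu
            · have h1 := serviceRate_le (toReal_nonneg z) hu
              rw [one_div, inv_mul_le_iff₀ (S.mu_pos _)]
              exact h1
            · rw [zero_mul]
        _ = load (toReal z) i * (S.cap i / load (toReal z) i) := by
            rw [← Finset.sum_mul]; rfl
        _ ≤ S.cap i := by
            rcases eq_or_ne (load (toReal z) i) 0 with h0 | h0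
            · rw [h0, zero_mul]; exact (S.cap_pos i).le
            · rw [mul_div_cancel₀ _ h0]
  have hgen : ∀ (k : ℕ) (z : S.State),
      (∑ e : S.Active, S.lam e.1 * c e * (if z e < k then 1 else 0))
        - (if z = 0 then 0 else S.cap i)
      ≤ generator (fun z => ∑ e, c e * (min (z e) k : ℕ)) z := by
    intro k z
    refine (sub_le_sub_left (hsrv z) _).trans ?_
    rw [generator_eq, ← Finset.sum_sub_distrib]
    refine Finset.sum_le_sum fun e _ => ?_
    rw [sum_add_single_sub (fun e m => c e * (min m k : ℕ)) z (Finset.mem_univ e),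
      sum_sub_single_sub (fun e m => c e * (min m k : ℕ)) z (Finset.mem_univ e)]
    have h1 : (if z e < k then (1 : ℝ) else 0) ≤ (min (z e + 1) k : ℕ) - (min (z e) k : ℕ) := by
      split_ifs with hk
      · rw [min_eq_left hk.le, min_eq_left (Nat.succ_le_of_lt hk)]; push_cast; linarith
      · rw [sub_nonneg]; exact_mod_cast min_le_min_right k (Nat.le_succ _)
    have h2 : (-1 : ℝ) ≤ (min (z e - 1) k : ℕ) - (min (z e) k : ℕ) := by
      have : (min (z e) k : ℕ) ≤ min (z e - 1) k + 1 := by omega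
      have : ((min (z e) k : ℕ) : ℝ) ≤ (min (z e - 1) k : ℕ) + 1 := by exact_mod_cast this
      linarith
    have h3 := mul_le_mul_of_nonneg_left h1 (mul_nonneg (S.lam_nonneg e.1) (hc0 e))
    have h4 := mul_le_mul_of_nonneg_left h2 (mul_nonneg (srv_nonneg z e) (hc0 e))
    linarith
  -- The work is unbounded, so each population is truncated at a level `k` above all states of a
  -- finite set `B` of mass more than `1 - η`; on `B` no arrival is lost.
  have hkey : ∀ η > 0, ρ * (1 - η) ≤ S.cap i * (1 - p 0) := by
    intro η hη
    obtain ⟨B, hB⟩ := (hp1.eventually (lt_mem_nhds (show 1 - η < 1 by linarith))).exists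
    obtain ⟨k, hk⟩ : ∃ k : ℕ, ∀ z ∈ B, ∀ e, z e < k := by
      refine ⟨∑ z ∈ B, ∑ e, z e + 1, fun z hz e => Nat.lt_succ_of_le ?_⟩
      exact (Finset.single_le_sum (f := fun e => z e) (fun _ _ => Nat.zero_le _)
        (Finset.mem_univ e)).trans
        (Finset.single_le_sum (f := fun z : S.State => ∑ e, z e) (fun _ _ => Nat.zero_le _) hz)
    have hsum := hst (fun z => ∑ e, c e * (min (z e) k : ℕ)) ⟨∑ e, c e * k, fun z => by
      rw [abs_of_nonneg (Finset.sum_nonneg fun e _ => mul_nonneg (hc0 e) (Nat.cast_nonneg _))]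
      exact Finset.sum_le_sum fun e _ => mul_le_mul_of_nonneg_left
        (by exact_mod_cast min_le_right _ _) (hc0 e)⟩
    have h1 : HasSum (fun z => (if z ∈ B then p z else 0) * ρ) ((∑ z ∈ B, p z) * ρ) :=
      HasSum.mul_right ρ (by
        have : HasSum (fun z => if z ∈ B then p z else 0) (∑ z ∈ B, if z ∈ B then p z else 0) :=
          hasSum_sum_of_ne_finset_zero
          (by intro z hz; simp [hz])
        rwa [Finset.sum_congr rfl (g := p) (fun z hz => by simp [hz])] at this)
    have h2 : HasSum (fun z => (p z - if z = 0 then p 0 else 0) * S.cap i)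
        ((1 - p 0) * S.cap i) := by
      refine (hp1.sub ?_).mul_right _
      exact hasSum_ite_eq 0 (p 0)
    have h3 := hasSum_le (fun z => ?_) (h1.sub h2) hsum
    · have h4 := mul_le_mul_of_nonneg_right hB.le hρ0
      linarith
    · have h5 := mul_le_mul_of_nonneg_left (hgen k z) (hp0 z)
      refine le_trans ?_ h5
      rw [mul_sub]
      refine sub_le_sub ?_ ?_
      · split_ifs with hz
        · refine mul_le_mul_of_nonneg_left ?_ (hp0 z)
          rw [← hcρ]
          exact Finset.sum_le_sum fun e _ => by simp [hk z hz e]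
        · rw [zero_mul]
          refine mul_nonneg (hp0 z) (Finset.sum_nonneg fun e _ => ?_)
          have := mul_nonneg (S.lam_nonneg e.1) (hc0 e)
          split_ifs <;> simp [this]
      · split_ifs with hz
        · simp [hz]
        · simp
  have hfin : ρ ≤ S.cap i * (1 - p 0) := by
    have hlim : Tendsto (fun η : ℝ => ρ * (1 - η)) (𝓝[>] 0) (𝓝 ρ) := by
      have : Tendsto (fun η : ℝ => ρ * (1 - η)) (𝓝 0) (𝓝 (ρ * (1 - 0))) :=
        (continuous_const.mul (continuous_const.sub continuous_id)).tendsto 0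
      rw [sub_zero, mul_one] at this
      exact this.mono_left nhdsWithin_le_nhds
    exact le_of_tendsto hlim (eventually_nhdsWithin_of_forall hkey)
  have := mul_pos (S.cap_pos i) hpz
  linarith

end StarNetwork

/-! ### The cost function of the M/M/1 queue. -/

lemma mm1Cost_zero_zero (lam : ℝ) : mm1Cost 0 lam 0 = lam := by
  simp [mm1Cost]

/-- The optimal exponential tilt for the drift `D`. -/
lemma exists_mm1_tilt (D : ℝ) {lam mu : ℝ} (hl : 0 < lam) (hm : 0 < mu) :
    ∃ θ : ℝ, lam * Real.exp θ - mu * Real.exp (-θ) = D ∧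
      lam * (Real.exp θ - 1) + mu * (Real.exp (-θ) - 1) - θ * D = -mm1Cost D lam mu := by
  set r := √(D ^ 2 + 4 * lam * mu) with hr
  have hlm : 0 < lam * mu := mul_pos hl hm
  have hr2 : r ^ 2 = D ^ 2 + 4 * lam * mu := Real.sq_sqrt (by nlinarith [sq_nonneg D])
  have hr0 : 0 ≤ r := Real.sqrt_nonneg _
  have hDr : 0 < D + r := by nlinarith
  -- `w = exp θ` is the positive root of `lam w ^ 2 - D w - mu = 0`, the equation stating that the
  -- tilted drift is `D`.
  set w := (D + r) / (2 * lam) with hw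
  have hw0 : 0 < w := by positivity
  have hquad : lam * w ^ 2 = D * w + mu := by
    rw [hw]; field_simp; linear_combination hr2
  have h1 : lam * w - mu / w = D := by
    field_simp; linear_combination hquad
  have h2 : lam * w + mu / w = r := by
    have : lam * w = (D + r) / 2 := by rw [hw]; field_simp
    linarith
  refine ⟨Real.log w, ?_, ?_⟩
  · rw [Real.exp_neg, Real.exp_log hw0, ← div_eq_mul_inv, h1]
  · rw [Real.exp_neg, Real.exp_log hw0, mm1Cost, ← hr, ← hw, ← h2]
    field_simp; ring

/-- With `h s = 1 - s + s log s ≥ 0` and the optimal `θ`, the cost equals `lam * h (exp θ) + mu * h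
(exp (-θ))`. When `mu = 0` only arrivals matter and the cost is `lam * h (D / lam)`. -/
lemma mm1Cost_nonneg (D lam mu : ℝ) (hl : 0 < lam) (hm : 0 ≤ mu) (h : 0 < mu ∨ 0 ≤ D) :
    0 ≤ mm1Cost D lam mu := by
  rcases hm.eq_or_lt with h0 | hpos
  · subst h0
    have hD : 0 ≤ D := h.resolve_left (lt_irrefl _)
    have hsq : √(D ^ 2 + 4 * lam * 0) = D := by rw [mul_zero, add_zero, Real.sqrt_sq hD]
    rw [mm1Cost, hsq]
    rcases hD.eq_or_lt with h0 | hDpos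
    · rw [← h0]; simpa using hl.le
    · have h1 : (D + D) / (2 * lam) = D / lam := by field_simp; ring
      have h2 := Real.one_sub_inv_le_log_of_pos (div_pos hDpos hl)
      rw [inv_div] at h2
      have h3 := mul_le_mul_of_nonneg_left h2 hD
      have h4 : D * (1 - lam / D) = D - lam := by field_simp
      rw [h1]
      linarith
  · obtain ⟨θ, h1, h2⟩ := exists_mm1_tilt D hl hpos
    have h3 : 0 ≤ 1 - Real.exp θ + θ * Real.exp θ := by
      have h := mul_le_mul_of_nonneg_right (Real.add_one_le_exp (-θ)) (Real.exp_nonneg θ)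
      rw [← Real.exp_add, neg_add_cancel, Real.exp_zero] at h
      linarith
    have h4 : 0 ≤ 1 - Real.exp (-θ) - θ * Real.exp (-θ) := by
      have h := mul_le_mul_of_nonneg_right (Real.add_one_le_exp θ) (Real.exp_nonneg (-θ))
      rw [← Real.exp_add, add_neg_cancel, Real.exp_zero] at h
      linarith
    have h5 := mul_nonneg hl.le h3
    have h6 := mul_nonneg hpos.le h4
    have h7 : θ * D = θ * (lam * Real.exp θ - mu * Real.exp (-θ)) := by rw [h1]
    linarith

lemma continuousAt_mm1Cost (D : ℝ) {lam mu : ℝ} (hl : 0 < lam) (hm : 0 < mu) :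
    ContinuousAt (fun m => mm1Cost D lam m) mu := by
  have hpos : 0 < D + √(D ^ 2 + 4 * lam * mu) := by
    have h1 : |D| < √(D ^ 2 + 4 * lam * mu) := by
      rw [← Real.sqrt_sq_eq_abs]
      exact Real.sqrt_lt_sqrt (sq_nonneg D) (by nlinarith [mul_pos hl hm])
    linarith [neg_abs_le D]
  have hne : (D + √(D ^ 2 + 4 * lam * mu)) / (2 * lam) ≠ 0 := by positivity
  have hs : ContinuousAt (fun m : ℝ => √(D ^ 2 + 4 * lam * m)) mu := by fun_prop
  have hlog : ContinuousAt (fun m : ℝ => Real.log ((D + √(D ^ 2 + 4 * lam * m)) / (2 * lam))) mu :=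
    ContinuousAt.log ((continuousAt_const.add hs).div_const _) hne
  unfold mm1Cost
  exact (((continuousAt_const.mul hlog).add continuousAt_const).add continuousAt_id).sub hs

/-! ### Faces and the continuity of the local rate along a face. -/

namespace StarNetwork

variable {N : ℕ} {S : StarNetwork N}

lemma mem_support {x : S.Active → ℝ} {e : S.Active} : e ∈ support x ↔ 0 < x e := by
  simp [support]

lemma mem_jammed {Λ : Finset S.Active} {e : S.Active} :
    e ∈ jammed Λ ↔ e ∉ Λ ∧ ∃ i, Uses e i ∧ ∃ r ∈ Λ, Uses r i := by
  simp [jammed]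

lemma support_eq_of_mem_face {Λ : Finset S.Active} {x : S.Active → ℝ} (hx : x ∈ face Λ) :
    support x = Λ := by
  ext e
  rw [mem_support]
  by_cases he : e ∈ Λ
  · simp [he, hx.1 e he]
  · simp [he, hx.2 e he]

lemma nonneg_of_mem_face {Λ : Finset S.Active} {x : S.Active → ℝ} (hx : x ∈ face Λ) : 0 ≤ x := by
  intro e
  by_cases he : e ∈ Λ
  · exact (hx.1 e he).le
  · exact (hx.2 e he).ge

lemma mem_face_support {x : S.Active → ℝ} (hx : 0 ≤ x) : x ∈ face (support x) :=
  ⟨fun _ he => mem_support.1 he, fun e he =>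
    le_antisymm (not_lt.1 fun h => he (mem_support.2 h)) (hx e)⟩

lemma continuous_load (i : Fin N) : Continuous fun x : S.Active → ℝ => load x i := by
  unfold load; fun_prop

lemma serviceRate_pos {x : S.Active → ℝ} (hx : 0 ≤ x) {e : S.Active} (he : 0 < x e) :
    0 < serviceRate x e := by
  have hl : ∀ i, Uses e i → 0 < load x i := fun i hi => he.trans_le (le_load hx hi)
  refine mul_pos (S.mu_pos _) (mul_pos he ?_)
  generalize hz : e.1.1 = z
  have h2 : ∀ i ∈ z, 0 < S.cap i / load x i := fun i hi =>
    div_pos (S.cap_pos i) (hl i (by simpa [Uses, hz] using hi))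
  induction z with
  | _ a b =>
    simpa using ⟨h2 a (Sym2.mem_mk_left a b), h2 b (Sym2.mem_mk_right a b)⟩

lemma continuousAt_serviceRate {x : S.Active → ℝ} (hx : 0 ≤ x) {e : S.Active} (he : 0 < x e) :
    ContinuousAt (fun w : S.Active → ℝ => serviceRate w e) x := by
  have hl : ∀ i, Uses e i → 0 < load x i := fun i hi => he.trans_le (le_load hx hi)
  unfold serviceRate
  refine continuousAt_const.mul ((continuous_apply e).continuousAt.mul ?_)
  generalize hz : e.1.1 = z
  have h2 : ∀ i ∈ z, ContinuousAt (fun w : S.Active → ℝ => S.cap i / load w i) x := fun i hi =>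
    continuousAt_const.div (continuous_load i).continuousAt
      (hl i (by simpa [Uses, hz] using hi)).ne'
  induction z with
  | _ a b =>
    simpa using (h2 a (Sym2.mem_mk_left a b)).inf (h2 b (Sym2.mem_mk_right a b))

/-- The routes sharing a link with the support are served at a negligible rate. -/
lemma eventually_serviceRate_lt {x : S.Active → ℝ} (hx : 0 ≤ x) {e : S.Active}
    (he : e ∈ jammed (support x)) {ζ : ℝ} (hζ : 0 < ζ) :
    ∀ᶠ w in 𝓝 x, 0 ≤ w → serviceRate w e < ζ := by
  obtain ⟨he1, i, hi, r, hr, hri⟩ := mem_jammed.1 he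
  have hl : 0 < load x i := (mem_support.1 hr).trans_le (le_load hx hri)
  have hc : ContinuousAt (fun w : S.Active → ℝ => S.mu e.1 * (w e * (S.cap i / load w i))) x :=
    continuousAt_const.mul ((continuous_apply e).continuousAt.mul
      (continuousAt_const.div (continuous_load i).continuousAt hl.ne'))
  have h0 : S.mu e.1 * (x e * (S.cap i / load x i)) < ζ := by
    rw [(mem_face_support hx).2 e he1]; simpa using hζ
  filter_upwards [hc.eventually (gt_mem_nhds h0)] with w hw hw0
  exact (serviceRate_le hw0 hi).trans_lt hw

/-- The contribution of one route to the local rate function. -/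
noncomputable def routeCost (x D : S.Active → ℝ) (e : S.Active) : ℝ :=
  if e ∈ support x then mm1Cost (D e) (S.lam e.1) (serviceRate x e)
  else if e ∈ jammed (support x) then S.lam e.1 else 0

/-- On a jammed route both the drift and the service rate vanish, so the cost reduces to the arrival
rate. -/
lemma localRate_eq_sum {x D : S.Active → ℝ} (hx : 0 ≤ x) (hD : D ∈ driftSpace (support x)) :
    localRate x D = ∑ e, routeCost x D e := by
  unfold localRate
  rw [← Finset.sum_filter_add_sum_filter_not Finset.univ (fun e => e ∈ support x ∪ jammed (support x)),
    Finset.sum_eq_zero (s := Finset.univ.filter fun e => e ∉ support x ∪ jammed (support x)),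
    add_zero]
  · refine Finset.sum_congr (by ext; simp) fun e he => ?_
    unfold routeCost
    split_ifs with h1 h2
    · rfl
    · rw [hD e h1, serviceRate_eq_zero ((mem_face_support hx).2 e h1), mm1Cost_zero_zero]
    · exact absurd (Finset.mem_union.1 (Finset.mem_filter.1 he).2) (by tauto)
  · intro e he
    have he := (Finset.mem_filter.1 he).2
    rw [Finset.mem_union, not_or] at he
    simp [routeCost, he.1, he.2]

lemma eventually_localRate {x D : S.Active → ℝ} (hx : 0 ≤ x) (hD : D ∈ driftSpace (support x))
    {η : ℝ} (hη : 0 < η) :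
    ∀ᶠ x' in 𝓝 x, x' ∈ face (support x) → |localRate x' D - localRate x D| < η := by
  -- The support and the jammed set are frozen at their values at `x`. On the face they are
  -- constant, so this continuous function coincides there with the local rate.
  have hc : ContinuousAt (fun w : S.Active → ℝ => ∑ e, (if e ∈ support x then
      mm1Cost (D e) (S.lam e.1) (serviceRate w e)
      else if e ∈ jammed (support x) then S.lam e.1 else 0)) x := by
    refine tendsto_finsetSum _ fun e _ => ?_
    split_ifs with h1 h2
    · have h3 := mem_support.1 h1
      exact ContinuousAt.comp (g := fun m => mm1Cost (D e) (S.lam e.1) m)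
        (f := fun w : S.Active → ℝ => serviceRate w e)
        (continuousAt_mm1Cost (D e) (lam_pos e) (serviceRate_pos hx h3))
        (continuousAt_serviceRate hx h3)
    · exact tendsto_const_nhds
    · exact tendsto_const_nhds
  filter_upwards [Metric.tendsto_nhds.1 hc η hη] with w hw hwf
  have hs := support_eq_of_mem_face hwf
  rw [localRate_eq_sum (nonneg_of_mem_face hwf) (by rwa [hs]), localRate_eq_sum hx hD]
  simpa only [routeCost, hs, Real.dist_eq] using hw

end StarNetwork

/-! ### The upper bound, by exponential tilting. -/

lemma ereal_mul_log_le {b a : ℝ} (hb : 0 < b) {p : ℝ≥0∞}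
    (h : p ≤ ENNReal.ofReal (Real.exp (a / b))) : (b : EReal) * ENNReal.log p ≤ a := by
  calc (b : EReal) * ENNReal.log p ≤ (b : EReal) * ((a / b : ℝ) : EReal) := by
        refine mul_le_mul_of_nonneg_left ?_ (by exact_mod_cast hb.le)
        refine (ENNReal.log_le_log h).trans ?_
        rw [ENNReal.log_ofReal_of_pos (Real.exp_pos _), Real.log_exp]
    _ = a := by rw [← EReal.coe_mul, mul_div_cancel₀ _ hb.ne']

lemma le_ereal_mul_log {b a : ℝ} (hb : 0 < b) {p : ℝ≥0∞}
    (h : ENNReal.ofReal (Real.exp (a / b)) ≤ p) : (a : EReal) ≤ (b : EReal) * ENNReal.log p := by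
  calc (a : EReal) = (b : EReal) * ((a / b : ℝ) : EReal) := by
        rw [← EReal.coe_mul, mul_div_cancel₀ _ hb.ne']
    _ ≤ (b : EReal) * ENNReal.log p := by
        refine mul_le_mul_of_nonneg_left ?_ (by exact_mod_cast hb.le)
        refine le_trans ?_ (ENNReal.log_le_log h)
        rw [ENNReal.log_ofReal_of_pos (Real.exp_pos _), Real.log_exp]

namespace StarNetwork

variable {N : ℕ} {S : StarNetwork N}

lemma srv_eq_serviceRate_smul (q : S.State) (e : S.Active) {n : ℕ} (hn : 0 < n) :
    srv q e = serviceRate ((n : ℝ)⁻¹ • toReal q) e :=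
  (serviceRate_smul (inv_pos.2 (by exact_mod_cast hn)) _ e).symm

/-- Each jump multiplies the exponential by `exp (± θ e)`. The boundary makes no difference, since
an empty route has service rate zero. -/
lemma generator_exp (θ : S.Active → ℝ) (q : S.State) :
    generator (fun z => Real.exp (∑ e, θ e * toReal z e)) q
      = Real.exp (∑ e, θ e * toReal q e) * ∑ e, (S.lam e.1 * (Real.exp (θ e) - 1)
        + srv q e * (Real.exp (-θ e) - 1)) := by
  rw [generator_eq, Finset.mul_sum]
  refine Finset.sum_congr rfl fun e _ => ?_
  have h1 : ∑ r, θ r * toReal (q + Pi.single e 1) r = ∑ r, θ r * toReal q r + θ e := by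
    have := sum_add_single_sub (fun r m => θ r * (m : ℝ)) q (Finset.mem_univ e)
    unfold toReal
    push_cast at this ⊢
    linarith
  rw [h1, Real.exp_add]
  rcases Nat.eq_zero_or_pos (q e) with h0 | h0
  · rw [srv_eq_zero h0]; ring
  · have h2 : ∑ r, θ r * toReal (q - Pi.single e 1) r = ∑ r, θ r * toReal q r + -θ e := by
      have := sum_sub_single_sub (fun r m => θ r * (m : ℝ)) q (Finset.mem_univ e)
      unfold toReal
      rw [Nat.cast_sub h0] at this
      push_cast at this ⊢
      linarith
    rw [h2, Real.exp_add]
    ring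

/-- Tilts for which the exponential growth rate near `x` is almost minus the local rate. -/
lemma exists_upper_tilt {x D : S.Active → ℝ} (hx : 0 ≤ x) (hD : D ∈ driftSpace (support x))
    {η : ℝ} (hη : 0 < η) :
    ∃ θ : S.Active → ℝ, ∀ᶠ w in 𝓝 x, 0 ≤ w →
      ∑ e, (S.lam e.1 * (Real.exp (θ e) - 1) + serviceRate w e * (Real.exp (-θ e) - 1))
        - ∑ e, θ e * D e ≤ -localRate x D + η := by
  set η' : ℝ := η / (Fintype.card S.Active + 1) with hη'
  have hη'0 : 0 < η' := by positivity
  have hroute : ∀ e : S.Active, ∃ θ : ℝ, ∀ᶠ w in 𝓝 x, 0 ≤ w →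
      S.lam e.1 * (Real.exp θ - 1) + serviceRate w e * (Real.exp (-θ) - 1) - θ * D e
        ≤ -routeCost x D e + η' := by
    intro e
    unfold routeCost
    split_ifs with h1 h2
    · have h3 := mem_support.1 h1
      obtain ⟨θ, -, hθ⟩ := exists_mm1_tilt (D e) (lam_pos e) (serviceRate_pos hx h3)
      refine ⟨θ, ?_⟩
      have hc : ContinuousAt (fun w : S.Active → ℝ => S.lam e.1 * (Real.exp θ - 1)
          + serviceRate w e * (Real.exp (-θ) - 1) - θ * D e) x :=
        (continuousAt_const.add ((continuousAt_serviceRate hx h3).mul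
          continuousAt_const)).sub continuousAt_const
      have hlt : S.lam e.1 * (Real.exp θ - 1) + serviceRate x e * (Real.exp (-θ) - 1) - θ * D e
          < -mm1Cost (D e) (S.lam e.1) (serviceRate x e) + η' := by
        rw [hθ]; linarith
      filter_upwards [hc.eventually (gt_mem_nhds hlt)] with w hw _ using hw.le
    -- On a jammed route `θ` is sent towards `-∞` to gain the full `-λ`. Once `θ` is fixed, the
    -- service rate near `x` is small enough to offset the factor `exp (-θ)`.
    · have hlim : Tendsto (fun θ : ℝ => S.lam e.1 * Real.exp θ) atBot (𝓝 0) := by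
        simpa using Real.tendsto_exp_atBot.const_mul (S.lam e.1)
      obtain ⟨θ, hθ⟩ := (hlim.eventually (gt_mem_nhds (half_pos hη'0))).exists
      refine ⟨θ, ?_⟩
      filter_upwards [eventually_serviceRate_lt hx h2
        (show 0 < η' / 2 * Real.exp θ by positivity)] with w hw hw0
      have h3 := serviceRate_nonneg hw0 e
      have h4 : serviceRate w e * Real.exp (-θ) ≤ η' / 2 := by
        have := mul_le_mul_of_nonneg_right (hw hw0).le (Real.exp_nonneg (-θ))
        rwa [mul_assoc, ← Real.exp_add, add_neg_cancel, Real.exp_zero, mul_one] at this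
      rw [hD e h1]
      linarith
    · refine ⟨0, Eventually.of_forall fun w _ => ?_⟩
      simp [hη'0.le]
  choose θ hθ using hroute
  refine ⟨θ, ?_⟩
  filter_upwards [eventually_all.2 hθ] with w hw hw0
  rw [localRate_eq_sum hx hD, ← Finset.sum_sub_distrib, ← Finset.sum_neg_distrib]
  calc _ ≤ ∑ e : S.Active, (-routeCost x D e + η') := Finset.sum_le_sum fun e _ => hw e hw0
    _ ≤ _ := by
      rw [Finset.sum_add_distrib, Finset.sum_const, nsmul_eq_mul, Finset.card_univ]
      have : (Fintype.card S.Active : ℝ) * η' ≤ η := by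
        rw [hη', mul_div_assoc', div_le_iff₀ (by positivity)]
        linarith
      linarith

lemma abs_sum_mul_le (θ v : S.Active → ℝ) : |∑ e, θ e * v e| ≤ (∑ e, |θ e|) * ‖v‖ := by
  rw [Finset.sum_mul]
  refine (Finset.abs_sum_le_sum_abs _ _).trans (Finset.sum_le_sum fun e _ => ?_)
  rw [abs_mul]
  exact mul_le_mul_of_nonneg_left (norm_le_pi_norm v e) (abs_nonneg _)

section

variable {Ω : Type*} {Q : S.State → ℝ≥0 → Ω → S.State} {x D : S.Active → ℝ}

lemma norm_lt_of_mem_tube {τ δ : ℝ} {n : ℕ} (hn : 0 < n) (hδ : 0 < δ) {y : S.State} {ω : Ω}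
    (h : ω ∈ tube Q x D τ δ n y) {t : ℝ≥0} (ht : (t : ℝ) ≤ n * τ) :
    ‖toReal (Q y t ω) - (n : ℝ) • x - (t : ℝ) • D‖ < δ * n := by
  have h1 : ‖toReal (Q y t ω) - (n : ℝ) • x - (t : ℝ) • D‖ₑ < ENNReal.ofReal (δ * n) :=
    lt_of_le_of_lt (le_iSup₂ (f := fun (t : ℝ≥0) (_ : (t : ℝ) ≤ n * τ) =>
      ‖toReal (Q y t ω) - (n : ℝ) • x - (t : ℝ) • D‖ₑ) t ht) h
  have hn' : (0 : ℝ) < n := by exact_mod_cast hn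
  rwa [← ofReal_norm, ENNReal.ofReal_lt_ofReal_iff (by positivity)] at h1

/-- The gap `r < δ` is needed because a supremum of strictly smaller quantities may reach the bound.
-/
lemma mem_tube_of_norm_le {τ δ r : ℝ} {n : ℕ} (hn : 0 < n) (hr : r < δ) (hr0 : 0 ≤ r)
    {y : S.State} {ω : Ω}
    (h : ∀ t : ℝ≥0, (t : ℝ) ≤ n * τ →
      ‖toReal (Q y t ω) - (n : ℝ) • x - (t : ℝ) • D‖ ≤ r * n) : ω ∈ tube Q x D τ δ n y := by
  have hn' : (0 : ℝ) < n := by exact_mod_cast hn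
  refine lt_of_le_of_lt (b := ENNReal.ofReal (r * n)) (iSup₂_le fun t ht => ?_) ?_
  · rw [← ofReal_norm]
    exact ENNReal.ofReal_le_ofReal (h t ht)
  · exact (ENNReal.ofReal_lt_ofReal_iff (mul_pos (hr0.trans_lt hr) hn')).2
      (mul_lt_mul_of_pos_right hr hn')

variable [MeasurableSpace Ω] {P : Measure Ω} [IsProbabilityMeasure P]

/-- A Chernoff bound: `exp (θ · q)`, cut off outside a ball that contains the tube, grows at rate at
most `c + θ · D`, while its values at both ends of the tube are known up to the factors given by `δ`
and `ε`. The base point `x₀` differs from `x` so that one tilt serves a whole neighbourhood. -/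
lemma measureReal_tube_le (hQ : ∀ y : S.State, IsNetworkProcess P y (Q y)) {x₀ : S.Active → ℝ}
    {θ : S.Active → ℝ} {ρ c : ℝ}
    (hc : ∀ w : S.Active → ℝ, ‖w - x₀‖ < ρ → 0 ≤ w →
      ∑ e, (S.lam e.1 * (Real.exp (θ e) - 1) + serviceRate w e * (Real.exp (-θ e) - 1))
        - ∑ e, θ e * D e ≤ c)
    {τ δ ε : ℝ} (hτ : 0 < τ) (hδ : 0 < δ) (hρ : ‖x - x₀‖ + τ * ‖D‖ + δ ≤ ρ)
    {n : ℕ} (hn : 0 < n) {y : S.State} (hy : ‖toReal y - (n : ℝ) • x‖ < ε * n) :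
    P.real (tube Q x D τ δ n y)
      ≤ Real.exp (n * τ * c + n * ((∑ e, |θ e|) * (δ + ε))) := by
  have hn' : (0 : ℝ) < n := by exact_mod_cast hn
  set A : Set S.State := {q | ‖toReal q - (n : ℝ) • x₀‖ < ρ * n} with hA
  set f : S.State → ℝ := A.indicator fun q => Real.exp (∑ e, θ e * toReal q e) with hf
  set Θ : ℝ := ∑ e, |θ e| with hΘ
  have hΘ0 : 0 ≤ Θ := Finset.sum_nonneg fun _ _ => abs_nonneg _
  set C : ℝ := c + ∑ e, θ e * D e with hC
  set T : ℝ≥0 := ⟨n * τ, by positivity⟩ with hT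
  have hTR : (T : ℝ) = n * τ := rfl
  have hf0 : ∀ q, 0 ≤ f q := fun q => Set.indicator_nonneg (fun _ _ => Real.exp_nonneg _) q
  have hfM : ∀ q, f q ≤ Real.exp (Θ * (‖(n : ℝ) • x₀‖ + ρ * n)) := fun q => by
    refine Set.indicator_apply_le' (fun hq => ?_) fun _ => Real.exp_nonneg _
    refine Real.exp_le_exp.2 ((le_abs_self _).trans ((abs_sum_mul_le θ _).trans
      (mul_le_mul_of_nonneg_left ?_ hΘ0)))
    have h1 : ‖toReal q‖ ≤ ‖toReal q - (n : ℝ) • x₀‖ + ‖(n : ℝ) • x₀‖ := by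
      simpa using norm_add_le (toReal q - (n : ℝ) • x₀) ((n : ℝ) • x₀)
    have h2 : ‖toReal q - (n : ℝ) • x₀‖ < ρ * n := hq
    linarith
  have hgen : ∀ q ∈ A, generator f q ≤ C * f q := by
    intro q hq
    have hfq : f q = Real.exp (∑ e, θ e * toReal q e) := Set.indicator_of_mem hq _
    refine (generator_sub_le (g := fun z => Real.exp (∑ e, θ e * toReal z e)) (fun z =>
      Set.indicator_le_self' (fun _ _ => Real.exp_nonneg _) z) hfq).trans ?_
    rw [generator_exp, ← hfq, mul_comm]
    refine mul_le_mul_of_nonneg_right ?_ (hf0 q)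
    have h1 : ‖(n : ℝ)⁻¹ • toReal q - x₀‖ < ρ := by
      have : (n : ℝ)⁻¹ • toReal q - x₀ = (n : ℝ)⁻¹ • (toReal q - (n : ℝ) • x₀) := by
        rw [smul_sub, smul_smul, inv_mul_cancel₀ hn'.ne', one_smul]
      rw [this, norm_smul, Real.norm_of_nonneg (inv_pos.2 hn').le, inv_mul_lt_iff₀ hn', mul_comm]
      exact hq
    have h2 := hc _ h1 (smul_nonneg (inv_pos.2 hn').le (toReal_nonneg q))
    simp only [srv_eq_serviceRate_smul q _ hn]
    rw [hC]
    linarith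
  have hEA : ∀ ω ∈ tube Q x D τ δ n y, ∀ t ≤ T, Q y t ω ∈ A := by
    intro ω hω t ht
    have ht' : (t : ℝ) ≤ n * τ := by exact_mod_cast ht
    have h1 := norm_lt_of_mem_tube hn hδ hω ht'
    have h2 : toReal (Q y t ω) - (n : ℝ) • x₀ = (toReal (Q y t ω) - (n : ℝ) • x - (t : ℝ) • D)
        + (n : ℝ) • (x - x₀) + (t : ℝ) • D := by
      rw [smul_sub]; abel
    have h3 : ‖(n : ℝ) • (x - x₀)‖ = n * ‖x - x₀‖ := by
      rw [norm_smul, Real.norm_of_nonneg hn'.le]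
    have h4 : ‖(t : ℝ) • D‖ ≤ n * τ * ‖D‖ := by
      rw [norm_smul, Real.norm_of_nonneg (NNReal.coe_nonneg t)]
      exact mul_le_mul_of_nonneg_right ht' (norm_nonneg _)
    show ‖toReal (Q y t ω) - (n : ℝ) • x₀‖ < ρ * n
    rw [h2]
    refine ((norm_add_le _ _).trans (add_le_add_left (norm_add_le _ _) _)).trans_lt ?_
    rw [h3]
    have := mul_le_mul_of_nonneg_right hρ hn'.le
    linarith
  have hEv : ∀ ω ∈ tube Q x D τ δ n y,
      Real.exp (∑ e, θ e * (n * x e + T * D e) - Θ * (δ * n)) ≤ f (Q y T ω) := by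
    intro ω hω
    rw [hf, Set.indicator_of_mem (hEA ω hω T le_rfl)]
    refine Real.exp_le_exp.2 ?_
    have h1 := abs_sum_mul_le θ (toReal (Q y T ω) - (n : ℝ) • x - (T : ℝ) • D)
    have h2 := mul_le_mul_of_nonneg_left (norm_lt_of_mem_tube hn hδ hω hTR.le).le hΘ0
    have h3 : ∑ e, θ e * (toReal (Q y T ω) - (n : ℝ) • x - (T : ℝ) • D) e
        = ∑ e, θ e * toReal (Q y T ω) e - ∑ e, θ e * (n * x e + T * D e) := by
      rw [← Finset.sum_sub_distrib]
      exact Finset.sum_congr rfl fun e _ => by simp; ring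
    rw [h3] at h1
    linarith [(abs_le.1 h1).1]
  have hmain := (hQ y).measureReal_mul_le_exp hf0 hfM hgen T hEA hEv (Real.exp_nonneg _)
  have hfy : f y ≤ Real.exp (∑ e, θ e * (n * x e) + Θ * (ε * n)) := by
    refine Set.indicator_apply_le' (fun _ => ?_) fun _ => Real.exp_nonneg _
    refine Real.exp_le_exp.2 ?_
    have h1 := abs_sum_mul_le θ (toReal y - (n : ℝ) • x)
    have h2 := mul_le_mul_of_nonneg_left hy.le hΘ0
    have h3 : ∑ e, θ e * (toReal y - (n : ℝ) • x) e
        = ∑ e, θ e * toReal y e - ∑ e, θ e * (n * x e) := by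
      rw [← Finset.sum_sub_distrib]
      exact Finset.sum_congr rfl fun e _ => by simp; ring
    rw [h3] at h1
    linarith [(abs_le.1 h1).2]
  have h4 := hmain.trans (mul_le_mul_of_nonneg_left hfy (Real.exp_nonneg _))
  rw [← Real.exp_add, ← le_div_iff₀' (Real.exp_pos _), ← Real.exp_sub] at h4
  refine h4.trans (Real.exp_le_exp.2 (le_of_eq ?_))
  have h5 : ∑ e, θ e * (n * x e + T * D e) = ∑ e, θ e * (n * x e) + T * ∑ e, θ e * D e := by
    rw [Finset.mul_sum, ← Finset.sum_add_distrib]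
    exact Finset.sum_congr rfl fun e _ => by ring
  rw [h5, hTR, hC]
  ring

/-- The upper bound, locally uniformly on the face of `x`. -/
lemma exists_upperRate_le (hQ : ∀ y : S.State, IsNetworkProcess P y (Q y)) (hx : 0 ≤ x)
    (hD : D ∈ driftSpace (support x)) {η : ℝ} (hη : 0 < η) :
    ∃ ρ > 0, ∀ x' ∈ face (support x), ‖x' - x‖ < ρ → ∀ τ, 0 < τ → τ < ρ →
      ∃ δ > 0, ∃ ε > 0,
        upperRate P Q x' D τ δ ε ≤ ((-localRate x' D + η : ℝ) : EReal) := by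
  obtain ⟨θ, hθ⟩ := exists_upper_tilt hx hD (show 0 < η / 4 by positivity)
  obtain ⟨ρ, hρ, hρ'⟩ := Metric.eventually_nhds_iff.1
    (hθ.and (eventually_localRate hx hD (show 0 < η / 4 by positivity)))
  set Θ : ℝ := ∑ e, |θ e| with hΘ
  have hΘ0 : 0 ≤ Θ := Finset.sum_nonneg fun _ _ => abs_nonneg _
  refine ⟨min (ρ / 4) (ρ / (4 * (‖D‖ + 1))), by positivity, fun x' hx'f hx' τ hτ hτρ => ?_⟩
  have hx1 : ‖x' - x‖ < ρ / 4 := hx'.trans_le (min_le_left _ _)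
  have hτ1 : τ * ‖D‖ ≤ ρ / 4 := by
    have h1 := hτρ.trans_le (min_le_right _ _)
    rw [lt_div_iff₀ (by positivity)] at h1
    nlinarith [norm_nonneg D]
  -- The endpoint errors are of order `Θ δ n` and must be small against `η n τ`; this is why `δ`
  -- goes to zero before `τ`. The same number serves as `ε`.
  set δ : ℝ := min (ρ / 4) (η * τ / (4 * (Θ + 1))) with hδ
  have hδ0 : 0 < δ := by positivity
  have hδ1 : δ ≤ ρ / 4 := min_le_left _ _
  have hδ2 : Θ * (δ + δ) ≤ η / 2 * τ := by
    have h1 : δ ≤ η * τ / (4 * (Θ + 1)) := min_le_right _ _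
    rw [le_div_iff₀ (by positivity)] at h1
    nlinarith
  refine ⟨δ, hδ0, δ, hδ0, limsup_le_of_le (by isBoundedDefault) ?_⟩
  filter_upwards [eventually_gt_atTop 0] with n hn
  have hn' : (0 : ℝ) < n := by exact_mod_cast hn
  refine iSup₂_le fun y hy => ereal_mul_log_le (by positivity) ?_
  have h1 := measureReal_tube_le (x := x') (x₀ := x) hQ (θ := θ) (c := -localRate x D + η / 4)
    (ρ := ρ) (fun w hw hw0 => (hρ' (by rwa [dist_eq_norm])).1 hw0) hτ hδ0 (by linarith) hn hy
  have h2 := (abs_lt.1 ((hρ' (y := x') (by rw [dist_eq_norm]; linarith)).2 hx'f)).2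
  rw [← ofReal_measureReal]
  refine ENNReal.ofReal_le_ofReal (h1.trans (Real.exp_le_exp.2 ?_))
  rw [div_div_eq_mul_div, div_one]
  have h3 := mul_le_mul_of_nonneg_left hδ2 hn'.le
  have h4 : n * τ * (-localRate x D + η / 4) ≤ n * τ * (-localRate x' D + η / 2) :=
    mul_le_mul_of_nonneg_left (by linarith) (by positivity)
  linarith

end

end StarNetwork

/-! ### Tilts and barriers for a single route. -/

/-- Factor by which `exp (θ z - β z ^ 2)` grows when `z` increases by one. -/
noncomputable def upRatio (θ β z : ℝ) : ℝ := Real.exp (θ - β * (2 * z + 1))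

/-- Factor by which `exp (θ z - β z ^ 2)` grows when `z` decreases by one. -/
noncomputable def downRatio (θ β z : ℝ) : ℝ := Real.exp (-θ + β * (2 * z - 1))

/-- For a route with rates `lam`, `s` tilted by `exp (θ z - β z ^ 2)` in the frame of drift `D`:
the growth rate of the tilt is at least `γ`, and the relative growth rates of the two barriers at
`± w` are at most `- ξ`, up to an error `κ`. -/
structure RouteBound (lam s D θ β a w z γ ξ κ : ℝ) : Prop where
  growth : γ ≤ lam * (upRatio θ β z - 1) + s * (downRatio θ β z - 1) - D * (θ - 2 * β * z)
  upper : Real.exp (a * (z - w)) * (lam * upRatio θ β z * (Real.exp a - 1)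
    + s * downRatio θ β z * (Real.exp (-a) - 1) - a * D) ≤ -ξ * Real.exp (a * (z - w)) + κ
  lower : Real.exp (-(a * (z + w))) * (lam * upRatio θ β z * (Real.exp (-a) - 1)
    + s * downRatio θ β z * (Real.exp a - 1) + a * D) ≤ -ξ * Real.exp (-(a * (z + w))) + κ

lemma RouteBound.mono {lam s D θ β a w z γ ξ ξ' κ : ℝ}
    (h : RouteBound lam s D θ β a w z γ ξ κ) (hξ : ξ' ≤ ξ) :
    RouteBound lam s D θ β a w z γ ξ' κ where
  growth := h.growth
  upper := h.upper.trans (by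
    have := mul_le_mul_of_nonneg_right hξ (Real.exp_nonneg (a * (z - w)))
    linarith)
  lower := h.lower.trans (by
    have := mul_le_mul_of_nonneg_right hξ (Real.exp_nonneg (-(a * (z + w))))
    linarith)

/-- Used to choose the barrier exponent `a`: the growth rate of a barrier vanishes at `a = 0`, with
derivative the tilted drift relative to the line, counted outwards. -/
lemma eventually_neg_of_hasDerivAt {f : ℝ → ℝ} {d : ℝ} (hf : HasDerivAt f d 0) (h0 : f 0 = 0)
    (hd : d < 0) : ∀ᶠ a in 𝓝[>] (0 : ℝ), f a < 0 := by
  have h1 : ∀ᶠ a in 𝓝[>] (0 : ℝ), slope f 0 a < 0 :=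
    ((hasDerivAt_iff_tendsto_slope.1 hf).eventually (gt_mem_nhds hd)).filter_mono
      (nhdsWithin_mono _ fun a ha => ne_of_gt ha)
  filter_upwards [h1, self_mem_nhdsWithin] with a ha hpos
  rw [slope_def_field, h0, sub_zero, sub_zero] at ha
  have hpos : 0 < a := hpos
  by_contra hcon
  exact absurd ha (not_lt.2 (div_nonneg (not_lt.1 hcon) hpos.le))

lemma eventually_mul_exp_neg_le (K : ℝ) {a κ : ℝ} (ha : 0 < a) (hκ : 0 < κ) :
    ∀ᶠ w : ℝ in atTop, K * Real.exp (-(a * w)) ≤ κ := by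
  have h1 : Tendsto (fun w : ℝ => K * Real.exp (-(a * w))) atTop (𝓝 (K * 0)) :=
    (Real.tendsto_exp_neg_atTop_nhds_zero.comp (tendsto_id.const_mul_atTop ha)).const_mul K
  rw [mul_zero] at h1
  filter_upwards [h1.eventually (gt_mem_nhds hκ)] with w hw using hw.le

/-- A barrier term that is far from the edge contributes little. -/
lemma exp_mul_le_of_far {E k K ξ κ v : ℝ} (hE0 : 0 ≤ E) (hE : E ≤ v) (hk : k ≤ K)
    (hK : 0 ≤ K + ξ) (hv : (K + ξ) * v ≤ κ) : E * k ≤ -ξ * E + κ := by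
  have h1 := mul_le_mul_of_nonneg_left hk hE0
  have h2 := mul_le_mul_of_nonneg_left hE hK
  linarith

lemma exp_mul_le_of_edge {E k ξ κ : ℝ} (hE0 : 0 ≤ E) (hk : k ≤ -ξ) (hκ : 0 ≤ κ) :
    E * k ≤ -ξ * E + κ := by
  have h1 := mul_le_mul_of_nonneg_left hk hE0
  linarith

/-- The order of choice matters. The optimal `θ` gives drift exactly `D`; a small `b` bends the tilt
at a loss below `η` and makes the drift at each edge point strictly inwards; a small `a` then makes
both barriers decrease; `ξ` and `ζ` come from strictness and continuity in `s`. -/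
lemma exists_tilt_parameters (D : ℝ) {lam s₀ η : ℝ} (hl : 0 < lam) (hs : 0 < s₀) (hη : 0 < η) :
    ∃ θ b a ξ ζ : ℝ, 0 < b ∧ 0 < a ∧ 0 < ξ ∧ 0 < ζ ∧ ∀ s, |s - s₀| < ζ →
      -mm1Cost D lam s₀ - η ≤ lam * (Real.exp (θ - 2 * b) - 1) + s * (Real.exp (-θ - 2 * b) - 1)
        - D * θ - b * |D| ∧
      lam * Real.exp (θ - b / 4) * (Real.exp a - 1)
        + s * Real.exp (-θ + b / 4) * (Real.exp (-a) - 1) - a * D ≤ -ξ ∧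
      lam * Real.exp (θ + b / 4) * (Real.exp (-a) - 1)
        + s * Real.exp (-θ - b / 4) * (Real.exp a - 1) + a * D ≤ -ξ := by
  obtain ⟨θ, hθ1, hθ2⟩ := exists_mm1_tilt D hl hs
  have hb : ∀ᶠ b in 𝓝[>] (0 : ℝ), -mm1Cost D lam s₀ - η <
      lam * (Real.exp (θ - 2 * b) - 1) + s₀ * (Real.exp (-θ - 2 * b) - 1) - D * θ - b * |D| := by
    have hc : Continuous fun b : ℝ => lam * (Real.exp (θ - 2 * b) - 1)
        + s₀ * (Real.exp (-θ - 2 * b) - 1) - D * θ - b * |D| := by fun_prop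
    refine (hc.continuousAt.eventually (lt_mem_nhds (a := -mm1Cost D lam s₀ - η)
      ?_)).filter_mono nhdsWithin_le_nhds
    simp only [mul_zero, sub_zero, zero_mul]
    linarith
  obtain ⟨b, hb1, hb0⟩ := (hb.and self_mem_nhdsWithin).exists
  have hb0 : 0 < b := hb0
  have hexp : HasDerivAt (fun a : ℝ => Real.exp a) 1 0 ∧
      HasDerivAt (fun a : ℝ => Real.exp (-a)) (-1) 0 := by
    refine ⟨by simpa using Real.hasDerivAt_exp 0, ?_⟩
    simpa using (hasDerivAt_neg (0 : ℝ)).exp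
  have hup : ∀ᶠ a in 𝓝[>] (0 : ℝ), lam * Real.exp (θ - b / 4) * (Real.exp a - 1)
      + s₀ * Real.exp (-θ + b / 4) * (Real.exp (-a) - 1) - a * D < 0 := by
    refine eventually_neg_of_hasDerivAt (d := lam * Real.exp (θ - b / 4) * 1
      + s₀ * Real.exp (-θ + b / 4) * (-1) - 1 * D) ?_ (by simp) ?_
    · exact (((hexp.1.sub_const 1).const_mul _).add
        ((hexp.2.sub_const 1).const_mul _)).sub ((hasDerivAt_id _).mul_const D)
    · have h1 := mul_lt_mul_of_pos_left
        (Real.exp_lt_exp.2 (show θ - b / 4 < θ by linarith)) hl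
      have h2 := mul_lt_mul_of_pos_left
        (Real.exp_lt_exp.2 (show -θ < -θ + b / 4 by linarith)) hs
      linarith
  have hlo : ∀ᶠ a in 𝓝[>] (0 : ℝ), lam * Real.exp (θ + b / 4) * (Real.exp (-a) - 1)
      + s₀ * Real.exp (-θ - b / 4) * (Real.exp a - 1) + a * D < 0 := by
    refine eventually_neg_of_hasDerivAt (d := lam * Real.exp (θ + b / 4) * (-1)
      + s₀ * Real.exp (-θ - b / 4) * 1 + 1 * D) ?_ (by simp) ?_
    · exact (((hexp.2.sub_const 1).const_mul _).add
        ((hexp.1.sub_const 1).const_mul _)).add ((hasDerivAt_id _).mul_const D)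
    · have h1 := mul_lt_mul_of_pos_left
        (Real.exp_lt_exp.2 (show θ < θ + b / 4 by linarith)) hl
      have h2 := mul_lt_mul_of_pos_left
        (Real.exp_lt_exp.2 (show -θ - b / 4 < -θ by linarith)) hs
      linarith
  obtain ⟨a, ⟨ha1, ha2⟩, ha0⟩ := ((hup.and hlo).and self_mem_nhdsWithin).exists
  obtain ⟨ξ, hξ0, hξ⟩ := exists_between (lt_min (neg_pos.2 ha1) (neg_pos.2 ha2))
  have e2 : ∀ᶠ s in 𝓝 s₀, lam * Real.exp (θ - b / 4) * (Real.exp a - 1)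
      + s * Real.exp (-θ + b / 4) * (Real.exp (-a) - 1) - a * D < -ξ :=
    (show Continuous fun s : ℝ => lam * Real.exp (θ - b / 4) * (Real.exp a - 1)
      + s * Real.exp (-θ + b / 4) * (Real.exp (-a) - 1) - a * D by
        fun_prop).continuousAt.eventually
      (gt_mem_nhds (by linarith [hξ.trans_le (min_le_left _ _)]))
  have e3 : ∀ᶠ s in 𝓝 s₀, lam * Real.exp (θ + b / 4) * (Real.exp (-a) - 1)
      + s * Real.exp (-θ - b / 4) * (Real.exp a - 1) + a * D < -ξ :=
    (show Continuous fun s : ℝ => lam * Real.exp (θ + b / 4) * (Real.exp (-a) - 1)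
      + s * Real.exp (-θ - b / 4) * (Real.exp a - 1) + a * D by
        fun_prop).continuousAt.eventually
      (gt_mem_nhds (by linarith [hξ.trans_le (min_le_right _ _)]))
  have e1 : ∀ᶠ s in 𝓝 s₀, -mm1Cost D lam s₀ - η < lam * (Real.exp (θ - 2 * b) - 1)
      + s * (Real.exp (-θ - 2 * b) - 1) - D * θ - b * |D| :=
    (show Continuous fun s : ℝ => lam * (Real.exp (θ - 2 * b) - 1)
      + s * (Real.exp (-θ - 2 * b) - 1) - D * θ - b * |D| by
        fun_prop).continuousAt.eventually (lt_mem_nhds hb1)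
  obtain ⟨ζ, hζ0, hζ⟩ := Metric.eventually_nhds_iff.1 (e1.and (e2.and e3))
  refine ⟨θ, b, a, ξ, ζ, hb0, ha0, hξ0, hζ0, fun s hs => ?_⟩
  obtain ⟨h1, h2, h3⟩ := hζ (y := s) (by rwa [Real.dist_eq])
  exact ⟨h1.le, h2.le, h3.le⟩

/-- Confinement of a busy route around a line of slope `D` at almost optimal cost. -/
lemma exists_routeBound_busy (D : ℝ) {lam s₀ η : ℝ} (hl : 0 < lam) (hs : 0 < s₀) (hη : 0 < η) :
    ∃ θ b a ξ ζ : ℝ, 0 ≤ b ∧ 0 < a ∧ 0 < ξ ∧ 0 < ζ ∧ ∀ κ > 0, ∀ᶠ w : ℝ in atTop,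
      ∀ z s, |z| < w → 0 ≤ s → |s - s₀| < ζ →
        RouteBound lam s D θ (b / (2 * w)) a w z (-mm1Cost D lam s₀ - η) ξ κ := by
  obtain ⟨θ, b, a, ξ, ζ, hb, ha, hξ, hζ, hpar⟩ := exists_tilt_parameters D hl hs hη
  refine ⟨θ, b, a, ξ, ζ, hb.le, ha, hξ, hζ, fun κ hκ => ?_⟩
  have hea : 0 ≤ Real.exp a - 1 := sub_nonneg.2 (Real.one_le_exp ha.le)
  have hena : Real.exp (-a) - 1 ≤ 0 := sub_nonpos.2 (Real.exp_le_one_iff.2 (by linarith))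
  -- A crude bound for the relative growth of either barrier anywhere in the strip. It suffices far
  -- from the edge, where the barrier is at most `exp (-(a / 2 * w))`.
  set K : ℝ := (lam * Real.exp (θ + 2 * b) + (s₀ + ζ) * Real.exp (-θ + 2 * b))
    * (Real.exp a - 1) + a * |D| with hK
  have hK0 : 0 ≤ K := by positivity
  filter_upwards [eventually_mul_exp_neg_le (K + ξ) (show 0 < a / 2 by positivity) hκ,
    eventually_ge_atTop 2] with w hw1 hw2 z s hz hs0 hsζ
  obtain ⟨hp1, hp2, hp3⟩ := hpar s hsζ
  obtain ⟨hz1, hz2⟩ := abs_lt.1 hz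
  have hw0 : 0 < w := by linarith
  set β := b / (2 * w) with hβ
  have hβ0 : 0 < β := by positivity
  have hβw : 2 * β * w = b := by rw [hβ]; field_simp
  -- Beyond `± w / 2` the bend `2 β z` is at least `b / 2` in size. The discrete correction `β` uses
  -- up at most `b / 4` of it, which leaves the `b / 4` of the edge estimates.
  have hβ4 : β ≤ b / 4 := by
    have := mul_le_mul_of_nonneg_left hw2 hβ0.le
    linarith
  have hβz1 : 2 * β * z ≤ b := by rw [← hβw]; exact mul_le_mul_of_nonneg_left hz2.le (by linarith)
  have hβz2 : -b ≤ 2 * β * z := by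
    rw [← hβw, ← mul_neg]; exact mul_le_mul_of_nonneg_left hz1.le (by linarith)
  have hup1 : Real.exp (θ - 2 * b) ≤ upRatio θ β z := Real.exp_le_exp.2 (by linarith)
  have hup2 : upRatio θ β z ≤ Real.exp (θ + 2 * b) := Real.exp_le_exp.2 (by linarith)
  have hdn1 : Real.exp (-θ - 2 * b) ≤ downRatio θ β z := Real.exp_le_exp.2 (by linarith)
  have hdn2 : downRatio θ β z ≤ Real.exp (-θ + 2 * b) := Real.exp_le_exp.2 (by linarith)
  have hup0 : 0 ≤ upRatio θ β z := Real.exp_nonneg _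
  have hdn0 : 0 ≤ downRatio θ β z := Real.exp_nonneg _
  have hs1 : s ≤ s₀ + ζ := by linarith [(abs_lt.1 hsζ).2]
  have hlu : lam * upRatio θ β z * (Real.exp a - 1)
      ≤ lam * Real.exp (θ + 2 * b) * (Real.exp a - 1) :=
    mul_le_mul_of_nonneg_right (mul_le_mul_of_nonneg_left hup2 hl.le) hea
  have hsd : s * downRatio θ β z * (Real.exp a - 1)
      ≤ (s₀ + ζ) * Real.exp (-θ + 2 * b) * (Real.exp a - 1) :=
    mul_le_mul_of_nonneg_right (mul_le_mul hs1 hdn2 hdn0 (by linarith)) hea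
  have hlu0 : 0 ≤ lam * Real.exp (θ + 2 * b) * (Real.exp a - 1) := by positivity
  have hsd0 : 0 ≤ (s₀ + ζ) * Real.exp (-θ + 2 * b) * (Real.exp a - 1) := by positivity
  have hln : lam * upRatio θ β z * (Real.exp (-a) - 1) ≤ 0 :=
    mul_nonpos_of_nonneg_of_nonpos (by positivity) hena
  have hsn : s * downRatio θ β z * (Real.exp (-a) - 1) ≤ 0 :=
    mul_nonpos_of_nonneg_of_nonpos (by positivity) hena
  have haD := mul_le_mul_of_nonneg_left (neg_abs_le D) ha.le
  have haD' := mul_le_mul_of_nonneg_left (le_abs_self D) ha.le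
  refine ⟨?_, ?_, ?_⟩
  · have h1 := mul_le_mul_of_nonneg_left hup1 hl.le
    have h2 := mul_le_mul_of_nonneg_left hdn1 hs0
    have h3 : |D * (2 * β * z)| ≤ b * |D| := by
      rw [abs_mul, mul_comm b]
      exact mul_le_mul_of_nonneg_left (abs_le.2 ⟨hβz2, hβz1⟩) (abs_nonneg D)
    have h4 := (abs_le.1 h3).1
    linarith
  · rcases le_or_gt (w / 2) z with hedge | hfar
    · refine exp_mul_le_of_edge (Real.exp_nonneg _) (le_trans ?_ hp2) hκ.le
      have h5 : b / 2 ≤ 2 * β * z := by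
        have := mul_le_mul_of_nonneg_left hedge hβ0.le
        linarith
      have h1 : upRatio θ β z ≤ Real.exp (θ - b / 4) := Real.exp_le_exp.2 (by linarith)
      have h2 : Real.exp (-θ + b / 4) ≤ downRatio θ β z := Real.exp_le_exp.2 (by linarith)
      have h3 := mul_le_mul_of_nonneg_right (mul_le_mul_of_nonneg_left h1 hl.le) hea
      have h4 := mul_le_mul_of_nonpos_right (mul_le_mul_of_nonneg_left h2 hs0) hena
      linarith
    · refine exp_mul_le_of_far (K := K) (Real.exp_nonneg _) (Real.exp_le_exp.2 ?_) ?_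
        (by linarith) hw1
      · have := mul_lt_mul_of_pos_left hfar ha
        linarith
      · rw [hK]; linarith
  · rcases le_or_gt z (-(w / 2)) with hedge | hfar
    · refine exp_mul_le_of_edge (Real.exp_nonneg _) (le_trans ?_ hp3) hκ.le
      have h5 : 2 * β * z ≤ -(b / 2) := by
        have := mul_le_mul_of_nonneg_left hedge hβ0.le
        linarith
      have h1 : Real.exp (θ + b / 4) ≤ upRatio θ β z := Real.exp_le_exp.2 (by linarith)
      have h2 : downRatio θ β z ≤ Real.exp (-θ - b / 4) := Real.exp_le_exp.2 (by linarith)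
      have h3 := mul_le_mul_of_nonpos_right (mul_le_mul_of_nonneg_left h1 hl.le) hena
      have h4 := mul_le_mul_of_nonneg_right (mul_le_mul_of_nonneg_left h2 hs0) hea
      linarith
    · refine exp_mul_le_of_far (K := K) (Real.exp_nonneg _) (Real.exp_le_exp.2 ?_) ?_
        (by linarith) hw1
      · have := mul_lt_mul_of_pos_left hfar ha
        linarith
      · rw [hK]; linarith

/-- Confinement near zero of a route that is underloaded when its population is large. -/
lemma exists_routeBound_idle {lam κ₀ : ℝ} (hl : 0 < lam) (hκ₀ : 0 < κ₀) (σ : ℝ) :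
    ∃ a ξ : ℝ, 0 < a ∧ 0 < ξ ∧ ∀ κ > 0, ∀ᶠ w : ℝ in atTop,
      ∀ z s, 0 ≤ z → 0 ≤ s → s ≤ σ → ((1 - κ₀) * w ≤ z → lam * (1 + κ₀) ≤ s) →
        RouteBound lam s 0 0 0 a w z 0 ξ κ := by
  -- With arrival rate `lam` and service rate at least `lam (1 + κ₀)`, any `exp a` strictly between
  -- `1` and `1 + κ₀` makes the upper barrier decrease.
  set a := Real.log (1 + κ₀ / 2) with ha
  have ha0 : 0 < a := Real.log_pos (by linarith)
  have hea : Real.exp a = 1 + κ₀ / 2 := Real.exp_log (by linarith)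
  have hena : Real.exp (-a) = (1 + κ₀ / 2)⁻¹ := by rw [Real.exp_neg, hea]
  set ξ := -(lam * (Real.exp a - 1) + lam * (1 + κ₀) * (Real.exp (-a) - 1)) with hξ
  have hξ0 : 0 < ξ := by
    have : ξ = lam * (κ₀ / 2) * (κ₀ / 2) / (1 + κ₀ / 2) := by
      rw [hξ, hea, hena]; field_simp; ring
    rw [this]; positivity
  have hn : Real.exp (-a) - 1 ≤ 0 := sub_nonpos.2 (Real.exp_le_one_iff.2 (by linarith))
  have hp : 0 ≤ Real.exp a - 1 := by rw [hea]; linarith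
  refine ⟨a, ξ, ha0, hξ0, fun κ hκ => ?_⟩
  set K := (lam + |σ|) * (Real.exp a - 1) with hK
  have hK0 : 0 ≤ K := by positivity
  filter_upwards [eventually_mul_exp_neg_le (K + ξ) (show 0 < a * κ₀ by positivity) hκ,
    eventually_mul_exp_neg_le (K + ξ) ha0 hκ]
    with w hw1 hw2 z s hz0 hs0 hsσ hdrift
  have hup : upRatio 0 0 z = 1 := by simp [upRatio]
  have hdn : downRatio 0 0 z = 1 := by simp [downRatio]
  have hsn : s * (Real.exp (-a) - 1) ≤ 0 := mul_nonpos_of_nonneg_of_nonpos hs0 hn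
  have hln : lam * (Real.exp (-a) - 1) ≤ 0 := mul_nonpos_of_nonneg_of_nonpos hl.le hn
  have hsp : s * (Real.exp a - 1) ≤ |σ| * (Real.exp a - 1) :=
    mul_le_mul_of_nonneg_right (hsσ.trans (le_abs_self σ)) hp
  have hlp : 0 ≤ lam * (Real.exp a - 1) := mul_nonneg hl.le hp
  have hσp : 0 ≤ |σ| * (Real.exp a - 1) := mul_nonneg (abs_nonneg _) hp
  refine ⟨?_, ?_, ?_⟩
  · simp [hup, hdn]
  · simp only [hup, hdn, mul_one, mul_zero, sub_zero]
    rcases le_or_gt ((1 - κ₀) * w) z with hedge | hfar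
    · refine exp_mul_le_of_edge (Real.exp_nonneg _) ?_ hκ.le
      have := mul_le_mul_of_nonpos_right (hdrift hedge) hn
      rw [hξ]; linarith
    · refine exp_mul_le_of_far (K := K) (Real.exp_nonneg _) (Real.exp_le_exp.2 ?_) ?_
        (by linarith) hw1
      · have := mul_lt_mul_of_pos_left hfar ha0
        linarith
      · rw [hK]; linarith
  · simp only [hup, hdn, mul_one, mul_zero, add_zero]
    -- A population is never negative, so the lower edge `-w` is always far.
    refine exp_mul_le_of_far (K := K) (Real.exp_nonneg _) (Real.exp_le_exp.2 ?_) ?_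
      (by linarith) hw2
    · have := mul_nonneg ha0.le hz0
      linarith
    · rw [hK]; linarith

/-! ### The space-time subsolution. -/

namespace StarNetwork

variable {N : ℕ}

/-- Parameters of a space-time subsolution: the routes in `free` are tilted by
`exp (θ z - β z ^ 2)` and confined to `|z| < w`, where `z` is the distance to the line
`m + t D`, while the other routes receive no arrivals once they have reached `M`. -/
structure Confinement (S : StarNetwork N) where
  free : Finset S.Active
  θ : S.Active → ℝ
  β : S.Active → ℝ
  a : S.Active → ℝ
  w : S.Active → ℝ
  m : S.Active → ℝ
  D : S.Active → ℝ
  c : ℝ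
  M : ℝ

namespace Confinement

variable {S : StarNetwork N} (d : Confinement S)

/-- Position of a route relative to its moving target. -/
noncomputable def disp (t : ℝ) (r : S.Active) (k : ℕ) : ℝ := k - d.m r - t * d.D r

/-- The exponential tilt. -/
noncomputable def tilt (t : ℝ) (q : S.State) : ℝ :=
  Real.exp (∑ r ∈ d.free, (d.θ r * d.disp t r (q r) - d.β r * d.disp t r (q r) ^ 2) - d.c * t)

/-- The barrier at the upper edge. -/
noncomputable def upper (t : ℝ) (r : S.Active) (k : ℕ) : ℝ :=
  Real.exp (d.a r * (d.disp t r k - d.w r))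

/-- The barrier at the lower edge. -/
noncomputable def lower (t : ℝ) (r : S.Active) (k : ℕ) : ℝ :=
  Real.exp (-(d.a r * (d.disp t r k + d.w r)))

/-- One minus all the barriers. -/
noncomputable def margin (t : ℝ) (q : S.State) : ℝ :=
  1 - ∑ r ∈ d.free, (d.upper t r (q r) + d.lower t r (q r))

open Classical in
/-- The subsolution. -/
noncomputable def sub (t : ℝ) (q : S.State) : ℝ :=
  if ∀ e ∉ d.free, toReal q e ≤ d.M then d.tilt t q * d.margin t q else 0

/-- The logarithmic time derivative of the tilt. -/
noncomputable def rate (t : ℝ) (q : S.State) : ℝ :=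
  ∑ r ∈ d.free, -(d.D r * (d.θ r - 2 * d.β r * d.disp t r (q r))) - d.c

/-- The time derivative of the margin. -/
noncomputable def marginDeriv (t : ℝ) (q : S.State) : ℝ :=
  ∑ r ∈ d.free, d.a r * d.D r * (d.upper t r (q r) - d.lower t r (q r))

open Classical in
/-- The time derivative of the subsolution. -/
noncomputable def subDeriv (t : ℝ) (q : S.State) : ℝ :=
  if ∀ e ∉ d.free, toReal q e ≤ d.M then
    d.tilt t q * (d.rate t q * d.margin t q + d.marginDeriv t q) else 0

lemma hasDerivAt_disp (r : S.Active) (k : ℕ) (t : ℝ) :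
    HasDerivAt (fun s => d.disp s r k) (-d.D r) t := by
  simpa [disp] using ((hasDerivAt_id t).mul_const (d.D r)).const_sub ((k : ℝ) - d.m r)

lemma hasDerivAt_tilt (q : S.State) (t : ℝ) :
    HasDerivAt (fun s => d.tilt s q) (d.tilt t q * d.rate t q) t := by
  refine HasDerivAt.exp (f := fun s => ∑ r ∈ d.free,
    (d.θ r * d.disp s r (q r) - d.β r * d.disp s r (q r) ^ 2) - d.c * s) ?_
  refine HasDerivAt.sub (HasDerivAt.fun_sum fun r _ => ?_) ?_
  · have h := d.hasDerivAt_disp r (q r) t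
    refine ((h.const_mul (d.θ r)).sub ((h.pow 2).const_mul (d.β r))).congr_deriv ?_
    push_cast; ring
  · simpa using (hasDerivAt_id t).const_mul d.c

lemma hasDerivAt_margin (q : S.State) (t : ℝ) :
    HasDerivAt (fun s => d.margin s q) (d.marginDeriv t q) t := by
  have h : HasDerivAt (fun s => d.margin s q) (-∑ r ∈ d.free,
      (d.upper t r (q r) * (d.a r * -d.D r) + d.lower t r (q r) * -(d.a r * -d.D r))) t := by
    refine HasDerivAt.const_sub 1 (HasDerivAt.fun_sum fun r _ => HasDerivAt.add ?_ ?_)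
    · exact (((d.hasDerivAt_disp r (q r) t).sub_const (d.w r)).const_mul (d.a r)).exp
    · exact (((d.hasDerivAt_disp r (q r) t).add_const (d.w r)).const_mul (d.a r)).neg.exp
  refine h.congr_deriv ?_
  rw [marginDeriv, ← Finset.sum_neg_distrib]
  exact Finset.sum_congr rfl fun r _ => by ring

lemma hasDerivAt_sub (q : S.State) (t : ℝ) :
    HasDerivAt (fun s => d.sub s q) (d.subDeriv t q) t := by
  unfold sub subDeriv
  split_ifs
  · refine ((d.hasDerivAt_tilt q t).mul (d.hasDerivAt_margin q t)).congr_deriv ?_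
    ring
  · exact hasDerivAt_const t 0

lemma continuous_subDeriv (q : S.State) : Continuous fun t => d.subDeriv t q := by
  unfold subDeriv
  split_ifs
  · unfold tilt rate margin marginDeriv upper lower disp
    fun_prop
  · exact continuous_const

lemma tilt_add {e : S.Active} (he : e ∈ d.free) (t : ℝ) (q : S.State) :
    d.tilt t (q + Pi.single e 1)
      = d.tilt t q * upRatio (d.θ e) (d.β e) (d.disp t e (q e)) := by
  have := sum_add_single_sub
    (fun r k => d.θ r * d.disp t r k - d.β r * d.disp t r k ^ 2) q he
  rw [tilt, tilt, upRatio, ← Real.exp_add, eq_add_of_sub_eq this]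
  congr 1
  simp only [disp]
  push_cast
  ring

lemma tilt_sub {e : S.Active} (he : e ∈ d.free) (t : ℝ) {q : S.State} (hq : 0 < q e) :
    d.tilt t (q - Pi.single e 1)
      = d.tilt t q * downRatio (d.θ e) (d.β e) (d.disp t e (q e)) := by
  have := sum_sub_single_sub
    (fun r k => d.θ r * d.disp t r k - d.β r * d.disp t r k ^ 2) q he
  rw [tilt, tilt, downRatio, ← Real.exp_add, eq_add_of_sub_eq this]
  congr 1
  simp only [disp]
  rw [Nat.cast_sub hq]
  push_cast
  ring

lemma margin_add {e : S.Active} (he : e ∈ d.free) (t : ℝ) (q : S.State) :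
    d.margin t (q + Pi.single e 1) = d.margin t q
      - (d.upper t e (q e) * (Real.exp (d.a e) - 1)
        + d.lower t e (q e) * (Real.exp (-d.a e) - 1)) := by
  have h := sum_add_single_sub (fun r k => d.upper t r k + d.lower t r k) q he
  have h1 : d.upper t e (q e + 1) = d.upper t e (q e) * Real.exp (d.a e) := by
    rw [upper, upper, ← Real.exp_add]
    congr 1; simp only [disp]; push_cast; ring
  have h2 : d.lower t e (q e + 1) = d.lower t e (q e) * Real.exp (-d.a e) := by
    rw [lower, lower, ← Real.exp_add]
    congr 1; simp only [disp]; push_cast; ring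
  rw [h1, h2] at h
  rw [margin, margin]
  linarith

lemma margin_sub {e : S.Active} (he : e ∈ d.free) (t : ℝ) {q : S.State} (hq : 0 < q e) :
    d.margin t (q - Pi.single e 1) = d.margin t q
      - (d.upper t e (q e) * (Real.exp (-d.a e) - 1)
        + d.lower t e (q e) * (Real.exp (d.a e) - 1)) := by
  have h := sum_sub_single_sub (fun r k => d.upper t r k + d.lower t r k) q he
  have h1 : d.upper t e (q e - 1) = d.upper t e (q e) * Real.exp (-d.a e) := by
    rw [upper, upper, ← Real.exp_add]
    congr 1; simp only [disp]; rw [Nat.cast_sub hq]; push_cast; ring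
  have h2 : d.lower t e (q e - 1) = d.lower t e (q e) * Real.exp (d.a e) := by
    rw [lower, lower, ← Real.exp_add]
    congr 1; simp only [disp]; rw [Nat.cast_sub hq]; push_cast; ring
  rw [h1, h2] at h
  rw [margin, margin]
  linarith

lemma tilt_pos (t : ℝ) (q : S.State) : 0 < d.tilt t q := Real.exp_pos _

lemma upper_pos (t : ℝ) (r : S.Active) (k : ℕ) : 0 < d.upper t r k := Real.exp_pos _

lemma lower_pos (t : ℝ) (r : S.Active) (k : ℕ) : 0 < d.lower t r k := Real.exp_pos _

lemma sub_eq {t : ℝ} {q : S.State} (hq : ∀ e ∉ d.free, toReal q e ≤ d.M) :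
    d.sub t q = d.tilt t q * d.margin t q := if_pos hq

lemma of_sub_pos {t : ℝ} {q : S.State} (h : 0 < d.sub t q) :
    (∀ e ∉ d.free, toReal q e ≤ d.M) ∧ 0 < d.margin t q := by
  by_cases hq : ∀ e ∉ d.free, toReal q e ≤ d.M
  · rw [d.sub_eq hq] at h
    exact ⟨hq, (pos_iff_pos_of_mul_pos h).1 (d.tilt_pos t q)⟩
  · rw [sub, if_neg hq] at h
    exact absurd h (lt_irrefl 0)

/-- Where the subsolution is positive, the free routes are confined. -/
lemma abs_disp_lt {t : ℝ} {q : S.State} (h : 0 < d.margin t q) {e : S.Active}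
    (he : e ∈ d.free) (ha : 0 < d.a e) : |d.disp t e (q e)| < d.w e := by
  have h1 : d.upper t e (q e) + d.lower t e (q e) < 1 := by
    have := Finset.single_le_sum (f := fun r => d.upper t r (q r) + d.lower t r (q r))
      (fun r _ => (add_pos (d.upper_pos t r _) (d.lower_pos t r _)).le) he
    rw [margin] at h
    linarith
  have h2 : d.upper t e (q e) < 1 := by linarith [d.lower_pos t e (q e)]
  have h3 : d.lower t e (q e) < 1 := by linarith [d.upper_pos t e (q e)]
  rw [upper, Real.exp_lt_one_iff] at h2
  rw [lower, Real.exp_lt_one_iff, neg_lt_zero] at h3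
  rw [abs_lt]
  constructor
  · have := (pos_iff_pos_of_mul_pos h3).1 ha
    linarith
  · have := neg_of_mul_neg_right h2 ha.le
    linarith

/-- Positive parts are bounded below by the function itself, and a jump of a free route preserves
the constraint on the others, so the product formula can be expanded exactly. -/
lemma jump_free {e : S.Active} (he : e ∈ d.free) {t : ℝ} {q : S.State}
    (hq : ∀ r ∉ d.free, toReal q r ≤ d.M) :
    d.tilt t q * (S.lam e.1 * ((upRatio (d.θ e) (d.β e) (d.disp t e (q e)) - 1) * d.margin t q
        - upRatio (d.θ e) (d.β e) (d.disp t e (q e)) * (d.upper t e (q e) * (Real.exp (d.a e) - 1)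
          + d.lower t e (q e) * (Real.exp (-d.a e) - 1)))
      + srv q e * ((downRatio (d.θ e) (d.β e) (d.disp t e (q e)) - 1) * d.margin t q
        - downRatio (d.θ e) (d.β e) (d.disp t e (q e)) * (d.upper t e (q e)
          * (Real.exp (-d.a e) - 1) + d.lower t e (q e) * (Real.exp (d.a e) - 1))))
    ≤ S.lam e.1 * (max (d.sub t (q + Pi.single e 1)) 0 - d.sub t q)
      + srv q e * (max (d.sub t (q - Pi.single e 1)) 0 - d.sub t q) := by
  have hadd : ∀ r ∉ d.free, toReal (q + Pi.single e 1) r ≤ d.M := fun r hr => by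
    have hne : r ≠ e := fun h => hr (h ▸ he)
    simpa [toReal, hne] using hq r hr
  have hsub : ∀ r ∉ d.free, toReal (q - Pi.single e 1) r ≤ d.M := fun r hr => by
    have hne : r ≠ e := fun h => hr (h ▸ he)
    simpa [toReal, hne] using hq r hr
  have h1 := mul_le_mul_of_nonneg_left (sub_le_sub_right
    (le_max_left (d.sub t (q + Pi.single e 1)) 0) (d.sub t q)) (S.lam_nonneg e.1)
  have h2 := mul_le_mul_of_nonneg_left (sub_le_sub_right
    (le_max_left (d.sub t (q - Pi.single e 1)) 0) (d.sub t q)) (srv_nonneg q e)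
  refine le_trans (le_of_eq ?_) (add_le_add h1 h2)
  rw [d.sub_eq hadd, d.sub_eq hsub, d.sub_eq hq, d.tilt_add he, d.margin_add he]
  rcases Nat.eq_zero_or_pos (q e) with h0 | h0
  · rw [srv_eq_zero h0]; ring
  · rw [d.tilt_sub he t h0, d.margin_sub he t h0]; ring

/-- Departures do not change the subsolution, which ignores the coordinate `e` below `M`. The value
after an arrival is merely bounded below by zero, and this loss is the cost `λ` of a jammed route.
-/
lemma jump_not_free {e : S.Active} (he : e ∉ d.free) {t : ℝ} {q : S.State}
    (hq : ∀ r ∉ d.free, toReal q r ≤ d.M) :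
    d.tilt t q * (-S.lam e.1 * d.margin t q)
    ≤ S.lam e.1 * (max (d.sub t (q + Pi.single e 1)) 0 - d.sub t q)
      + srv q e * (max (d.sub t (q - Pi.single e 1)) 0 - d.sub t q) := by
  have hsub : ∀ r ∉ d.free, toReal (q - Pi.single e 1) r ≤ d.M := fun r hr => by
    refine le_trans ?_ (hq r hr)
    simp only [toReal, Pi.sub_apply]
    exact_mod_cast Nat.sub_le _ _
  have hcoord : ∀ r ∈ d.free, (q - Pi.single e 1 : S.State) r = q r := fun r hr => by
    have hne : r ≠ e := fun h => he (h ▸ hr)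
    simp [hne]
  have heq : d.sub t (q - Pi.single e 1) = d.sub t q := by
    rw [d.sub_eq hsub, d.sub_eq hq, tilt, tilt, margin, margin]
    congr 1
    · congr 2
      exact Finset.sum_congr rfl fun r hr => by rw [hcoord r hr]
    · congr 1
      exact Finset.sum_congr rfl fun r hr => by rw [hcoord r hr]
  have h1 := mul_nonneg (S.lam_nonneg e.1) (le_max_right (d.sub t (q + Pi.single e 1)) 0)
  have h2 := mul_le_mul_of_nonneg_left (sub_le_sub_right
    (le_max_left (d.sub t (q - Pi.single e 1)) 0) (d.sub t q)) (srv_nonneg q e)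
  rw [heq, sub_self, mul_zero] at h2
  rw [d.sub_eq hq] at h2 ⊢
  rw [heq, d.sub_eq hq]
  linarith

/-- The subsolution property. -/
lemma subsolution {t : ℝ} {q : S.State} (hq : ∀ r ∉ d.free, toReal q r ≤ d.M)
    (hm : 0 < d.margin t q) {γ : S.Active → ℝ} {ξ κ : ℝ}
    (hb : ∀ e ∈ d.free, RouteBound (S.lam e.1) (srv q e) (d.D e) (d.θ e) (d.β e) (d.a e) (d.w e)
      (d.disp t e (q e)) (γ e) ξ κ)
    (hγ : ξ ≤ ∑ e ∈ d.free, γ e - ∑ e ∈ d.freeᶜ, S.lam e.1 - d.c)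
    (hκ : 2 * d.free.card * κ ≤ ξ) :
    0 ≤ d.subDeriv t q + generator (fun q' => max (d.sub t q') 0) q := by
  have hs0 : 0 < d.sub t q := by
    rw [d.sub_eq hq]; exact mul_pos (d.tilt_pos t q) hm
  set E := d.tilt t q with hE
  set h := d.margin t q with hh
  have hgen : E * (∑ e ∈ d.free, (S.lam e.1 * ((upRatio (d.θ e) (d.β e) (d.disp t e (q e)) - 1) * h
        - upRatio (d.θ e) (d.β e) (d.disp t e (q e)) * (d.upper t e (q e) * (Real.exp (d.a e) - 1)
          + d.lower t e (q e) * (Real.exp (-d.a e) - 1)))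
      + srv q e * ((downRatio (d.θ e) (d.β e) (d.disp t e (q e)) - 1) * h
        - downRatio (d.θ e) (d.β e) (d.disp t e (q e)) * (d.upper t e (q e)
          * (Real.exp (-d.a e) - 1) + d.lower t e (q e) * (Real.exp (d.a e) - 1))))
      + ∑ e ∈ d.freeᶜ, (-S.lam e.1 * h)) ≤ generator (fun q' => max (d.sub t q') 0) q := by
    rw [generator_eq, ← Finset.sum_add_sum_compl d.free, mul_add, Finset.mul_sum, Finset.mul_sum]
    simp only [max_eq_left hs0.le]
    exact add_le_add (Finset.sum_le_sum fun e he => d.jump_free he hq)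
      (Finset.sum_le_sum fun e he => d.jump_not_free (Finset.mem_compl.1 he) hq)
  have hder : d.subDeriv t q = E * (d.rate t q * h + d.marginDeriv t q) := if_pos hq
  rw [hder]
  refine le_trans ?_ (add_le_add le_rfl hgen)
  rw [← mul_add]
  refine mul_nonneg (d.tilt_pos t q).le ?_
  have hroute : ∑ e ∈ d.free, (γ e * h + ξ * (d.upper t e (q e) + d.lower t e (q e)) - 2 * κ)
      ≤ ∑ e ∈ d.free, (-(d.D e * (d.θ e - 2 * d.β e * d.disp t e (q e))) * h
      + d.a e * d.D e * (d.upper t e (q e) - d.lower t e (q e))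
      + (S.lam e.1 * ((upRatio (d.θ e) (d.β e) (d.disp t e (q e)) - 1) * h
        - upRatio (d.θ e) (d.β e) (d.disp t e (q e)) * (d.upper t e (q e) * (Real.exp (d.a e) - 1)
          + d.lower t e (q e) * (Real.exp (-d.a e) - 1)))
      + srv q e * ((downRatio (d.θ e) (d.β e) (d.disp t e (q e)) - 1) * h
        - downRatio (d.θ e) (d.β e) (d.disp t e (q e)) * (d.upper t e (q e)
          * (Real.exp (-d.a e) - 1) + d.lower t e (q e) * (Real.exp (d.a e) - 1))))) := by
    refine Finset.sum_le_sum fun e he => ?_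
    have h1 := mul_le_mul_of_nonneg_right (hb e he).growth hm.le
    have h2 := (hb e he).upper
    have h3 := (hb e he).lower
    rw [← upper.eq_1 d] at h2
    rw [← lower.eq_1 d] at h3
    linarith
  -- The barriers sum to `1 - h`. Their decay contributes `ξ (1 - h)` and the surplus growth of the
  -- tilt at least `ξ h`; together they give `ξ`, which covers the errors `2 κ` per free route.
  have hmar : ∑ e ∈ d.free, (d.upper t e (q e) + d.lower t e (q e)) = 1 - h := by
    rw [hh, margin]; ring
  rw [Finset.sum_sub_distrib, Finset.sum_add_distrib, ← Finset.sum_mul, ← Finset.mul_sum, hmar,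
    Finset.sum_const, nsmul_eq_mul] at hroute
  rw [Finset.sum_add_distrib, Finset.sum_add_distrib, ← Finset.sum_mul] at hroute
  have hneg : ∑ e ∈ d.freeᶜ, -S.lam e.1 = -∑ e ∈ d.freeᶜ, S.lam e.1 :=
    Finset.sum_neg_distrib _
  rw [rate, marginDeriv, ← Finset.sum_mul, hneg]
  have h4 := mul_le_mul_of_nonneg_right hγ hm.le
  linarith

end Confinement

end StarNetwork

/-! ### From the subsolution to probabilities, and the stability of idle routes. -/

namespace StarNetwork

variable {N : ℕ} {S : StarNetwork N}

namespace Confinement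

variable (d : Confinement S)

lemma norm_le_of_sub_pos {R : ℝ} (hR : 0 ≤ R) (ha : ∀ e ∈ d.free, 0 < d.a e)
    (hw : ∀ e ∈ d.free, d.w e ≤ R) (hM : d.M ≤ R) (hm : ∀ e ∉ d.free, d.m e = 0)
    (hD : ∀ e ∉ d.free, d.D e = 0) {t : ℝ} {q : S.State} (h : 0 < d.sub t q) :
    ‖toReal q - d.m - t • d.D‖ ≤ R := by
  obtain ⟨h1, h2⟩ := d.of_sub_pos h
  rw [pi_norm_le_iff_of_nonneg hR]
  intro e
  rw [Real.norm_eq_abs]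
  by_cases he : e ∈ d.free
  · exact ((d.abs_disp_lt h2 he (ha e he)).le).trans (hw e he)
  · have h3 := toReal_nonneg q e
    simp only [Pi.sub_apply, Pi.smul_apply, smul_eq_mul, hm e he, hD e he, mul_zero, sub_zero]
    rw [abs_of_nonneg h3]
    exact (h1 e he).trans hM

lemma sub_le_exp {R : ℝ} (hR : 0 ≤ R) (ha : ∀ e ∈ d.free, 0 < d.a e)
    (hβ : ∀ e ∈ d.free, 0 ≤ d.β e) (hw : ∀ e ∈ d.free, d.w e ≤ R) (t : ℝ) (q : S.State) :
    d.sub t q ≤ Real.exp ((∑ e, |d.θ e|) * R - d.c * t) := by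
  rcases le_or_gt (d.sub t q) 0 with h | h
  · exact h.trans (Real.exp_nonneg _)
  obtain ⟨h1, h2⟩ := d.of_sub_pos h
  rw [d.sub_eq h1]
  have h3 : d.margin t q ≤ 1 := by
    rw [margin, sub_le_self_iff]
    exact Finset.sum_nonneg fun r _ => (add_pos (d.upper_pos t r _) (d.lower_pos t r _)).le
  refine (mul_le_of_le_one_right (d.tilt_pos t q).le h3).trans
    (Real.exp_le_exp.2 (sub_le_sub_right ?_ _))
  calc _ ≤ ∑ r ∈ d.free, |d.θ r| * R := by
        refine Finset.sum_le_sum fun r hr => ?_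
        have h4 := ((d.abs_disp_lt h2 hr (ha r hr)).le).trans (hw r hr)
        have h5 := mul_nonneg (hβ r hr) (sq_nonneg (d.disp t r (q r)))
        have h6 := le_abs_self (d.θ r * d.disp t r (q r))
        rw [abs_mul] at h6
        have h7 := mul_le_mul_of_nonneg_left h4 (abs_nonneg (d.θ r))
        linarith
    _ ≤ _ := by
        rw [Finset.sum_mul]
        exact Finset.sum_le_sum_of_subset_of_nonneg (Finset.subset_univ _)
          fun r _ _ => mul_nonneg (abs_nonneg _) hR

/-- A start in the inner half of the strip keeps every barrier below `exp (-(a w / 2))`, so the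
margin is at least `1 / 2`; the tilt loses only the linear and quadratic terms at distance `v`. -/
lemma le_sub_zero {y : S.State} {v : ℝ} {B : S.Active → ℝ} (hv : ∀ e ∈ d.free, v ≤ d.w e / 2)
    (hβ : ∀ e ∈ d.free, 0 ≤ d.β e) (ha : ∀ e ∈ d.free, 0 < d.a e)
    (hB : ∀ e ∈ d.free, d.β e * v ^ 2 ≤ B e) (hB0 : ∀ e, 0 ≤ B e) (hv0 : 0 ≤ v)
    (hy : ∀ e ∈ d.free, |(y e : ℝ) - d.m e| ≤ v) (hyM : ∀ e ∉ d.free, toReal y e ≤ d.M)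
    (hexp : ∑ e ∈ d.free, 2 * Real.exp (-(d.a e / 2 * d.w e)) ≤ 1 / 2) :
    Real.exp (-((∑ e, |d.θ e|) * v + ∑ e, B e)) * (1 / 2) ≤ d.sub 0 y := by
  have hdisp : ∀ e ∈ d.free, |d.disp 0 e (y e)| ≤ v := fun e he => by
    simpa [disp] using hy e he
  rw [d.sub_eq hyM]
  refine mul_le_mul ?_ ?_ (by norm_num) (d.tilt_pos 0 y).le
  · refine Real.exp_le_exp.2 ?_
    rw [mul_zero, sub_zero, Finset.sum_mul, ← Finset.sum_add_distrib, ← Finset.sum_neg_distrib]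
    calc _ ≤ ∑ e ∈ d.free, -(|d.θ e| * v + B e) := by
          rw [← Finset.sum_add_sum_compl d.free]
          have : ∑ e ∈ d.freeᶜ, -(|d.θ e| * v + B e) ≤ 0 := Finset.sum_nonpos fun e _ =>
            neg_nonpos.2 (add_nonneg (mul_nonneg (abs_nonneg _) hv0) (hB0 e))
          linarith
      _ ≤ _ := by
          refine Finset.sum_le_sum fun e he => ?_
          have h1 := neg_abs_le (d.θ e * d.disp 0 e (y e))
          rw [abs_mul] at h1
          have h2 := mul_le_mul_of_nonneg_left (hdisp e he) (abs_nonneg (d.θ e))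
          have h3 : d.disp 0 e (y e) ^ 2 ≤ v ^ 2 := sq_le_sq' (by
            linarith [(abs_le.1 (hdisp e he)).1]) (abs_le.1 (hdisp e he)).2
          have h4 := mul_le_mul_of_nonneg_left h3 (hβ e he)
          have h5 := hB e he
          linarith
  · rw [margin]
    have h1 : ∑ r ∈ d.free, (d.upper 0 r (y r) + d.lower 0 r (y r))
        ≤ ∑ e ∈ d.free, 2 * Real.exp (-(d.a e / 2 * d.w e)) := by
      refine Finset.sum_le_sum fun e he => ?_
      obtain ⟨h2, h3⟩ := abs_le.1 (hdisp e he)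
      have h6 := hv e he
      have h4 : d.upper 0 e (y e) ≤ Real.exp (-(d.a e / 2 * d.w e)) := by
        refine Real.exp_le_exp.2 ?_
        have := mul_le_mul_of_nonneg_left (h3.trans h6) (ha e he).le
        linarith
      have h5 : d.lower 0 e (y e) ≤ Real.exp (-(d.a e / 2 * d.w e)) := by
        refine Real.exp_le_exp.2 ?_
        have := mul_le_mul_of_nonneg_left ((neg_le_neg h6).trans h2) (ha e he).le
        linarith
      linarith
    linarith

/-- The subsolution is positive only within `R` of the line, hence on a finite box of states up to
time `T`, so the comparison principle applies. -/
lemma le_mul_measureReal_confined {Ω : Type*} [MeasurableSpace Ω] {P : Measure Ω}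
    [IsProbabilityMeasure P] {y : S.State} {X : ℝ≥0 → Ω → S.State}
    (hX : IsNetworkProcess P y X) {R : ℝ} (hR : 0 ≤ R) (ha : ∀ e ∈ d.free, 0 < d.a e)
    (hβ : ∀ e ∈ d.free, 0 ≤ d.β e) (hw : ∀ e ∈ d.free, d.w e ≤ R) (hM : d.M ≤ R)
    (hm : ∀ e ∉ d.free, d.m e = 0) (hD : ∀ e ∉ d.free, d.D e = 0) {T : ℝ≥0} (hT : 0 < T)
    (hpde : ∀ t ∈ Set.Icc 0 (T : ℝ), ∀ q, 0 < d.sub t q →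
      0 ≤ d.subDeriv t q + generator (fun q' => max (d.sub t q') 0) q) :
    d.sub 0 y ≤ Real.exp ((∑ e, |d.θ e|) * R - d.c * T)
      * P.real {ω | ∀ t ≤ T, ‖toReal (X t ω) - d.m - (t : ℝ) • d.D‖ ≤ R} := by
  have hpos := fun {t : ℝ} {q : S.State} (h : 0 < d.sub t q) =>
    d.norm_le_of_sub_pos hR ha hw hM hm hD h
  refine hX.le_mul_measureReal (F := d.sub) (F' := d.subDeriv) d.hasDerivAt_sub
    d.continuous_subDeriv
    (Fintype.piFinset fun _ => Finset.range (⌊R + ‖d.m‖ + T * ‖d.D‖⌋₊ + 1)) ?_ hpde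
    (A := fun t => {q | ‖toReal q - d.m - (t : ℝ) • d.D‖ ≤ R}) ?_ ?_ (Real.exp_nonneg _)
    (d.sub_le_exp hR ha hβ hw T) hT
  · intro t ht q hq
    by_contra hcon
    refine hq (Fintype.mem_piFinset.2 fun e => Finset.mem_range_succ_iff.2 (Nat.le_floor ?_))
    have h1 := hpos (not_le.1 hcon)
    have h2 : ‖toReal q‖ ≤ ‖toReal q - d.m - t • d.D‖ + ‖d.m‖ + ‖t • d.D‖ := by
      have : toReal q = (toReal q - d.m - t • d.D) + d.m + t • d.D := by abel
      calc ‖toReal q‖ = ‖(toReal q - d.m - t • d.D) + d.m + t • d.D‖ := by rw [← this]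
        _ ≤ _ := (norm_add_le _ _).trans (add_le_add_left (norm_add_le _ _) _)
    have h3 : ‖t • d.D‖ ≤ T * ‖d.D‖ := by
      rw [norm_smul, Real.norm_of_nonneg ht.1]
      exact mul_le_mul_of_nonneg_right ht.2 (norm_nonneg _)
    have h4 : (q e : ℝ) ≤ ‖toReal q‖ := (le_abs_self _).trans (norm_le_pi_norm (toReal q) e)
    linarith
  · intro t _ q hq
    exact hpos hq
  · intro q
    have hc : Continuous fun t : ℝ≥0 => ‖toReal q - d.m - (t : ℝ) • d.D‖ := by fun_prop
    exact isClosed_le hc continuous_const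

end Confinement

/-- A route away from the support whose population is large is underloaded, when the populations
of the other such routes are comparable. -/
lemma le_srv_of_idle {Λ : Finset S.Active} {u κ M : ℝ} (hu : 0 < u) (hκ0 : 0 < κ) (hκ1 : κ < 1)
    (hκ : ∀ i, (1 + κ) * (∑ e : S.Active with Uses e i, S.lam e.1 / S.mu e.1 + κ)
      ≤ (1 - κ) * S.cap i) (hM0 : 0 ≤ M) (hM : Fintype.card S.Active * M ≤ κ * u)
    {q : S.State} (hqJ : ∀ f ∈ jammed Λ, (q f : ℝ) ≤ M)
    (hq : ∀ f ∉ Λ, f ∉ jammed Λ → (q f : ℝ) ≤ u * (S.lam f.1 / S.mu f.1))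
    {e : S.Active} (heΛ : e ∉ Λ) (heJ : e ∉ jammed Λ)
    (he : (1 - κ) * (u * (S.lam e.1 / S.mu e.1)) ≤ q e) :
    S.lam e.1 * (1 + κ) ≤ srv q e := by
  have hμ := S.mu_pos e.1
  have hl := lam_pos e
  have hκ1' : 0 < 1 - κ := by linarith
  -- A share of `c` per document suffices: a population of at least `(1 - κ) u λ / μ` is then served
  -- at rate at least `λ (1 + κ)`.
  set c : ℝ := (1 + κ) / ((1 - κ) * u) with hc
  have hc0 : 0 < c := by positivity
  have hqe : 0 < (q e : ℝ) := lt_of_lt_of_le (by positivity) he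
  have hload : ∀ i, Uses e i → c ≤ S.cap i / load (toReal q) i := by
    intro i hi
    have h1 : 0 < load (toReal q) i := hqe.trans_le (le_load (toReal_nonneg q) hi)
    have h2 : load (toReal q) i
        ≤ u * (∑ f : S.Active with Uses f i, S.lam f.1 / S.mu f.1 + κ) := by
      calc load (toReal q) i
          ≤ ∑ f : S.Active with Uses f i, (u * (S.lam f.1 / S.mu f.1) + M) := by
            refine Finset.sum_le_sum fun f hf => ?_
            have hfi : Uses f i := (Finset.mem_filter.1 hf).2
            -- As `e` is not jammed, no route of `Λ` loads its links. The load is at most `u` times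
            -- the sum of `λ / μ`, up to the jammed populations, and `hκ` compares it with the
            -- capacity.
            have hfΛ : f ∉ Λ := fun h => heJ (mem_jammed.2 ⟨heΛ, i, hi, f, h, hfi⟩)
            have h3 : 0 ≤ u * (S.lam f.1 / S.mu f.1) :=
              mul_nonneg hu.le (div_nonneg (S.lam_nonneg _) (S.mu_pos _).le)
            by_cases hfJ : f ∈ jammed Λ
            · have := hqJ f hfJ
              simp only [toReal]; linarith
            · have := hq f hfΛ hfJ
              simp only [toReal]; linarith
        _ ≤ u * ∑ f : S.Active with Uses f i, S.lam f.1 / S.mu f.1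
            + Fintype.card S.Active * M := by
            rw [Finset.sum_add_distrib, ← Finset.mul_sum, Finset.sum_const, nsmul_eq_mul]
            have : ((Finset.univ.filter fun f : S.Active => Uses f i).card : ℝ)
                ≤ Fintype.card S.Active := by exact_mod_cast Finset.card_le_univ _
            have := mul_le_mul_of_nonneg_right this hM0
            linarith
        _ ≤ _ := by linarith
    rw [le_div_iff₀ h1]
    calc c * load (toReal q) i
        ≤ c * (u * (∑ f : S.Active with Uses f i, S.lam f.1 / S.mu f.1 + κ)) :=
          mul_le_mul_of_nonneg_left h2 hc0.le
      _ = ((1 + κ) * (∑ f : S.Active with Uses f i, S.lam f.1 / S.mu f.1 + κ)) / (1 - κ) := by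
          rw [hc]; field_simp
      _ ≤ S.cap i := by
          rw [div_le_iff₀ hκ1']
          linarith [hκ i]
  refine le_trans ?_ (le_serviceRate (toReal_nonneg q) hload)
  have h5 := mul_le_mul_of_nonneg_right he hc0.le
  have h6 : (1 - κ) * (u * (S.lam e.1 / S.mu e.1)) * c = S.lam e.1 / S.mu e.1 * (1 + κ) := by
    rw [hc]; field_simp
  have h7 := mul_le_mul_of_nonneg_left h5 hμ.le
  rw [h6] at h7
  have h8 : S.mu e.1 * (S.lam e.1 / S.mu e.1 * (1 + κ)) = S.lam e.1 * (1 + κ) := by field_simp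
  rw [h8] at h7
  exact h7

/-- At `κ = 0` this is the strict underload of every link, so it survives for small `κ`. -/
lemma exists_slack (hS : S.Ergodic) : ∃ κ : ℝ, 0 < κ ∧ κ < 1 ∧ ∀ i,
    (1 + κ) * (∑ e : S.Active with Uses e i, S.lam e.1 / S.mu e.1 + κ) ≤ (1 - κ) * S.cap i := by
  have h1 : ∀ i, ∀ᶠ κ in 𝓝[>] (0 : ℝ),
      (1 + κ) * (∑ e : S.Active with Uses e i, S.lam e.1 / S.mu e.1 + κ)
        - (1 - κ) * S.cap i < 0 := fun i => by
    have hc : Continuous fun κ : ℝ =>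
        (1 + κ) * (∑ e : S.Active with Uses e i, S.lam e.1 / S.mu e.1 + κ)
          - (1 - κ) * S.cap i := by fun_prop
    refine (hc.continuousAt.eventually (gt_mem_nhds (a := 0) ?_)).filter_mono nhdsWithin_le_nhds
    have := hS.sum_lam_div_mu_lt i
    simpa using this
  have h2 : ∀ᶠ κ in 𝓝[>] (0 : ℝ), κ < 1 :=
    mem_nhdsWithin_of_mem_nhds (Iio_mem_nhds one_pos)
  obtain ⟨κ, ⟨h3, h4⟩, h5⟩ := (((eventually_all.2 h1).and h2).and self_mem_nhdsWithin).exists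
  exact ⟨κ, h5, h4, fun i => by linarith [h3 i]⟩

/-- Confinement parameters of every route, as dictated by the behaviour near `x`. -/
lemma exists_route_parameters {x D : S.Active → ℝ} (hx : 0 ≤ x)
    (hD : D ∈ driftSpace (support x)) {κ₀ : ℝ} (hκ₀ : 0 < κ₀) {η : ℝ} (hη : 0 < η)
    (e : S.Active) : ∃ θ b a ξ ζ : ℝ, 0 ≤ b ∧ 0 < a ∧ 0 < ξ ∧ 0 < ζ ∧
      ∀ κ > 0, ∀ᶠ w : ℝ in atTop, ∀ z (q : S.State), |z| < w →
        (e ∈ support x → |srv q e - serviceRate x e| < ζ) →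
        (e ∉ support x → 0 ≤ z ∧ ((1 - κ₀) * w ≤ z → S.lam e.1 * (1 + κ₀) ≤ srv q e)) →
        RouteBound (S.lam e.1) (srv q e) (D e) θ (b / (2 * w)) a w z
          (-routeCost x D e - η) ξ κ := by
  by_cases he : e ∈ support x
  · obtain ⟨θ, b, a, ξ, ζ, hb, ha, hξ, hζ, h⟩ := exists_routeBound_busy (D e) (lam_pos e)
      (serviceRate_pos hx (mem_support.1 he)) hη
    refine ⟨θ, b, a, ξ, ζ, hb, ha, hξ, hζ, fun κ hκ => ?_⟩
    filter_upwards [h κ hκ] with w hw z q hz h1 _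
    rw [routeCost, if_pos he]
    exact hw z _ hz (srv_nonneg q e) (h1 he)
  · obtain ⟨i, hi⟩ := exists_uses e
    obtain ⟨a, ξ, ha, hξ, h⟩ := exists_routeBound_idle (lam_pos e) hκ₀ (S.mu e.1 * S.cap i)
    refine ⟨0, 0, a, ξ, 1, le_rfl, ha, hξ, one_pos, fun κ hκ => ?_⟩
    filter_upwards [h κ hκ] with w hw z q hz _ h2
    obtain ⟨hz0, hdrift⟩ := h2 he
    have hR := hw z (srv q e) hz0 (srv_nonneg q e)
      (serviceRate_le_cap (toReal_nonneg q) hi) hdrift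
    -- The idle estimate has growth at least `0`, which is stronger than required outside the
    -- support.
    have hcost : 0 ≤ routeCost x D e := by
      rw [routeCost, if_neg he]
      split_ifs
      · exact S.lam_nonneg _
      · exact le_rfl
    rw [hD e he, zero_div]
    exact ⟨le_trans (by linarith) hR.growth, hR.upper, hR.lower⟩

end StarNetwork

/-! ### The lower bound. -/

namespace StarNetwork

variable {N : ℕ} {S : StarNetwork N}

lemma exists_pos_le {ι : Type*} [Finite ι] {f : ι → ℝ} (hf : ∀ i, 0 < f i) {c : ℝ} (hc : 0 < c) :
    ∃ ξ : ℝ, 0 < ξ ∧ ξ ≤ c ∧ ∀ i, ξ ≤ f i := by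
  have h1 : ∀ i, ∀ᶠ ξ in 𝓝[>] (0 : ℝ), ξ < f i := fun i =>
    mem_nhdsWithin_of_mem_nhds (Iio_mem_nhds (hf i))
  have h2 : ∀ᶠ ξ in 𝓝[>] (0 : ℝ), ξ < c := mem_nhdsWithin_of_mem_nhds (Iio_mem_nhds hc)
  obtain ⟨ξ, ⟨h3, h4⟩, h5⟩ := (((eventually_all.2 h1).and h2).and self_mem_nhdsWithin).exists
  exact ⟨ξ, h5, h4.le, fun i => (h3 i).le⟩

lemma norm_inv_smul_sub_lt {x x' D : S.Active → ℝ} {q : S.State} {n : ℕ} (hn : 0 < n)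
    {t τ r ρ : ℝ} (ht0 : 0 ≤ t) (ht : t ≤ n * τ)
    (h : ‖toReal q - (n : ℝ) • x' - t • D‖ ≤ r * n) (hρ : r + ‖x' - x‖ + τ * ‖D‖ < ρ) :
    ‖(n : ℝ)⁻¹ • toReal q - x‖ < ρ := by
  have hn' : (0 : ℝ) < n := by exact_mod_cast hn
  have h1 : (n : ℝ)⁻¹ • toReal q - x
      = (n : ℝ)⁻¹ • ((toReal q - (n : ℝ) • x' - t • D) + (n : ℝ) • (x' - x) + t • D) := by
    have : (toReal q - (n : ℝ) • x' - t • D) + (n : ℝ) • (x' - x) + t • D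
        = toReal q - (n : ℝ) • x := by rw [smul_sub]; abel
    rw [this, smul_sub, smul_smul, inv_mul_cancel₀ hn'.ne', one_smul]
  have h2 : ‖(n : ℝ) • (x' - x)‖ = n * ‖x' - x‖ := by
    rw [norm_smul, Real.norm_of_nonneg hn'.le]
  have h3 : ‖t • D‖ ≤ n * τ * ‖D‖ := by
    rw [norm_smul, Real.norm_of_nonneg ht0]
    exact mul_le_mul_of_nonneg_right ht (norm_nonneg _)
  have h4 := (norm_add_le ((toReal q - (n : ℝ) • x' - t • D) + (n : ℝ) • (x' - x)) (t • D)).trans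
    (add_le_add_left (norm_add_le _ _) _)
  rw [h1, norm_smul, Real.norm_of_nonneg (inv_pos.2 hn').le, inv_mul_lt_iff₀ hn']
  have h5 := mul_lt_mul_of_pos_left hρ hn'
  linarith

variable {Ω : Type*} [MeasurableSpace Ω] {P : Measure Ω} [IsProbabilityMeasure P]
  {Q : S.State → ℝ≥0 → Ω → S.State} {x D : S.Active → ℝ}

/-- The lower bound at a fixed scale `n`, from a confinement of width `v e * n` on each route. -/
lemma exp_le_mul_measureReal_tube (hQ : ∀ y : S.State, IsNetworkProcess P y (Q y))
    {Λ : Finset S.Active} {x' : S.Active → ℝ} (hx' : x' ∈ face Λ) (hD : D ∈ driftSpace Λ)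
    {θ b a v γ : S.Active → ℝ} (hb : ∀ e, 0 ≤ b e) (ha : ∀ e, 0 < a e) (hv : ∀ e, 0 < v e)
    {r ε u κ₀ κ ξ c τ δ ρ : ℝ} (hvr : ∀ e, v e ≤ r) (hr0 : 0 < r) (hrδ : r < δ) (hε : 0 < ε)
    (hεr : ε ≤ r) (hεv : ∀ e, ε ≤ v e / 2) (hu : 0 < u)
    (hvu : ∀ e ∉ Λ, v e = u * (S.lam e.1 / S.mu e.1)) (hεu : Fintype.card S.Active * ε ≤ κ₀ * u)
    (hκ₀ : 0 < κ₀) (hκ₁ : κ₀ < 1)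
    (hslack : ∀ i, (1 + κ₀) * (∑ e : S.Active with Uses e i, S.lam e.1 / S.mu e.1 + κ₀)
      ≤ (1 - κ₀) * S.cap i)
    (hτ : 0 < τ) (hρ : r + ‖x' - x‖ + τ * ‖D‖ < ρ) {n : ℕ} (hn : 0 < n)
    (hroute : ∀ e z (q : S.State), |z| < v e * n → ‖(n : ℝ)⁻¹ • toReal q - x‖ < ρ →
      (e ∉ Λ → 0 ≤ z ∧ ((1 - κ₀) * (v e * n) ≤ z → S.lam e.1 * (1 + κ₀) ≤ srv q e)) →
      RouteBound (S.lam e.1) (srv q e) (D e) (θ e) (b e / (2 * (v e * n))) (a e) (v e * n) z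
        (γ e) ξ κ)
    (hγ : ξ ≤ ∑ e ∈ (jammed Λ)ᶜ, γ e - ∑ e ∈ jammed Λ, S.lam e.1 - c)
    (hκ0 : 0 ≤ κ) (hκ : 2 * Fintype.card S.Active * κ ≤ ξ)
    (hexp : ∀ e, 2 * Real.exp (-(a e / 2 * (v e * n))) ≤ 1 / (2 * (Fintype.card S.Active + 1)))
    {y : S.State} (hy : ‖toReal y - (n : ℝ) • x'‖ < ε * n) :
    Real.exp (-((∑ e, |θ e|) * (ε * n) + ∑ e, b e * (r * n))) * (1 / 2)
      ≤ Real.exp ((∑ e, |θ e|) * (r * n) - c * (n * τ)) * P.real (tube Q x' D τ δ n y) := by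
  have hn' : (0 : ℝ) < n := by exact_mod_cast hn
  have hvn : ∀ e, 0 < v e * n := fun e => mul_pos (hv e) hn'
  have hrn : 0 ≤ r * n := (mul_pos hr0 hn').le
  have hεn : 0 ≤ ε * n := (mul_pos hε hn').le
  -- All routes but the jammed ones are free. Jammed routes start below `ε * n`, and `M = ε * n`
  -- forbids them to exceed it.
  obtain ⟨d, hd⟩ : ∃ d : Confinement S, d =
    { free := (jammed Λ)ᶜ
      θ := θ
      β := fun e => b e / (2 * (v e * n))
      a := a
      w := fun e => v e * n
      m := (n : ℝ) • x'
      D := D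
      c := c
      M := ε * n } := ⟨_, rfl⟩
  have hdfree : d.free = (jammed Λ)ᶜ := by rw [hd]
  have hdθ : d.θ = θ := by rw [hd]
  have hdβ : d.β = fun e => b e / (2 * (v e * n)) := by rw [hd]
  have hda : d.a = a := by rw [hd]
  have hdw : d.w = fun e => v e * n := by rw [hd]
  have hdm : d.m = (n : ℝ) • x' := by rw [hd]
  have hdD : d.D = D := by rw [hd]
  have hdc : d.c = c := by rw [hd]
  have hdM : d.M = ε * n := by rw [hd]
  clear hd
  have hfree : ∀ e, e ∉ d.free ↔ e ∈ jammed Λ := fun e => by simp [hdfree]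
  have hcardle : (d.free.card : ℝ) ≤ Fintype.card S.Active :=
    Nat.cast_le.2 (Finset.card_le_univ _)
  have hjam : ∀ e ∉ d.free, e ∉ Λ := fun e he => (mem_jammed.1 ((hfree e).1 he)).1
  have hwr : ∀ e ∈ d.free, d.w e ≤ r * n := fun e _ => by
    rw [hdw]; exact mul_le_mul_of_nonneg_right (hvr e) hn'.le
  have hMr : d.M ≤ r * n := by
    rw [hdM]; exact mul_le_mul_of_nonneg_right hεr hn'.le
  have hm0 : ∀ e ∉ d.free, d.m e = 0 := fun e he => by
    rw [hdm, Pi.smul_apply, hx'.2 e (hjam e he), smul_zero]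
  have hD0 : ∀ e ∉ d.free, d.D e = 0 := fun e he => by rw [hdD, hD e (hjam e he)]
  have hβ0 : ∀ e ∈ d.free, 0 ≤ d.β e := fun e _ => by
    rw [hdβ]; exact div_nonneg (hb e) (mul_pos two_pos (hvn e)).le
  have ha0 : ∀ e ∈ d.free, 0 < d.a e := fun e _ => by rw [hda]; exact ha e
  have hnτ : 0 < (n : ℝ) * τ := mul_pos hn' hτ
  obtain ⟨T, hTR⟩ : ∃ T : ℝ≥0, (T : ℝ) = n * τ := ⟨⟨n * τ, hnτ.le⟩, rfl⟩
  have hT0 : 0 < T := by rw [← NNReal.coe_pos, hTR]; exact hnτ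
  have hpde : ∀ t ∈ Set.Icc 0 (T : ℝ), ∀ q, 0 < d.sub t q →
      0 ≤ d.subDeriv t q + generator (fun q' => max (d.sub t q') 0) q := by
    intro t ht q hq
    obtain ⟨hqM, hqm⟩ := d.of_sub_pos hq
    have hnorm := d.norm_le_of_sub_pos hrn ha0 hwr hMr hm0 hD0 hq
    rw [hdm, hdD] at hnorm
    rw [hTR] at ht
    have hclose : ‖(n : ℝ)⁻¹ • toReal q - x‖ < ρ :=
      norm_inv_smul_sub_lt hn ht.1 ht.2 hnorm hρ
    have hdisp : ∀ e ∈ d.free, |d.disp t e (q e)| < v e * n := fun e he => by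
      have := d.abs_disp_lt hqm he (ha0 e he)
      rwa [hdw] at this
    have hdisp0 : ∀ e ∉ Λ, d.disp t e (q e) = q e := fun e he => by
      rw [Confinement.disp, hdm, hdD, Pi.smul_apply, hx'.2 e he, hD e he]; simp
    refine d.subsolution (γ := γ) (ξ := ξ) (κ := κ) hqM hqm (fun e he => ?_) ?_ ?_
    · rw [hdD, hdθ, hdβ, hda, hdw]
      refine hroute e _ q (hdisp e he) hclose fun heΛ => ⟨?_, fun hz => ?_⟩
      · rw [hdisp0 e heΛ]; exact Nat.cast_nonneg _
      · have heJ : e ∉ jammed Λ := fun h => (hfree e).2 h he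
        have hve : ∀ f ∉ Λ, v f * n = (u * n) * (S.lam f.1 / S.mu f.1) := fun f hf => by
          rw [hvu f hf]; ring
        refine le_srv_of_idle (Λ := Λ) (M := ε * n) (mul_pos hu hn') hκ₀ hκ₁ hslack hεn ?_
          (fun f hf => ?_) (fun f hf hfJ => ?_) heΛ heJ ?_
        · have := mul_le_mul_of_nonneg_right hεu hn'.le
          linarith
        · rw [← hdM]; exact hqM f ((hfree f).2 hf)
        · have h1 := hdisp f (by_contra fun h => hfJ ((hfree f).1 h))
          rw [hdisp0 f hf, hve f hf] at h1
          exact ((le_abs_self _).trans_lt h1).le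
        · rwa [hdisp0 e heΛ, hve e heΛ] at hz
    · rw [hdfree, compl_compl, hdc]; exact hγ
    · refine le_trans (mul_le_mul_of_nonneg_right ?_ hκ0) hκ
      linarith
  have hupper := d.le_mul_measureReal_confined (hQ y) hrn ha0 hβ0 hwr hMr hm0 hD0 hT0 hpde
  have hycoord : ∀ e, |(y e : ℝ) - n * x' e| ≤ ε * n := fun e =>
    (norm_le_pi_norm (toReal y - (n : ℝ) • x') e).trans hy.le
  have hεvn : ∀ e, ε * n ≤ v e * n / 2 := fun e => by
    have := mul_le_mul_of_nonneg_right (hεv e) hn'.le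
    linarith
  have hlower := d.le_sub_zero (y := y) (v := ε * n) (B := fun e => b e * (r * n))
    (fun e _ => by rw [hdw]; exact hεvn e) hβ0 ha0
    (fun e _ => by
      -- Thus the bend `β z ^ 2` costs at most `b e * (r * n)` at the start, the same order as the
      -- linear tilt over the width of the tube.
      have h3 : (ε * n) ^ 2 ≤ (r * n) * (2 * (v e * n)) := by
        rw [sq]
        exact mul_le_mul (mul_le_mul_of_nonneg_right hεr hn'.le)
          (by linarith [hεvn e, hvn e]) hεn hrn
      rw [hdβ]
      show b e / (2 * (v e * n)) * (ε * n) ^ 2 ≤ b e * (r * n)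
      rw [div_mul_eq_mul_div, div_le_iff₀ (mul_pos two_pos (hvn e)), mul_assoc]
      exact mul_le_mul_of_nonneg_left h3 (hb e))
    (fun e => mul_nonneg (hb e) hrn) hεn
    (fun e _ => by rw [hdm]; exact hycoord e)
    (fun e he => by
      have h1 := hycoord e
      rw [hx'.2 e (hjam e he), mul_zero, sub_zero] at h1
      rw [hdM]
      exact (le_abs_self _).trans h1)
    (by
      rw [hda, hdw]
      calc _ ≤ ∑ e ∈ d.free, 1 / (2 * ((Fintype.card S.Active : ℝ) + 1)) :=
            Finset.sum_le_sum fun e _ => hexp e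
        _ ≤ 1 / 2 := by
          rw [Finset.sum_const, nsmul_eq_mul, mul_one_div, div_le_div_iff₀ (by positivity)
            (by positivity)]
          linarith)
  have hsub : {ω | ∀ t ≤ T, ‖toReal (Q y t ω) - d.m - (t : ℝ) • d.D‖ ≤ r * n}
      ⊆ tube Q x' D τ δ n y := fun ω hω => by
    rw [hdm, hdD] at hω
    exact mem_tube_of_norm_le hn hrδ hr0.le fun t ht =>
      hω t (NNReal.coe_le_coe.1 (by rwa [hTR]))
  rw [hdθ] at hlower
  rw [hdθ, hdc, hTR] at hupper
  exact hlower.trans (hupper.trans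
    (mul_le_mul_of_nonneg_left (measureReal_mono hsub) (Real.exp_nonneg _)))

/-- The lower bound, locally uniformly on the face of `x`. -/
lemma exists_le_lowerRate (hS : S.Ergodic) (hQ : ∀ y : S.State, IsNetworkProcess P y (Q y))
    (hx : 0 ≤ x) (hD : D ∈ driftSpace (support x)) {η : ℝ} (hη : 0 < η) :
    ∃ ρ > 0, ∀ x' ∈ face (support x), ‖x' - x‖ < ρ → ∀ τ, 0 < τ → τ < ρ → ∀ δ, 0 < δ →
      ∃ ε > 0, ((-localRate x' D - η : ℝ) : EReal) ≤ lowerRate P Q x' D τ δ ε := by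
  obtain ⟨κ₀, hκ₀, hκ₁, hslack⟩ := exists_slack hS
  obtain ⟨card, hcard⟩ : ∃ card : ℝ, card = Fintype.card S.Active := ⟨_, rfl⟩
  have hcard0 : 0 ≤ card := hcard ▸ Nat.cast_nonneg _
  choose θ b a ξ ζ hb ha hξ hζ hroute using fun e : S.Active =>
    exists_route_parameters hx hD hκ₀ (show 0 < η / (4 * (card + 1)) by positivity) e
  obtain ⟨ξ₀, hξ₀, hξη, hξle⟩ := exists_pos_le hξ (show 0 < η / 4 by positivity)
  have hnear : ∀ᶠ w in 𝓝 x, ∀ e, e ∈ support x → |serviceRate w e - serviceRate x e| < ζ e :=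
    eventually_all.2 fun e => by
      by_cases he : e ∈ support x
      · filter_upwards [Metric.tendsto_nhds.1
          (continuousAt_serviceRate hx (mem_support.1 he)) (ζ e) (hζ e)] with w hw _ using hw
      · exact Eventually.of_forall fun w h => absurd h he
  obtain ⟨ρ, hρ, hρ'⟩ := Metric.eventually_nhds_iff.1
    (hnear.and (eventually_localRate hx hD (show 0 < η / 8 by positivity)))
  refine ⟨min (ρ / 4) (ρ / (4 * (‖D‖ + 1))), by positivity, fun x' hx'f hx' τ hτ hτρ δ hδ => ?_⟩
  have hx1 : ‖x' - x‖ < ρ / 4 := hx'.trans_le (min_le_left _ _)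
  have hτ1 : τ * ‖D‖ ≤ ρ / 4 := by
    have h1 := hτρ.trans_le (min_le_right _ _)
    rw [lt_div_iff₀ (by positivity)] at h1
    nlinarith [norm_nonneg D]
  obtain ⟨Θ, hΘ⟩ : ∃ Θ : ℝ, Θ = ∑ e, |θ e| := ⟨_, rfl⟩
  have hΘ0 : 0 ≤ Θ := hΘ ▸ Finset.sum_nonneg fun _ _ => abs_nonneg _
  obtain ⟨B, hB⟩ : ∃ B : ℝ, B = ∑ e, b e := ⟨_, rfl⟩
  have hB0 : 0 ≤ B := hB ▸ Finset.sum_nonneg fun e _ => hb e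
  -- the width of the tube
  obtain ⟨r, hr0, hrδ, hrρ, hrη⟩ : ∃ r : ℝ, 0 < r ∧ r < δ ∧ r ≤ ρ / 4 ∧
      (2 * Θ + B) * r ≤ η / 8 * τ := by
    refine ⟨min (δ / 2) (min (ρ / 4) (η * τ / (8 * (2 * Θ + B + 1)))), by positivity,
      (min_le_left _ _).trans_lt (by linarith), (min_le_right _ _).trans (min_le_left _ _), ?_⟩
    have h1 : min (δ / 2) (min (ρ / 4) (η * τ / (8 * (2 * Θ + B + 1))))
        ≤ η * τ / (8 * (2 * Θ + B + 1)) := (min_le_right _ _).trans (min_le_right _ _)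
    have h2 : 0 < min (δ / 2) (min (ρ / 4) (η * τ / (8 * (2 * Θ + B + 1)))) := by positivity
    rw [le_div_iff₀ (by positivity)] at h1
    linarith
  have hfrac : ∀ e : S.Active, 0 < S.lam e.1 / S.mu e.1 := fun e =>
    div_pos (lam_pos e) (S.mu_pos _)
  obtain ⟨u, hu, hu1⟩ : ∃ u : ℝ, 0 < u ∧ ∀ e : S.Active, u * (S.lam e.1 / S.mu e.1) ≤ r := by
    obtain ⟨u, hu, -, hu1⟩ := exists_pos_le
      (fun e : S.Active => div_pos hr0 (hfrac e)) one_pos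
    exact ⟨u, hu, fun e => (le_div_iff₀ (hfrac e)).1 (hu1 e)⟩
  -- Idle routes receive widths proportional to `λ / μ`, the shape for which `le_srv_of_idle` pushes
  -- each of them back from its upper edge whatever the others do inside the box.
  obtain ⟨v, hv0, hvr, hvu⟩ : ∃ v : S.Active → ℝ, (∀ e, 0 < v e) ∧ (∀ e, v e ≤ r) ∧
      ∀ e ∉ support x, v e = u * (S.lam e.1 / S.mu e.1) := by
    refine ⟨fun e => if e ∈ support x then r else u * (S.lam e.1 / S.mu e.1), fun e => ?_,
      fun e => ?_, fun e he => if_neg he⟩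
    · dsimp only
      split_ifs
      · exact hr0
      · exact mul_pos hu (hfrac e)
    · dsimp only
      split_ifs
      · exact le_rfl
      · exact hu1 e
  obtain ⟨ε, hε, hεκ, hεv⟩ := exists_pos_le (f := fun e => v e / 2) (fun e => half_pos (hv0 e))
    (lt_min hr0 (show 0 < κ₀ * u / (card + 1) by positivity))
  have hεr : ε ≤ r := hεκ.trans (min_le_left _ _)
  have hεκ' : card * ε ≤ κ₀ * u := by
    have h1 := hεκ.trans (min_le_right _ _)
    rw [le_div_iff₀ (by positivity)] at h1
    linarith
  refine ⟨ε, hε, le_liminf_of_le (by isBoundedDefault) ?_⟩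
  obtain ⟨κ, hκ0, hκ⟩ : ∃ κ : ℝ, 0 < κ ∧ 2 * card * κ ≤ ξ₀ := by
    refine ⟨ξ₀ / (2 * (card + 1)), by positivity, ?_⟩
    rw [mul_div_assoc', div_le_iff₀ (by positivity)]
    linarith
  have hlimw : ∀ e, Tendsto (fun n : ℕ => v e * (n : ℝ)) atTop atTop := fun e =>
    tendsto_natCast_atTop_atTop.const_mul_atTop (hv0 e)
  have hev1 := eventually_all.2 fun e => (hlimw e).eventually (hroute e κ hκ0)
  have hev2 := eventually_all.2 fun e => (hlimw e).eventually
    (eventually_mul_exp_neg_le 2 (half_pos (ha e))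
      (show 0 < 1 / (2 * ((Fintype.card S.Active : ℝ) + 1)) by positivity))
  have hev3 : ∀ᶠ n : ℕ in atTop, Real.log 2 ≤ η / 8 * τ * n :=
    (tendsto_natCast_atTop_atTop.const_mul_atTop
      (show 0 < η / 8 * τ by positivity)).eventually_ge_atTop _
  filter_upwards [hev1, hev2, hev3, eventually_gt_atTop 0] with n hn1 hn2 hn3 hn
  have hn' : (0 : ℝ) < n := by exact_mod_cast hn
  refine le_iInf₂ fun y hy => le_ereal_mul_log (by positivity) ?_
  -- With `c = -L - η / 2`, the free routes lose at most `η / 4` in total and at least `η / 4 ≥ ξ₀`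
  -- remains.
  have hcost : ξ₀ ≤ ∑ e ∈ (jammed (support x))ᶜ, (-routeCost x D e - η / (4 * (card + 1)))
      - ∑ e ∈ jammed (support x), S.lam e.1 - (-localRate x D - η / 2) := by
    have h1 : ∑ e, routeCost x D e = ∑ e ∈ jammed (support x), S.lam e.1
        + ∑ e ∈ (jammed (support x))ᶜ, routeCost x D e := by
      rw [← Finset.sum_add_sum_compl (jammed (support x))]
      congr 1
      refine Finset.sum_congr rfl fun e he => ?_
      rw [routeCost, if_neg (mem_jammed.1 he).1, if_pos he]
    have h4 : (((jammed (support x))ᶜ.card : ℕ) : ℝ) * (η / (4 * (card + 1))) ≤ η / 4 := by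
      have h5 : (((jammed (support x))ᶜ.card : ℕ) : ℝ) ≤ card := by
        rw [hcard]; exact Nat.cast_le.2 (Finset.card_le_univ _)
      rw [mul_div_assoc', div_le_div_iff₀ (by positivity) (by positivity)]
      nlinarith
    rw [localRate_eq_sum hx hD, h1, Finset.sum_sub_distrib, Finset.sum_neg_distrib,
      Finset.sum_const, nsmul_eq_mul]
    linarith
  have hmain := exp_le_mul_measureReal_tube (P := P) (x := x) (ρ := ρ) hQ hx'f hD hb ha hv0 hvr
    hr0 hrδ hε hεr hεv hu hvu (hcard ▸ hεκ') hκ₀ hκ₁ hslack hτ (by linarith) hn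
    (fun e z q hz hq hidle => (hn1 e z q hz (fun he => by
      rw [srv_eq_serviceRate_smul q e hn]
      exact (hρ' (by rwa [dist_eq_norm])).1 e he) hidle).mono (hξle e))
    hcost hκ0.le (hcard ▸ hκ) hn2 hy
  rw [← hΘ, ← Finset.sum_mul, ← hB, ← div_le_iff₀' (Real.exp_pos _)] at hmain
  rw [← ofReal_measureReal]
  refine ENNReal.ofReal_le_ofReal (le_trans ?_ hmain)
  have h2 : (1 / 2 : ℝ) = Real.exp (-Real.log 2) := by
    rw [Real.exp_neg, Real.exp_log two_pos, one_div]
  rw [h2, ← Real.exp_add, ← Real.exp_sub]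
  refine Real.exp_le_exp.2 ?_
  have h3 := (abs_lt.1 ((hρ' (y := x') (by rw [dist_eq_norm]; linarith)).2 hx'f)).1
  -- Moving from `x'` to `x` uses `η / 8`; the tilt over the tube and the initial factor `1 / 2` use
  -- at most `η / 8` each out of the remaining `3 η / 8`.
  have h4 : n * τ * (-localRate x' D - η) ≤ n * τ * (-localRate x D - η / 2 - 3 * η / 8) :=
    mul_le_mul_of_nonneg_left (by linarith) (by positivity)
  have h5 := mul_le_mul_of_nonneg_right hrη hn'.le
  have h6 : Θ * (ε * n) ≤ Θ * (r * n) :=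
    mul_le_mul_of_nonneg_left (mul_le_mul_of_nonneg_right hεr hn'.le) hΘ0
  have h7 : 0 ≤ η * τ * n := by positivity
  rw [div_div_eq_mul_div, div_one]
  linarith

end StarNetwork

/-! ### Existence of the iterated limits and uniformity on compact sets. -/

lemma ereal_tendsto_coe {ι : Type*} {l : Filter ι} {f : ι → EReal} {c : ℝ}
    (h : ∀ η : ℝ, 0 < η → ∀ᶠ i in l, ((c - η : ℝ) : EReal) ≤ f i ∧ f i ≤ ((c + η : ℝ) : EReal)) :
    Tendsto f l (𝓝 (c : EReal)) := by
  refine tendsto_order.2 ⟨fun a ha => ?_, fun a ha => ?_⟩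
  · obtain ⟨r, h1, h2⟩ := EReal.lt_iff_exists_real_btwn.1 ha
    have h2 : r < c := EReal.coe_lt_coe_iff.1 h2
    filter_upwards [h (c - r) (by linarith)] with i hi
    exact h1.trans_le (by simpa using hi.1)
  · obtain ⟨r, h1, h2⟩ := EReal.lt_iff_exists_real_btwn.1 ha
    have h1 : c < r := EReal.coe_lt_coe_iff.1 h1
    filter_upwards [h (r - c) (by linarith)] with i hi
    exact lt_of_le_of_lt (by simpa using hi.2) h2

namespace StarNetwork

variable {N : ℕ} {S : StarNetwork N} {Ω : Type*} [MeasurableSpace Ω] {P : Measure Ω}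
  {Q : S.State → ℝ≥0 → Ω → S.State} {x D : S.Active → ℝ} {τ : ℝ}

lemma lt_mul_natCast_of_le {a ε ε' : ℝ} (h : ε ≤ ε') {n : ℕ} (ha : a < ε * n) : a < ε' * n :=
  ha.trans_le (mul_le_mul_of_nonneg_right h (Nat.cast_nonneg n))

lemma logProb_mono (hτ : 0 < τ) (n : ℕ) (y : S.State) :
    Monotone fun δ => logProb P Q x D τ δ n y := by
  intro δ δ' h
  refine mul_le_mul_of_nonneg_left (ENNReal.log_le_log (measure_mono fun ω hω => ?_))
    (EReal.coe_nonneg.2 (by positivity))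
  exact lt_of_lt_of_le hω (ENNReal.ofReal_le_ofReal
    (mul_le_mul_of_nonneg_right h (Nat.cast_nonneg n)))

lemma lowerRate_antitone (δ : ℝ) : Antitone (lowerRate P Q x D τ δ) := fun _ _ h =>
  liminf_le_liminf (Eventually.of_forall fun _ => le_iInf₂ fun y hy =>
    iInf₂_le y (lt_mul_natCast_of_le h hy))

lemma upperRate_monotone (δ : ℝ) : Monotone (upperRate P Q x D τ δ) := fun _ _ h =>
  limsup_le_limsup (Eventually.of_forall fun n => iSup₂_le fun y hy =>
    le_iSup₂ (f := fun (y : S.State) _ => logProb P Q x D τ δ n y) y (lt_mul_natCast_of_le h hy))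

lemma lowerRate_monotone_left (hτ : 0 < τ) (ε : ℝ) :
    Monotone fun δ => lowerRate P Q x D τ δ ε := fun _ _ h =>
  liminf_le_liminf (Eventually.of_forall fun n => iInf₂_mono fun y _ => logProb_mono hτ n y h)

lemma upperRate_monotone_left (hτ : 0 < τ) (ε : ℝ) :
    Monotone fun δ => upperRate P Q x D τ δ ε := fun _ _ h =>
  limsup_le_limsup (Eventually.of_forall fun n => iSup₂_mono fun y _ => logProb_mono hτ n y h)

variable (P Q x D τ) in
/-- The iterated limit of the lower rates in `ε` and `δ`. -/
noncomputable def lowerLimit : EReal :=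
  ⨅ δ ∈ Set.Ioi (0 : ℝ), ⨆ ε ∈ Set.Ioi (0 : ℝ), lowerRate P Q x D τ δ ε

variable (P Q x D τ) in
/-- The iterated limit of the upper rates in `ε` and `δ`. -/
noncomputable def upperLimit : EReal :=
  ⨅ δ ∈ Set.Ioi (0 : ℝ), ⨅ ε ∈ Set.Ioi (0 : ℝ), upperRate P Q x D τ δ ε

lemma isInnerLimit_lowerLimit (hτ : 0 < τ) :
    IsInnerLimit (lowerRate P Q x D τ) (lowerLimit P Q x D τ) := by
  refine ⟨fun δ => ⨆ ε ∈ Set.Ioi (0 : ℝ), lowerRate P Q x D τ δ ε, fun δ _ => ?_, ?_⟩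
  · dsimp only
    rw [← sSup_image]
    exact (lowerRate_antitone δ).tendsto_nhdsGT 0
  · rw [lowerLimit, ← sInf_image]
    exact Monotone.tendsto_nhdsGT
      (fun _ _ h => iSup₂_mono fun ε _ => lowerRate_monotone_left hτ ε h) 0

lemma isInnerLimit_upperLimit (hτ : 0 < τ) :
    IsInnerLimit (upperRate P Q x D τ) (upperLimit P Q x D τ) := by
  refine ⟨fun δ => ⨅ ε ∈ Set.Ioi (0 : ℝ), upperRate P Q x D τ δ ε, fun δ _ => ?_, ?_⟩
  · dsimp only
    rw [← sInf_image]
    exact (upperRate_monotone δ).tendsto_nhdsGT 0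
  · rw [upperLimit, ← sInf_image]
    exact Monotone.tendsto_nhdsGT
      (fun _ _ h => iInf₂_mono fun ε _ => upperRate_monotone_left hτ ε h) 0

/-- An infimum is below a supremum only over a nonempty set: for `ε n > 1` the coordinatewise
integer part of `n x` is an admissible starting state. -/
lemma lowerRate_le_upperRate (hx : 0 ≤ x) (δ : ℝ) {ε : ℝ} (hε : 0 < ε) :
    lowerRate P Q x D τ δ ε ≤ upperRate P Q x D τ δ ε := by
  refine (liminf_le_liminf (v := fun n : ℕ => ⨆ (y : S.State)
    (_ : ‖toReal y - (n : ℝ) • x‖ < ε * n), logProb P Q x D τ δ n y) ?_).trans liminf_le_limsup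
  have hev : ∀ᶠ n : ℕ in atTop, 1 < ε * n :=
    (tendsto_natCast_atTop_atTop.const_mul_atTop hε).eventually_gt_atTop 1
  filter_upwards [hev] with n hn
  have hy : ‖toReal (fun e => ⌊(n : ℝ) * x e⌋₊ : S.State) - (n : ℝ) • x‖ < ε * n := by
    refine lt_of_le_of_lt ((pi_norm_le_iff_of_nonneg zero_le_one).2 fun e => ?_) hn
    have h1 := Nat.floor_le (mul_nonneg (Nat.cast_nonneg n) (hx e) : 0 ≤ (n : ℝ) * x e)
    have h2 := Nat.lt_floor_add_one ((n : ℝ) * x e)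
    rw [Real.norm_eq_abs, abs_le]
    simp only [toReal, Pi.sub_apply, Pi.smul_apply, smul_eq_mul]
    constructor <;> linarith
  exact (iInf₂_le (f := fun (y : S.State) (_ : ‖toReal y - (n : ℝ) • x‖ < ε * n) =>
      logProb P Q x D τ δ n y) _ hy).trans
    (le_iSup₂ (f := fun (y : S.State) (_ : ‖toReal y - (n : ℝ) • x‖ < ε * n) =>
      logProb P Q x D τ δ n y) _ hy)

lemma lowerLimit_le_upperLimit (hx : 0 ≤ x) : lowerLimit P Q x D τ ≤ upperLimit P Q x D τ := by
  refine iInf₂_mono fun δ _ => iSup₂_le fun ε hε => le_iInf₂ fun ε' hε' => ?_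
  calc lowerRate P Q x D τ δ ε ≤ lowerRate P Q x D τ δ (min ε ε') :=
        lowerRate_antitone δ (min_le_left _ _)
    _ ≤ upperRate P Q x D τ δ (min ε ε') := lowerRate_le_upperRate hx δ (lt_min hε hε')
    _ ≤ upperRate P Q x D τ δ ε' := upperRate_monotone δ (min_le_right _ _)

variable [IsProbabilityMeasure P]

/-- Both iterated limits are close to minus the local rate, locally uniformly on a face. -/
lemma exists_limit_bounds (hS : S.Ergodic) (hQ : ∀ y : S.State, IsNetworkProcess P y (Q y))
    (hx : 0 ≤ x) (hD : D ∈ driftSpace (support x)) {η : ℝ} (hη : 0 < η) :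
    ∃ ρ > 0, ∀ x' ∈ face (support x), ‖x' - x‖ < ρ → ∀ τ, 0 < τ → τ < ρ →
      ((-localRate x' D - η : ℝ) : EReal) ≤ lowerLimit P Q x' D τ ∧
        upperLimit P Q x' D τ ≤ ((-localRate x' D + η : ℝ) : EReal) := by
  obtain ⟨ρ₁, hρ₁, h₁⟩ := exists_le_lowerRate hS hQ hx hD hη
  obtain ⟨ρ₂, hρ₂, h₂⟩ := exists_upperRate_le hQ hx hD hη
  refine ⟨min ρ₁ ρ₂, lt_min hρ₁ hρ₂, fun x' hx' hxx' τ hτ hτρ => ⟨?_, ?_⟩⟩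
  · refine le_iInf₂ fun δ hδ => ?_
    obtain ⟨ε, hε, h⟩ := h₁ x' hx' (hxx'.trans_le (min_le_left _ _)) τ hτ
      (hτρ.trans_le (min_le_left _ _)) δ hδ
    exact h.trans (le_iSup₂ (f := fun ε (_ : ε ∈ Set.Ioi (0 : ℝ)) =>
      lowerRate P Q x' D τ δ ε) ε hε)
  · obtain ⟨δ, hδ, ε, hε, h⟩ := h₂ x' hx' (hxx'.trans_le (min_le_right _ _)) τ hτ
      (hτρ.trans_le (min_le_right _ _))
    exact (iInf₂_le δ hδ).trans ((iInf₂_le ε hε).trans h)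

lemma exists_uniform_limit_bounds (hS : S.Ergodic)
    (hQ : ∀ y : S.State, IsNetworkProcess P y (Q y)) {Λ : Finset S.Active} (hD : D ∈ driftSpace Λ)
    {K : Set (S.Active → ℝ)} (hK : IsCompact K) (hKΛ : K ⊆ face Λ) {η : ℝ} (hη : 0 < η) :
    ∃ τ₀ > 0, ∀ τ, 0 < τ → τ < τ₀ → ∀ x ∈ K,
      ((-localRate x D - η : ℝ) : EReal) ≤ lowerLimit P Q x D τ ∧
        upperLimit P Q x D τ ≤ ((-localRate x D + η : ℝ) : EReal) := by
  refine hK.induction_on (p := fun s => ∃ τ₀ > 0, ∀ τ, 0 < τ → τ < τ₀ → ∀ x ∈ s,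
      ((-localRate x D - η : ℝ) : EReal) ≤ lowerLimit P Q x D τ ∧
        upperLimit P Q x D τ ≤ ((-localRate x D + η : ℝ) : EReal)) ?_ ?_ ?_ ?_
  · exact ⟨1, one_pos, fun _ _ _ x hx => absurd hx (Set.notMem_empty x)⟩
  · rintro s t hst ⟨τ₀, hτ₀, h⟩
    exact ⟨τ₀, hτ₀, fun τ h1 h2 x hx => h τ h1 h2 x (hst hx)⟩
  · rintro s t ⟨τ₁, hτ₁, h₁⟩ ⟨τ₂, hτ₂, h₂⟩
    refine ⟨min τ₁ τ₂, lt_min hτ₁ hτ₂, fun τ h1 h2 x hx => hx.elim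
      (h₁ τ h1 (h2.trans_le (min_le_left _ _)) x) (h₂ τ h1 (h2.trans_le (min_le_right _ _)) x)⟩
  · intro x hx
    have hs := support_eq_of_mem_face (hKΛ hx)
    -- The radius `ρ` serves both as a neighbourhood in the face and as a threshold for `τ`, so a
    -- finite subcover leaves a positive common threshold.
    obtain ⟨ρ, hρ, h⟩ := exists_limit_bounds hS hQ (nonneg_of_mem_face (hKΛ hx))
      (by rwa [hs] : D ∈ driftSpace (support x)) hη
    refine ⟨Metric.ball x ρ ∩ K, Filter.inter_mem (mem_nhdsWithin_of_mem_nhds (Metric.ball_mem_nhds x hρ)) self_mem_nhdsWithin, ρ, hρ, fun τ h1 h2 x' hx' => ?_⟩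
    exact h x' (by rw [hs]; exact hKΛ hx'.2) (by rw [← dist_eq_norm]; exact hx'.1) τ h1 h2

end StarNetwork

theorem theorem1p2 {N : ℕ} (S : StarNetwork N) (hS : S.Ergodic)
    {Ω : Type*} [MeasurableSpace Ω] (P : Measure Ω) [IsProbabilityMeasure P]
    (Q : S.State → ℝ≥0 → Ω → S.State)
    (hQ : ∀ y : S.State, StarNetwork.IsNetworkProcess P y (Q y)) :
    -- the two iterated limits exist and are both equal to `-L(x, D)`
    (∀ x : S.Active → ℝ, 0 ≤ x →
      ∀ D ∈ StarNetwork.driftSpace (StarNetwork.support x),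
        ∃ a b : ℝ → EReal,
          (∀ τ : ℝ, 0 < τ → IsInnerLimit (StarNetwork.lowerRate P Q x D τ) (a τ)) ∧
          (∀ τ : ℝ, 0 < τ → IsInnerLimit (StarNetwork.upperRate P Q x D τ) (b τ)) ∧
          Tendsto a (𝓝[>] 0) (𝓝 ((-StarNetwork.localRate x D : ℝ) : EReal)) ∧
          Tendsto b (𝓝[>] 0) (𝓝 ((-StarNetwork.localRate x D : ℝ) : EReal))) ∧
    -- for a fixed face and drift, the limits in `τ` are uniform on compact subsets of the face
    (∀ (Λ : Finset S.Active), ∀ D ∈ StarNetwork.driftSpace Λ,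
      ∀ K : Set (S.Active → ℝ), IsCompact K → K ⊆ StarNetwork.face Λ →
        ∀ η : ℝ, 0 < η → ∃ τ₀ : ℝ, 0 < τ₀ ∧ ∀ τ : ℝ, 0 < τ → τ < τ₀ → ∀ x ∈ K,
          ∃ a b : EReal,
            IsInnerLimit (StarNetwork.lowerRate P Q x D τ) a ∧
            IsInnerLimit (StarNetwork.upperRate P Q x D τ) b ∧
            ((-StarNetwork.localRate x D - η : ℝ) : EReal) ≤ a ∧
            a ≤ ((-StarNetwork.localRate x D + η : ℝ) : EReal) ∧
            ((-StarNetwork.localRate x D - η : ℝ) : EReal) ≤ b ∧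
            b ≤ ((-StarNetwork.localRate x D + η : ℝ) : EReal)) ∧
    -- the M/M/1 cost is nonnegative
    (∀ D lam mu : ℝ, 0 < lam → 0 ≤ mu → (0 < mu ∨ 0 ≤ D) → 0 ≤ mm1Cost D lam mu) := by
  refine ⟨fun x hx D hD => ?_, fun Λ D hD K hK hKΛ η hη => ?_, mm1Cost_nonneg⟩
  · have hbd : ∀ η : ℝ, 0 < η → ∀ᶠ τ in 𝓝[>] (0 : ℝ),
        ((-StarNetwork.localRate x D - η : ℝ) : EReal) ≤ StarNetwork.lowerLimit P Q x D τ ∧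
        StarNetwork.upperLimit P Q x D τ ≤ ((-StarNetwork.localRate x D + η : ℝ) : EReal) := by
      intro η hη
      obtain ⟨ρ, hρ, h⟩ := StarNetwork.exists_limit_bounds hS hQ hx hD hη
      filter_upwards [Ioo_mem_nhdsGT hρ] with τ hτ
      exact h x (StarNetwork.mem_face_support hx) (by simpa using hρ) τ hτ.1 hτ.2
    refine ⟨fun τ => StarNetwork.lowerLimit P Q x D τ, fun τ => StarNetwork.upperLimit P Q x D τ,
      fun τ hτ => StarNetwork.isInnerLimit_lowerLimit hτ,
      fun τ hτ => StarNetwork.isInnerLimit_upperLimit hτ,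
      ereal_tendsto_coe fun η hη => ?_, ereal_tendsto_coe fun η hη => ?_⟩
    · filter_upwards [hbd η hη] with τ h
      exact ⟨h.1, (StarNetwork.lowerLimit_le_upperLimit hx).trans h.2⟩
    · filter_upwards [hbd η hη] with τ h
      exact ⟨h.1.trans (StarNetwork.lowerLimit_le_upperLimit hx), h.2⟩
  · obtain ⟨τ₀, hτ₀, h⟩ := StarNetwork.exists_uniform_limit_bounds hS hQ hD hK hKΛ hη
    refine ⟨τ₀, hτ₀, fun τ hτ hτ' x hx => ⟨StarNetwork.lowerLimit P Q x D τ,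
      StarNetwork.upperLimit P Q x D τ, StarNetwork.isInnerLimit_lowerLimit hτ,
      StarNetwork.isInnerLimit_upperLimit hτ, ?_⟩⟩
    have hle : StarNetwork.lowerLimit P Q x D τ ≤ StarNetwork.upperLimit P Q x D τ :=
      StarNetwork.lowerLimit_le_upperLimit (StarNetwork.nonneg_of_mem_face (hKΛ hx))
    obtain ⟨h1, h2⟩ := h τ hτ hτ' x hx
    exact ⟨h1, hle.trans h2, h1.trans hle, h2⟩
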